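/- Let $G$ be a connected real Lie group with identity $e$ and Lie algebra $\mathfrak g=T_eG$ of dimension $n$, and let $V\subset\mathfrak g$ be a linear subspace of dimension $m$. Put $V^1:=V$ and $V^{k+1}:=[V,V^k]=\mathrm{Span}\{[v,w] : v\in V,\ w\in V^k\}$ for $k\ge 1$. Assume that $V$ is bracket-generating of step $s\ge 2$, that is, $$V^1+\cdots+V^{s-1}\subsetneq V^1+\cdots+V^s=\mathfrak g$$ (so that $m<n$ and $n\ge 3$), and that $V$ is nilpotent, that is, $V^k=\{0\}$ for some $k\ge 1$. Let $\Delta(g)=d_eL_g(V)$ be the left-invariant distribution on $G$ generated by $V$, where $L_g(h)=gh$. A horizontal path is an absolutely continuous curve $\gamma:[0,1]\to G$ with derivative in $L^2$ such that $\dot\gamma(t)\in\Delta(\gamma(t))$ for a.e. $t$. Let $\omega$ be the canonical symplectic form of $T^*G$, let $\Delta^\perp=\{(x,p)\in T^*G : p\ne 0,\ p|_{\Delta(x)}=0\}$, and let $\omega^\perp$ be the restriction of $\omega$ to the submanifold $\Delta^\perp$. An abnormal lift of $\gamma$ is an absolutely continuous curve $\psi:[0,1]\to\Delta^\perp$ over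 $\gamma$ with $\dot\psi(t)\in\ker\bigl(\omega^\perp_{\psi(t)}\bigr)$ for a.e. $t$. A horizontal path is singular if it admits an abnormal lift; its corank is the dimension of the vector space spanned by its abnormal lifts, its rank is $n$ minus its corank. For $g\in G$, let $\mathrm{Abn}^m(g)$ be the set of end-points $\gamma(1)$ of the singular horizontal paths $\gamma$ of (minimal) rank $m$ with $\gamma(0)=g$. Finally let $$\mathfrak V=\{v\in V : [v,w]\in V \text{ for all } w\in V\}.$$ Then: 1. $\mathfrak V$ is a proper Lie subalgebra of $\mathfrak g$. 2. $\mathrm{Abn}^m(e)=\exp(\mathfrak V)$, where $\exp:\mathfrak g\to G$ is the exponential map of $G$; this set is a proper subgroup of $G$, and it has Lebesgue measure zero in $G$. 3. $\mathrm{Abn}^m(g)=g\cdot\mathrm{Abn}^m(e)$ for every $g\in G$. 4. Consequently the minimal rank Sard conjecture holds for $\Delta$: for every $g\in G$, the set $\mathrm{Abn}^m(g)$ has Lebesgue measure zero in $G$. -/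

import Mathlib

open Set MeasureTheory Filter Topology Bundle
open scoped Manifold ContDiff

/-! ### Regularity class needed for the Lie algebra of a smooth Lie group -/

instance instLEInftyMinSmoothnessThree : ENat.LEInfty (minSmoothness ℝ 3) where
  out := by
    rw [minSmoothness_of_isRCLikeNormedField]
    exact ENat.LEInfty.out

noncomputable section

/-! ### The cotangent bundle and its canonical symplectic form

`M` is a manifold of dimension `n` (without boundary), modelled on `ℝⁿ`. -/

section Cotangent

variable {n : ℕ} {M : Type*} [TopologicalSpace M] [ChartedSpace (EuclideanSpace ℝ (Fin n)) M]

/-- Points `(x, p)` of the cotangent bundle `T*M`: `x` is a point of `M`, `p` a linear form on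
`T_x M`. -/
abbrev CotangentPoint (n : ℕ) (M : Type*) [TopologicalSpace M]
    [ChartedSpace (EuclideanSpace ℝ (Fin n)) M] : Type _ :=
  Σ x : M, (TangentSpace (𝓡 n) x →L[ℝ] ℝ)

/-- The space `ℝⁿ × (ℝⁿ)*` in which local coordinates `(x, p)` of `T*M` take their values. The
tangent vectors `(ξ, η)` of `T*M`, read in local coordinates, are elements of the same space. -/
abbrev CotangentModel (n : ℕ) : Type :=
  EuclideanSpace ℝ (Fin n) × (EuclideanSpace ℝ (Fin n) →L[ℝ] ℝ)

/-- The canonical coordinates of `T*M` induced by the chart `φ` of `M` at `x₀`: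
`(x, p) ↦ (φ x, p ∘ (dφ_x)⁻¹)`. They are meaningful when `x` is in the domain of `φ`. -/
def cotangentCoord (x₀ : M) (a : CotangentPoint n M) : CotangentModel n :=
  (extChartAt (𝓡 n) x₀ a.1,
    a.2.comp (mfderiv (𝓡 n) 𝓘(ℝ, EuclideanSpace ℝ (Fin n))
      (extChartAt (𝓡 n) x₀ : M → EuclideanSpace ℝ (Fin n)) a.1).inverse)

/-- The canonical symplectic form `ω = ∑ dxᵢ ∧ dpᵢ` in canonical coordinates of `T*M`. -/
def symplecticForm (ζ ζ' : CotangentModel n) : ℝ := ζ'.2 ζ.1 - ζ.2 ζ'.1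

/-- A curve in `T*M` is absolutely continuous on `[0,1]` if, around every time of `[0,1]`, its
expression in canonical coordinates is. -/
def IsACCotangent (ψ : ℝ → CotangentPoint n M) : Prop :=
  ∀ t₀ ∈ Icc (0 : ℝ) 1, ∃ a b : ℝ, Icc a b ⊆ Icc 0 1 ∧ Icc a b ∈ 𝓝[Icc (0 : ℝ) 1] t₀ ∧
    (∀ t ∈ Icc a b, (ψ t).1 ∈ (extChartAt (𝓡 n) (ψ t₀).1).source) ∧
    AbsolutelyContinuousOnInterval (fun t => cotangentCoord (ψ t₀).1 (ψ t)) a b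

/-! ### Distributions, horizontal paths, singular horizontal paths -/

/-- The nonzero annihilator `Δ^⊥ ⊆ T*M` of a distribution `Δ`. -/
def nonzeroAnnihilator (Δ : ∀ x : M, Submodule ℝ (TangentSpace (𝓡 n) x)) :
    Set (CotangentPoint n M) :=
  {a | a.2 ≠ 0 ∧ ∀ v ∈ Δ a.1, a.2 v = 0}

/-- The tangent space of `Δ^⊥` at `a`, read in the canonical coordinates of `T*M` induced by the
preferred chart of `M` at the base point of `a`: the velocities at `a` of the curves of `T*M` which
are contained in `Δ^⊥`. -/
def annihilatorTangent (Δ : ∀ x : M, Submodule ℝ (TangentSpace (𝓡 n) x))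
    (a : CotangentPoint n M) : Set (CotangentModel n) :=
  {ζ | ∃ c : ℝ → CotangentPoint n M, c 0 = a ∧
    (∀ s, c s ∈ nonzeroAnnihilator Δ ∧ (c s).1 ∈ (extChartAt (𝓡 n) a.1).source) ∧
    HasDerivAt (fun s => cotangentCoord a.1 (c s)) ζ 0}

/-- The kernel at `a ∈ Δ^⊥` of the restriction `ω^⊥` of the symplectic form to `Δ^⊥`, read in the
canonical coordinates induced by the preferred chart of `M` at the base point of `a`. -/
def kerRestrictedForm (Δ : ∀ x : M, Submodule ℝ (TangentSpace (𝓡 n) x))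
    (a : CotangentPoint n M) : Set (CotangentModel n) :=
  {ζ | ζ ∈ annihilatorTangent Δ a ∧ ∀ ζ' ∈ annihilatorTangent Δ a, symplecticForm ζ ζ' = 0}

/-- `γ : [0,1] → M` is a horizontal path: it is absolutely continuous with derivative in `L²` (in
charts) and almost everywhere tangent to `Δ`. The values of `γ` outside `[0,1]` are irrelevant. -/
def IsHorizontalPath (Δ : ∀ x : M, Submodule ℝ (TangentSpace (𝓡 n) x)) (γ : ℝ → M) : Prop :=
  (∀ t₀ ∈ Icc (0 : ℝ) 1, ∃ a b : ℝ, Icc a b ⊆ Icc 0 1 ∧ Icc a b ∈ 𝓝[Icc (0 : ℝ) 1] t₀ ∧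
    (∀ t ∈ Icc a b, γ t ∈ (extChartAt (𝓡 n) (γ t₀)).source) ∧
    AbsolutelyContinuousOnInterval (fun t => extChartAt (𝓡 n) (γ t₀) (γ t)) a b ∧
    MemLp (deriv fun t => extChartAt (𝓡 n) (γ t₀) (γ t)) 2 (volume.restrict (Icc a b))) ∧
  ∀ᵐ t ∂(volume.restrict (Icc (0 : ℝ) 1)),
    ∃ v ∈ Δ (γ t), HasMFDerivAt 𝓘(ℝ, ℝ) (𝓡 n) γ t ((1 : ℝ →L[ℝ] ℝ).smulRight v)

/-- `t ↦ (γ t, p t)` is an abnormal lift of `γ : [0,1] → M`: an absolutely continuous curve with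
values in `Δ^⊥` whose derivative is almost everywhere in the kernel of `ω^⊥`. -/
def IsAbnormalLift (Δ : ∀ x : M, Submodule ℝ (TangentSpace (𝓡 n) x)) (γ : ℝ → M)
    (p : ∀ t : ℝ, TangentSpace (𝓡 n) (γ t) →L[ℝ] ℝ) : Prop :=
  (∀ t ∈ Icc (0 : ℝ) 1, (⟨γ t, p t⟩ : CotangentPoint n M) ∈ nonzeroAnnihilator Δ) ∧
  IsACCotangent (fun t => (⟨γ t, p t⟩ : CotangentPoint n M)) ∧
  ∀ᵐ t ∂(volume.restrict (Icc (0 : ℝ) 1)), ∃ ζ ∈ kerRestrictedForm Δ ⟨γ t, p t⟩,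
    HasDerivAt (fun s => cotangentCoord (γ t) (⟨γ s, p s⟩ : CotangentPoint n M)) ζ t

/-- A singular horizontal path is a horizontal path which admits an abnormal lift. -/
def IsSingularPath (Δ : ∀ x : M, Submodule ℝ (TangentSpace (𝓡 n) x)) (γ : ℝ → M) : Prop :=
  IsHorizontalPath Δ γ ∧ ∃ p, IsAbnormalLift Δ γ p

/-- The vector space (of covector fields along `γ : [0,1] → M`) spanned by the abnormal lifts of
`γ`. -/
def abnormalLiftSpace (Δ : ∀ x : M, Submodule ℝ (TangentSpace (𝓡 n) x)) (γ : ℝ → M) :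
    Submodule ℝ (∀ t : Icc (0 : ℝ) 1, TangentSpace (𝓡 n) (γ t) →L[ℝ] ℝ) :=
  Submodule.span ℝ {q | ∃ p, IsAbnormalLift Δ γ p ∧ ∀ t : Icc (0 : ℝ) 1, q t = p t}

/-- The corank of a horizontal path: the dimension of its space of abnormal lifts. -/
def pathCorank (Δ : ∀ x : M, Submodule ℝ (TangentSpace (𝓡 n) x)) (γ : ℝ → M) : ℕ :=
  Module.finrank ℝ (abnormalLiftSpace Δ γ)

/-- `Abn^r(x)`: the end-points of the singular horizontal paths of rank `r` starting at `x`, where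
the rank is `n` minus the corank. -/
def abnSet (Δ : ∀ x : M, Submodule ℝ (TangentSpace (𝓡 n) x)) (r : ℕ) (x : M) : Set M :=
  {y | ∃ γ : ℝ → M, γ 0 = x ∧ γ 1 = y ∧ IsSingularPath Δ γ ∧ r + pathCorank Δ γ = n}

/-- A subset of a smooth `n`-dimensional manifold has Lebesgue measure zero if its image in every
smooth chart has. -/
def IsLebesgueNull (n : ℕ) {M : Type*} [TopologicalSpace M]
    [ChartedSpace (EuclideanSpace ℝ (Fin n)) M] (S : Set M) : Prop :=
  ∀ e ∈ IsManifold.maximalAtlas (𝓡 n) ∞ M, volume (e '' (S ∩ e.source)) = 0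

/-- The minimal rank Sard conjecture for a distribution `Δ` of rank `m`. -/
def MinimalRankSard (Δ : ∀ x : M, Submodule ℝ (TangentSpace (𝓡 n) x)) (m : ℕ) : Prop :=
  ∀ x : M, IsLebesgueNull n (abnSet Δ m x)

end Cotangent

/-! ### Polarized groups -/

section Polarized

variable {n : ℕ} {G : Type*} [TopologicalSpace G] [ChartedSpace (EuclideanSpace ℝ (Fin n)) G]
  [Group G]

/-- The left-invariant distribution `Δ(g) = d_eL_g(V)`. -/
def leftInvariantDistribution (V : Submodule ℝ (GroupLieAlgebra (𝓡 n) G)) (g : G) :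
    Submodule ℝ (TangentSpace (𝓡 n) g) :=
  V.map (mfderiv (𝓡 n) (𝓡 n) (fun h : G => g * h) 1).toLinearMap

/-- The exponential map of `G`: `exp v = c 1`, with `c` the integral curve of the left-invariant
vector field generated by `v` such that `c 0 = 1`. -/
def groupExp (v : GroupLieAlgebra (𝓡 n) G) : G :=
  (Classical.epsilon fun c : ℝ → G =>
    c 0 = 1 ∧ IsMIntegralCurve (I := 𝓡 n) c (mulInvariantVectorField v)) 1

/-- `bracketPower V k` is `V^(k+1)`, where `V^1 = V` and `V^(k+1) = [V, V^k]`. -/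
def bracketPower (V : Submodule ℝ (GroupLieAlgebra (𝓡 n) G)) :
    ℕ → Submodule ℝ (GroupLieAlgebra (𝓡 n) G)
  | 0 => V
  | k + 1 => Submodule.span ℝ {u | ∃ v ∈ V, ∃ w ∈ bracketPower V k, ⁅v, w⁆ = u}

/-- `bracketSum V k` is `V^1 + ⋯ + V^k`. -/
def bracketSum (V : Submodule ℝ (GroupLieAlgebra (𝓡 n) G)) (k : ℕ) :
    Submodule ℝ (GroupLieAlgebra (𝓡 n) G) :=
  ∑ i ∈ Finset.range k, bracketPower V i

/-- `V` is bracket-generating of step `s`: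
`V^1 + ⋯ + V^(s-1) ⊊ V^1 + ⋯ + V^s = 𝔤`. -/
def IsBracketGeneratingOfStep (V : Submodule ℝ (GroupLieAlgebra (𝓡 n) G)) (s : ℕ) : Prop :=
  bracketSum V (s - 1) ≠ ⊤ ∧ bracketSum V s = ⊤

/-- `V` is nilpotent: `V^k = {0}` for some `k ≥ 1`. -/
def IsBracketNilpotent (V : Submodule ℝ (GroupLieAlgebra (𝓡 n) G)) : Prop :=
  ∃ k, bracketPower V k = ⊥

/-- The set `𝔙 = {v ∈ V | [v, V] ⊆ V}`. -/
def stabilizerSet (V : Submodule ℝ (GroupLieAlgebra (𝓡 n) G)) :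
    Set (GroupLieAlgebra (𝓡 n) G) :=
  {v | v ∈ V ∧ ∀ w ∈ V, ⁅v, w⁆ ∈ V}

end Polarized

end

/-! Left translations trivialize `T*G`: a covector `p` at `x` becomes `l = p ∘ dL_x`, and `Δ^⊥`
becomes the product of `G` with the nonzero annihilator of `V`. On velocities `(z, ν)`, `(z', ν')`
of the pair `(x, l)`, the symplectic form is `ν' z - ν z' + l [z, z']` (`symplecticForm_eq`).
Pairing the velocity of an abnormal lift of a path with control `u` against the directions `(z',
0)`, which are tangent to `Δ^⊥`, gives `l' = l ∘ ad u`, hence `l = μ ∘ Ad γ` with `μ` constant. So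
the abnormal lifts of `γ` are the nonzero `μ` that vanish on every `Ad(γ t) V`
(`abnormalLiftSpace_eq`), and the rank of `γ` is the dimension of the sum of these spaces. It takes
its minimal value `m` exactly when `Ad(γ t) V` does not depend on `t` (`mem_abnSet_iff`).

For `γ 0 = 1` this says `Ad(γ t) V = V`. Differentiating gives `[u, V] ⊆ V`, so the control takes
its values in `𝔙`, a subalgebra by the Jacobi identity. Conversely the curves `exp (t v)` with `v ∈
𝔙` preserve `V`.

It remains to see that a curve issued from `1` with control in a subalgebra `H` ends in `exp H`. One
looks for it as `exp x` with `Φ(x) x' = u`, where `Φ(x) = (1 - exp(-ad x)) / ad x` is a polynomial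
in `ad x` by nilpotency and is the identity up to terms lower in the filtration. Picard iteration
gains one step of the filtration each time, hence becomes stationary, and it never leaves `H`
(`exists_dexpSeries_eq`, `mem_exp_image_of_control`). The same argument makes `exp H` a group.

Finally `exp` is differentiable everywhere (`exp_expansion`, by following `exp(-tv) exp(t(v + w))`
for `t` in `[0,1]`), so it sends the proper subspace `𝔙` to a null set. Left invariance gives the
other base points. -/

set_option linter.unusedSectionVars false

/-! ### Calculus in the left and right trivializations; the adjoint representation. -/

noncomputable section

section GroupCalculus

variable {n : ℕ} {G : Type*} [TopologicalSpace G] [ChartedSpace (EuclideanSpace ℝ (Fin n)) G]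
  [Group G] {F : Type*} [NormedAddCommGroup F] [NormedSpace ℝ F]

local notation "𝔼" => EuclideanSpace ℝ (Fin n)
local notation "φ₁" => extChartAt (𝓡 n) (1 : G)

/-- The derivative at `x` of a function on a Lie group, in the left trivialization. -/
def leftDeriv (n : ℕ) {G : Type*} [TopologicalSpace G] [ChartedSpace (EuclideanSpace ℝ (Fin n)) G]
    [Group G] (f : G → F) (x : G) : EuclideanSpace ℝ (Fin n) →L[ℝ] F :=
  fderiv ℝ (fun b => f (x * (extChartAt (𝓡 n) (1 : G)).symm b)) (extChartAt (𝓡 n) (1 : G) 1)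

/-- The derivative at `x` of a function on a Lie group, in the right trivialization. -/
def rightDeriv (n : ℕ) {G : Type*} [TopologicalSpace G] [ChartedSpace (EuclideanSpace ℝ (Fin n)) G]
    [Group G] (f : G → F) (x : G) : EuclideanSpace ℝ (Fin n) →L[ℝ] F :=
  fderiv ℝ (fun b => f ((extChartAt (𝓡 n) (1 : G)).symm b * x)) (extChartAt (𝓡 n) (1 : G) 1)

/-- The adjoint representation. -/
def adjointRep (n : ℕ) {G : Type*} [TopologicalSpace G]
    [ChartedSpace (EuclideanSpace ℝ (Fin n)) G] [Group G] (x : G) :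
    EuclideanSpace ℝ (Fin n) →L[ℝ] EuclideanSpace ℝ (Fin n) :=
  fderiv ℝ (fun b => extChartAt (𝓡 n) (1 : G) (x * (extChartAt (𝓡 n) (1 : G)).symm b * x⁻¹))
    (extChartAt (𝓡 n) (1 : G) 1)

/-- The curve `c` has velocity `dL_{c(t)} u` at time `t`. -/
def HasLeftVelocity (c : ℝ → G) (t : ℝ) (u : EuclideanSpace ℝ (Fin n)) : Prop :=
  ContinuousAt c t ∧ HasDerivAt (fun s => extChartAt (𝓡 n) (1 : G) ((c t)⁻¹ * c s)) u t

lemma chartOne_symm_one : (φ₁).symm (φ₁ 1) = 1 := extChartAt_to_inv (1 : G)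

lemma leftDeriv_one_eq_rightDeriv (f : G → F) : leftDeriv n f 1 = rightDeriv n f 1 := by
  simp [leftDeriv, rightDeriv]

lemma leftDeriv_comp_mul_left (f : G → F) (x y : G) :
    leftDeriv n (fun z => f (x * z)) y = leftDeriv n f (x * y) := by
  simp [leftDeriv, mul_assoc]

lemma eventually_mem_chartOne_source : ∀ᶠ x in 𝓝 (1 : G), x ∈ (φ₁).source :=
  extChartAt_source_mem_nhds 1

variable [LieGroup (𝓡 n) ∞ G]

lemma contMDiffAt_chart_symm (x₀ : G) {y : 𝔼} (hy : y ∈ (extChartAt (𝓡 n) x₀).target) :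
    ContMDiffAt 𝓘(ℝ, 𝔼) (𝓡 n) ∞ (extChartAt (𝓡 n) x₀).symm y :=
  (contMDiffOn_extChartAt_symm x₀).contMDiffAt (extChartAt_target_mem_nhds' hy)

lemma contMDiffAt_chart (x₀ : G) {x : G} (hx : x ∈ (extChartAt (𝓡 n) x₀).source) :
    ContMDiffAt (𝓡 n) 𝓘(ℝ, 𝔼) ∞ (extChartAt (𝓡 n) x₀) x :=
  contMDiffAt_extChartAt' (by simpa using hx)

lemma contMDiffAt_chartOne_symm :
    ContMDiffAt 𝓘(ℝ, 𝔼) (𝓡 n) ∞ (φ₁).symm (φ₁ 1) :=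
  contMDiffAt_chart_symm 1 (mem_extChartAt_target 1)

lemma contMDiffAt_chartOne_one : ContMDiffAt (𝓡 n) 𝓘(ℝ, 𝔼) ∞ φ₁ 1 :=
  contMDiffAt_chart 1 (mem_extChartAt_source 1)

lemma chart_comp_contDiffAt {f : G → F} {k : WithTop ℕ∞} {x₀ x : G}
    (hx : x ∈ (extChartAt (𝓡 n) x₀).source) (hk : k ≤ ∞)
    (hf : ContMDiffAt (𝓡 n) 𝓘(ℝ, F) k f x) :
    ContDiffAt ℝ k (f ∘ (extChartAt (𝓡 n) x₀).symm) (extChartAt (𝓡 n) x₀ x) := by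
  rw [← contMDiffAt_iff_contDiffAt]
  refine ContMDiffAt.comp_of_eq hf
    ((contMDiffAt_chart_symm x₀ ((extChartAt (𝓡 n) x₀).map_source hx)).of_le hk)
    ((extChartAt (𝓡 n) x₀).left_inv hx)

/-- Smoothness of `(a, b) ↦ f (p (a) * q (b))`-like expressions in coordinates. -/
lemma contMDiffAt_mul_mul {H : Type*} [NormedAddCommGroup H] [NormedSpace ℝ H] {f : G → F}
    {k : WithTop ℕ∞} (hk : k ≤ ∞)
    {p q : H → G} {z : H} (hp : ContMDiffAt 𝓘(ℝ, H) (𝓡 n) k p z)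
    (hq : ContMDiffAt 𝓘(ℝ, H) (𝓡 n) k q z)
    (hf : ContMDiffAt (𝓡 n) 𝓘(ℝ, F) k f (p z * q z)) :
    ContDiffAt ℝ k (fun a => f (p a * q a)) z := by
  have := ContMDiffMul.of_le (I := 𝓡 n) (G := G) hk
  rw [← contMDiffAt_iff_contDiffAt]
  exact ContMDiffAt.comp_of_eq hf (hp.mul hq) rfl

/-- Reading the group parameter in a chart reduces this to the smooth dependence on parameters of
the derivative of a jointly smooth function. It serves for `leftDeriv`, `rightDeriv` and
`adjointRep` alike. -/
lemma contMDiffAt_fderiv_of_chart {K : G → 𝔼 → F} {x : G}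
    (hK : ContDiffAt ℝ ∞ (fun p : 𝔼 × 𝔼 => K ((extChartAt (𝓡 n) x).symm p.1) p.2)
      (extChartAt (𝓡 n) x x, φ₁ 1)) :
    ContMDiffAt (𝓡 n) 𝓘(ℝ, 𝔼 →L[ℝ] F) ∞ (fun y => fderiv ℝ (K y) (φ₁ 1)) x := by
  have h1 : ContDiffAt ℝ ∞ (fun η : 𝔼 => fderiv ℝ (K ((extChartAt (𝓡 n) x).symm η)) (φ₁ 1))
      (extChartAt (𝓡 n) x x) :=
    ContDiffAt.fderiv (f := fun η b => K ((extChartAt (𝓡 n) x).symm η) b)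
      (g := fun _ => φ₁ 1) hK contDiffAt_const le_rfl
  have h2 := ContMDiffAt.comp_of_eq h1.contMDiffAt
    (contMDiffAt_chart x (mem_extChartAt_source (I := 𝓡 n) x)) rfl
  refine h2.congr_of_eventuallyEq ?_
  filter_upwards [extChartAt_source_mem_nhds (I := 𝓡 n) x] with y hy
  simp only [Function.comp_apply, (extChartAt (𝓡 n) x).left_inv hy]

lemma contMDiffAt_leftDeriv {f : G → F} {x : G} (hf : ContMDiffAt (𝓡 n) 𝓘(ℝ, F) ∞ f x) :
    ContMDiffAt (𝓡 n) 𝓘(ℝ, 𝔼 →L[ℝ] F) ∞ (leftDeriv n f) x := by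
  refine contMDiffAt_fderiv_of_chart (G := G) (K := fun y b => f (y * (φ₁).symm b)) ?_
  refine contMDiffAt_mul_mul (n := n) (G := G) le_rfl (p := fun p : 𝔼 × 𝔼 => (extChartAt (𝓡 n) x).symm p.1)
    (q := fun p : 𝔼 × 𝔼 => (φ₁).symm p.2) ?_ ?_ ?_
  · exact ContMDiffAt.comp_of_eq (contMDiffAt_chart_symm x (mem_extChartAt_target x))
      contDiffAt_fst.contMDiffAt rfl
  · exact ContMDiffAt.comp_of_eq contMDiffAt_chartOne_symm contDiffAt_snd.contMDiffAt rfl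
  · simpa [chartOne_symm_one] using hf

lemma contMDiffAt_adjointRep (x : G) :
    ContMDiffAt (𝓡 n) 𝓘(ℝ, 𝔼 →L[ℝ] 𝔼) ∞ (adjointRep n) x := by
  refine contMDiffAt_fderiv_of_chart (K := fun y b => φ₁ (y * (φ₁).symm b * y⁻¹)) ?_
  have h1 : ContMDiffAt 𝓘(ℝ, 𝔼 × 𝔼) (𝓡 n) ∞
      (fun p : 𝔼 × 𝔼 => (extChartAt (𝓡 n) x).symm p.1) (extChartAt (𝓡 n) x x, φ₁ 1) :=
    ContMDiffAt.comp_of_eq (contMDiffAt_chart_symm x (mem_extChartAt_target x))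
      contDiffAt_fst.contMDiffAt rfl
  have h2 : ContMDiffAt 𝓘(ℝ, 𝔼 × 𝔼) (𝓡 n) ∞
      (fun p : 𝔼 × 𝔼 => (φ₁).symm p.2) (extChartAt (𝓡 n) x x, φ₁ 1) :=
    ContMDiffAt.comp_of_eq contMDiffAt_chartOne_symm contDiffAt_snd.contMDiffAt rfl
  refine contMDiffAt_mul_mul (n := n) le_rfl (h1.mul h2) h1.inv ?_
  simpa [chartOne_symm_one] using contMDiffAt_chartOne_one

lemma hasFDerivAt_leftDeriv {f : G → F} {x : G} (hf : MDifferentiableAt (𝓡 n) 𝓘(ℝ, F) f x) :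
    HasFDerivAt (fun b => f (x * (φ₁).symm b)) (leftDeriv n f x) (φ₁ 1) := by
  refine DifferentiableAt.hasFDerivAt ?_
  rw [← mdifferentiableAt_iff_differentiableAt]
  refine MDifferentiableAt.comp_of_eq (I' := 𝓡 n) (hg := hf) (hf := ?_) (hy := ?_)
  · exact ContMDiffAt.mdifferentiableAt (contMDiffAt_const.mul contMDiffAt_chartOne_symm)
      (by simp)
  · simp

lemma hasFDerivAt_rightDeriv {f : G → F} {x : G} (hf : MDifferentiableAt (𝓡 n) 𝓘(ℝ, F) f x) :
    HasFDerivAt (fun b => f ((φ₁).symm b * x)) (rightDeriv n f x) (φ₁ 1) := by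
  refine DifferentiableAt.hasFDerivAt ?_
  rw [← mdifferentiableAt_iff_differentiableAt]
  refine MDifferentiableAt.comp_of_eq (I' := 𝓡 n) (hg := hf) (hf := ?_) (hy := ?_)
  · exact ContMDiffAt.mdifferentiableAt (contMDiffAt_chartOne_symm.mul contMDiffAt_const)
      (by simp)
  · simp

lemma hasFDerivAt_adjointRep (x : G) :
    HasFDerivAt (fun b => φ₁ (x * (φ₁).symm b * x⁻¹)) (adjointRep n x) (φ₁ 1) := by
  refine DifferentiableAt.hasFDerivAt ?_
  rw [← mdifferentiableAt_iff_differentiableAt]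
  refine MDifferentiableAt.comp_of_eq (I' := 𝓡 n) (y := 1)
    (hg := contMDiffAt_chartOne_one.mdifferentiableAt (by simp)) (hf := ?_) (hy := ?_)
  · exact ContMDiffAt.mdifferentiableAt
      ((contMDiffAt_const.mul contMDiffAt_chartOne_symm).mul contMDiffAt_const) (by simp)
  · simp

lemma tendsto_chartOne_symm : Tendsto (φ₁).symm (𝓝 (φ₁ 1)) (𝓝 (1 : G)) := by
  simpa [chartOne_symm_one] using (contMDiffAt_chartOne_symm (n := n) (G := G)).continuousAt.tendsto

/-- The velocity of a curve determines the derivatives of functions along it. -/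
lemma HasLeftVelocity.hasDerivAt {c : ℝ → G} {t : ℝ} {u : 𝔼} (hc : HasLeftVelocity c t u)
    {f : G → F} (hf : MDifferentiableAt (𝓡 n) 𝓘(ℝ, F) f (c t)) :
    HasDerivAt (fun s => f (c s)) (leftDeriv n f (c t) u) t := by
  have := topologicalGroup_of_lieGroup (𝓡 n) ∞ (G := G)
  have h1 := HasFDerivAt.comp_hasDerivAt_of_eq t (hasFDerivAt_leftDeriv hf) hc.2 (by simp)
  refine h1.congr_of_eventuallyEq ?_
  have h2 : Tendsto (fun s => (c t)⁻¹ * c s) (𝓝 t) (𝓝 1) := by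
    simpa using (tendsto_const_nhds (x := (c t)⁻¹)).mul hc.1.tendsto
  filter_upwards [h2.eventually (eventually_mem_chartOne_source (n := n))] with s hs
  simp only [Function.comp_apply]
  rw [(φ₁).left_inv hs]
  simp

/-- Differentiate `x b = (x b x⁻¹) x` at `b = 1`. -/
lemma leftDeriv_eq_rightDeriv_comp {f : G → F} {x : G}
    (hf : MDifferentiableAt (𝓡 n) 𝓘(ℝ, F) f x) :
    leftDeriv n f x = (rightDeriv n f x).comp (adjointRep n x) := by
  have := topologicalGroup_of_lieGroup (𝓡 n) ∞ (G := G)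
  have h1 := HasFDerivAt.comp (φ₁ 1) (g := fun b => f ((φ₁).symm b * x))
    (by simpa using hasFDerivAt_rightDeriv hf) (hasFDerivAt_adjointRep x)
  refine ((hasFDerivAt_leftDeriv hf).unique (h1.congr_of_eventuallyEq ?_))
  have h2 : Tendsto (fun b => x * (φ₁).symm b * x⁻¹) (𝓝 (φ₁ 1)) (𝓝 1) := by
    simpa using ((tendsto_const_nhds (x := x)).mul tendsto_chartOne_symm).mul
      (tendsto_const_nhds (x := x⁻¹))
  filter_upwards [h2.eventually (eventually_mem_chartOne_source (n := n))] with s hs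
  simp only [Function.comp_apply]
  rw [(φ₁).left_inv hs]
  simp

lemma adjointRep_mul (x y : G) : adjointRep n (x * y) = (adjointRep n x).comp (adjointRep n y) := by
  have := topologicalGroup_of_lieGroup (𝓡 n) ∞ (G := G)
  have h1 := HasFDerivAt.comp (φ₁ 1) (g := fun b => φ₁ (x * (φ₁).symm b * x⁻¹))
    (by simpa using hasFDerivAt_adjointRep x) (hasFDerivAt_adjointRep y)
  refine ((hasFDerivAt_adjointRep (x * y)).unique (h1.congr_of_eventuallyEq ?_))
  have h2 : Tendsto (fun b => y * (φ₁).symm b * y⁻¹) (𝓝 (φ₁ 1)) (𝓝 1) := by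
    simpa using ((tendsto_const_nhds (x := y)).mul tendsto_chartOne_symm).mul
      (tendsto_const_nhds (x := y⁻¹))
  filter_upwards [h2.eventually (eventually_mem_chartOne_source (n := n))] with s hs
  simp only [Function.comp_apply]
  rw [(φ₁).left_inv hs]
  simp [mul_assoc]

lemma chart_comp_chart_symm_hasFDerivAt (x : G) : HasFDerivAt
    (fun b => extChartAt (𝓡 n) x ((extChartAt (𝓡 n) x).symm b))
    (ContinuousLinearMap.id ℝ 𝔼) (extChartAt (𝓡 n) x x) := by
  refine (hasFDerivAt_id _).congr_of_eventuallyEq ?_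
  filter_upwards [extChartAt_target_mem_nhds (I := 𝓡 n) x] with b hb
  rw [(extChartAt (𝓡 n) x).right_inv hb]; rfl

lemma adjointRep_one : adjointRep n (1 : G) = ContinuousLinearMap.id ℝ 𝔼 := by
  refine (hasFDerivAt_adjointRep 1).unique ?_
  simpa using chart_comp_chart_symm_hasFDerivAt (1 : G)

lemma adjointRep_inv_comp (x : G) :
    (adjointRep n x⁻¹).comp (adjointRep n x) = ContinuousLinearMap.id ℝ 𝔼 := by
  rw [← adjointRep_mul, inv_mul_cancel, adjointRep_one]

lemma adjointRep_comp_inv (x : G) :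
    (adjointRep n x).comp (adjointRep n x⁻¹) = ContinuousLinearMap.id ℝ 𝔼 := by
  rw [← adjointRep_mul, mul_inv_cancel, adjointRep_one]

lemma HasLeftVelocity.mul_left {c : ℝ → G} {t : ℝ} {u : 𝔼} (hc : HasLeftVelocity c t u) (g : G) :
    HasLeftVelocity (fun s => g * c s) t u := by
  have := topologicalGroup_of_lieGroup (𝓡 n) ∞ (G := G)
  refine ⟨continuousAt_const.mul hc.1, ?_⟩
  simpa [mul_assoc] using hc.2

end GroupCalculus
end

/-! ### The Lie bracket computed by left derivatives. -/

noncomputable section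

section GroupBracket

variable {n : ℕ} {G : Type*} [TopologicalSpace G] [ChartedSpace (EuclideanSpace ℝ (Fin n)) G]
  [Group G] {F : Type*} [NormedAddCommGroup F] [NormedSpace ℝ F]

local notation "𝔼" => EuclideanSpace ℝ (Fin n)
local notation "φ₁" => extChartAt (𝓡 n) (1 : G)

variable [LieGroup (𝓡 n) ∞ G]

/-- Left and right translations commute: both sides are mixed second derivatives at the base point
of the single function `(a, b) ↦ f (a x b)`, so they agree by symmetry. -/
lemma rightDeriv_leftDeriv_comm {f : G → F} {x : G} (hf : ContMDiffAt (𝓡 n) 𝓘(ℝ, F) ∞ f x)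
    (u w : 𝔼) :
    rightDeriv n (fun y => leftDeriv n f y u) x w =
      leftDeriv n (fun y => rightDeriv n f y w) x u := by
  let H : 𝔼 × 𝔼 → F := fun p => f ((φ₁).symm p.1 * x * (φ₁).symm p.2)
  have hH : ContDiffAt ℝ ∞ H (φ₁ 1, φ₁ 1) := by
    have h1 : ContMDiffAt 𝓘(ℝ, 𝔼 × 𝔼) (𝓡 n) ∞
        (fun p : 𝔼 × 𝔼 => (φ₁).symm p.1) (φ₁ 1, φ₁ 1) :=
      ContMDiffAt.comp_of_eq contMDiffAt_chartOne_symm contDiffAt_fst.contMDiffAt rfl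
    have h2 : ContMDiffAt 𝓘(ℝ, 𝔼 × 𝔼) (𝓡 n) ∞
        (fun p : 𝔼 × 𝔼 => (φ₁).symm p.2) (φ₁ 1, φ₁ 1) :=
      ContMDiffAt.comp_of_eq contMDiffAt_chartOne_symm contDiffAt_snd.contMDiffAt rfl
    refine contMDiffAt_mul_mul (n := n) le_rfl (h1.mul contMDiffAt_const) h2 ?_
    simpa [chartOne_symm_one] using hf
  have hev : ∀ᶠ p in 𝓝 (φ₁ 1, φ₁ 1), DifferentiableAt ℝ H p := by
    filter_upwards [(hH.of_le (m := 1) (by exact_mod_cast le_top)).eventually (by simp)] with p hp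
    exact hp.differentiableAt (by simp)
  have hD : HasFDerivAt (fderiv ℝ H) (fderiv ℝ (fderiv ℝ H) (φ₁ 1, φ₁ 1)) (φ₁ 1, φ₁ 1) :=
    ((hH.fderiv_right (m := ∞) le_rfl).differentiableAt (by simp)).hasFDerivAt
  have hl : HasFDerivAt (fun a : 𝔼 => (a, φ₁ 1)) (ContinuousLinearMap.inl ℝ 𝔼 𝔼) (φ₁ 1) :=
    hasFDerivAt_prodMk_left _ _
  have hr : HasFDerivAt (fun b : 𝔼 => (φ₁ 1, b)) (ContinuousLinearMap.inr ℝ 𝔼 𝔼) (φ₁ 1) :=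
    hasFDerivAt_prodMk_right _ _
  have e1 : (fun a => leftDeriv n f ((φ₁).symm a * x) u) =ᶠ[𝓝 (φ₁ 1)]
      fun a => fderiv ℝ H (a, φ₁ 1) (0, u) := by
    filter_upwards [hl.continuousAt.tendsto.eventually hev] with a ha
    have := HasFDerivAt.comp (φ₁ 1) (g := H) ha.hasFDerivAt
      (hasFDerivAt_prodMk_right a (φ₁ 1))
    exact congrArg (fun T : 𝔼 →L[ℝ] F => T u) this.fderiv
  have e2 : (fun b => rightDeriv n f (x * (φ₁).symm b) w) =ᶠ[𝓝 (φ₁ 1)]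
      fun b => fderiv ℝ H (φ₁ 1, b) (w, 0) := by
    filter_upwards [hr.continuousAt.tendsto.eventually hev] with b hb
    have := HasFDerivAt.comp (φ₁ 1) (g := H) (f := fun e => (e, b)) hb.hasFDerivAt
      (hasFDerivAt_prodMk_left (φ₁ 1) b)
    have h2 : (H ∘ fun e => (e, b)) = fun a => f ((φ₁).symm a * (x * (φ₁).symm b)) := by
      ext a; simp [H, mul_assoc]
    rw [h2] at this
    exact congrArg (fun T : 𝔼 →L[ℝ] F => T w) this.fderiv
  have d1 : rightDeriv n (fun y => leftDeriv n f y u) x w =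
      fderiv ℝ (fderiv ℝ H) (φ₁ 1, φ₁ 1) (w, 0) (0, u) := by
    have h3 := (HasFDerivAt.comp (φ₁ 1) (g := fderiv ℝ H) (f := fun a => (a, φ₁ 1)) hD hl).clm_apply
      (hasFDerivAt_const ((0, u) : 𝔼 × 𝔼) (φ₁ 1))
    rw [rightDeriv, e1.fderiv_eq]
    refine (congrArg (fun T : 𝔼 →L[ℝ] F => T w) h3.fderiv).trans ?_
    simp
  have d2 : leftDeriv n (fun y => rightDeriv n f y w) x u =
      fderiv ℝ (fderiv ℝ H) (φ₁ 1, φ₁ 1) (0, u) (w, 0) := by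
    have h3 := (HasFDerivAt.comp (φ₁ 1) (g := fderiv ℝ H) hD hr).clm_apply
      (hasFDerivAt_const ((w, 0) : 𝔼 × 𝔼) (φ₁ 1))
    rw [leftDeriv, e2.fderiv_eq]
    refine (congrArg (fun T : 𝔼 →L[ℝ] F => T u) h3.fderiv).trans ?_
    simp
  rw [d1, d2]
  exact (hH.isSymmSndFDerivAt (by rw [minSmoothness_of_isRCLikeNormedField]; exact ENat.LEInfty.out)).eq _ _

lemma mfderiv_eq_fderiv_chart {f : G → F} {x : G} (hf : MDifferentiableAt (𝓡 n) 𝓘(ℝ, F) f x) :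
    (mfderiv (𝓡 n) 𝓘(ℝ, F) f x : 𝔼 →L[ℝ] F) =
      fderiv ℝ (fun b => f ((extChartAt (𝓡 n) x).symm b)) (extChartAt (𝓡 n) x x) := by
  have aux : ∀ (T : 𝔼 →L[ℝ] F) (g : 𝔼 → F) (y : 𝔼),
      HasFDerivWithinAt g T (range (𝓡 n)) y → T = fderiv ℝ g y :=
    fun T g y h => (h.hasFDerivAt (by simp)).fderiv.symm
  exact aux _ _ _ hf.hasMFDerivAt.2

lemma mdifferentiableAt_leftMul (x y : G) :
    MDifferentiableAt (𝓡 n) (𝓡 n) (fun h : G => x * h) y :=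
  (contMDiff_mul_left (I := 𝓡 n) (n := ∞)).contMDiffAt.mdifferentiableAt (by simp)

/-- The differential at the identity of the left translation by `x`. -/
def leftTrans (n : ℕ) {G : Type*} [TopologicalSpace G] [ChartedSpace (EuclideanSpace ℝ (Fin n)) G]
    [Group G] (x : G) : EuclideanSpace ℝ (Fin n) →L[ℝ] EuclideanSpace ℝ (Fin n) :=
  mfderiv (𝓡 n) (𝓡 n) (fun h : G => x * h) 1

lemma mfderiv_comp_leftTrans {f : G → F} {x : G} (hf : MDifferentiableAt (𝓡 n) 𝓘(ℝ, F) f x) :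
    (mfderiv (𝓡 n) 𝓘(ℝ, F) f x : 𝔼 →L[ℝ] F).comp (leftTrans n x) = leftDeriv n f x := by
  have h0 : MDifferentiableAt (𝓡 n) 𝓘(ℝ, F) f (x * 1) := by simpa using hf
  have h1 := mfderiv_comp (I' := 𝓡 n) (1 : G) (g := f) (f := fun h => x * h) h0
    (mdifferentiableAt_leftMul x 1)
  have h2 : MDifferentiableAt (𝓡 n) 𝓘(ℝ, F) (f ∘ fun h => x * h) (1 : G) :=
    MDifferentiableAt.comp (I' := 𝓡 n) 1 h0 (mdifferentiableAt_leftMul x 1)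
  have h3 := mfderiv_eq_fderiv_chart h2
  have h4 : (mfderiv (𝓡 n) 𝓘(ℝ, F) f (x * 1) : 𝔼 →L[ℝ] F) = mfderiv (𝓡 n) 𝓘(ℝ, F) f x := by
    rw [mul_one]
  rw [← h4]
  exact h1.symm.trans h3

lemma mdifferentiableAt_chart (x₀ : G) {x : G} (hx : x ∈ (extChartAt (𝓡 n) x₀).source) :
    MDifferentiableAt (𝓡 n) 𝓘(ℝ, 𝔼) (extChartAt (𝓡 n) x₀) x :=
  (contMDiffAt_chart x₀ hx).mdifferentiableAt (by simp)

lemma leftDeriv_chartOne_one : leftDeriv n φ₁ (1 : G) = ContinuousLinearMap.id ℝ 𝔼 := by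
  refine HasFDerivAt.fderiv ?_
  simpa using chart_comp_chart_symm_hasFDerivAt (1 : G)

lemma mfderiv_chart_self (x : G) :
    (mfderiv (𝓡 n) 𝓘(ℝ, 𝔼) (extChartAt (𝓡 n) x) x : 𝔼 →L[ℝ] 𝔼) =
      ContinuousLinearMap.id ℝ 𝔼 := by
  rw [mfderiv_eq_fderiv_chart (mdifferentiableAt_chart x (mem_extChartAt_source x))]
  exact (chart_comp_chart_symm_hasFDerivAt x).fderiv

/-- The bracket is that of left-invariant vector fields at `1`. In the chart at `1` the field of `v`
reads `b ↦ leftDeriv n φ₁ (φ₁⁻¹ b) v`, and the coordinate formula for the bracket applies. -/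
lemma lie_eq_leftDeriv (u w : GroupLieAlgebra (𝓡 n) G) :
    (⁅u, w⁆ : GroupLieAlgebra (𝓡 n) G) =
      (leftDeriv n (fun y => leftDeriv n φ₁ y w) (1 : G) u -
        leftDeriv n (fun y => leftDeriv n φ₁ y u) (1 : G) w : 𝔼) := by
  have key : ∀ v : 𝔼, (VectorField.mpullbackWithin 𝓘(ℝ, 𝔼) (𝓡 n) (φ₁).symm
      (mulInvariantVectorField (v : GroupLieAlgebra (𝓡 n) G)) (range (𝓡 n)) : 𝔼 → 𝔼)
      =ᶠ[𝓝 (φ₁ 1)] fun b => leftDeriv n φ₁ ((φ₁).symm b) v := by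
    intro v
    filter_upwards [extChartAt_target_mem_nhds (I := 𝓡 n) (1 : G)] with b hb
    have hs := (φ₁).map_target hb
    have h1 := mfderiv_comp_leftTrans (mdifferentiableAt_chart (1 : G) hs)
    rw [← h1]
    refine ((isInvertible_mfderivWithin_extChartAt_symm hb).inverse_apply_eq).2 ?_
    have h2 := mfderivWithin_extChartAt_symm_comp_mfderiv_extChartAt (I := 𝓡 n) hb
    exact (congrArg (fun T : 𝔼 →L[ℝ] 𝔼 => T (leftTrans n ((φ₁).symm b) v)) h2).symm
  rw [GroupLieAlgebra.bracket_def, ← VectorField.mlieBracketWithin_univ,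
    VectorField.mlieBracketWithin_apply]
  have hr : ((φ₁).symm ⁻¹' univ ∩ range (𝓡 n) : Set 𝔼) = univ := by simp
  have h0 := (congrArg (fun T : 𝔼 →L[ℝ] 𝔼 => T.inverse) (mfderiv_chart_self (1 : G))).trans
    (ContinuousLinearMap.inverse_id (R := ℝ) (M := 𝔼))
  refine (congrArg (fun T : 𝔼 →L[ℝ] 𝔼 => T _) h0).trans ?_
  have h5 : ∀ v : 𝔼, (fun b => leftDeriv n φ₁ ((φ₁).symm b) v) (φ₁ 1) = v := by
    intro v
    simp only [chartOne_symm_one, leftDeriv_chartOne_one]; rfl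
  have e1 := (key w).fderiv_eq (𝕜 := ℝ)
  have e2 := (key u).fderiv_eq (𝕜 := ℝ)
  have e3 := (key w).eq_of_nhds.trans (h5 w)
  have e4 := (key u).eq_of_nhds.trans (h5 u)
  simp only [leftDeriv, one_mul]
  simp only [leftDeriv] at e1 e2
  have hb : ∀ (A B : 𝔼 → 𝔼) (s : Set 𝔼), s = univ →
      VectorField.lieBracketWithin ℝ A B s (φ₁ 1) =
        fderiv ℝ B (φ₁ 1) (A (φ₁ 1)) - fderiv ℝ A (φ₁ 1) (B (φ₁ 1)) := by
    rintro A B s rfl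
    rw [VectorField.lieBracketWithin_univ, VectorField.lieBracket_eq]
  refine (hb _ _ _ hr).trans ?_
  refine congrArg₂ (fun a b : 𝔼 => a - b) ?_ ?_
  · refine congrArg₂ (fun (T : 𝔼 →L[ℝ] 𝔼) (z : 𝔼) => T z) e1 e4
  · refine congrArg₂ (fun (T : 𝔼 →L[ℝ] 𝔼) (z : 𝔼) => T z) e2 e3

end GroupBracket
end

/-! ### The derivative of `Ad` is the bracket; velocities of curves in charts. -/

noncomputable section

section AdjointDerivative

variable {n : ℕ} {G : Type*} [TopologicalSpace G] [ChartedSpace (EuclideanSpace ℝ (Fin n)) G]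
  [Group G] {F : Type*} [NormedAddCommGroup F] [NormedSpace ℝ F]

local notation "𝔼" => EuclideanSpace ℝ (Fin n)
local notation "φ₁" => extChartAt (𝓡 n) (1 : G)

variable [LieGroup (𝓡 n) ∞ G]

lemma contMDiffAt_rightDeriv {f : G → F} {x : G} (hf : ContMDiffAt (𝓡 n) 𝓘(ℝ, F) ∞ f x) :
    ContMDiffAt (𝓡 n) 𝓘(ℝ, 𝔼 →L[ℝ] F) ∞ (rightDeriv n f) x := by
  refine contMDiffAt_fderiv_of_chart (G := G) (K := fun y b => f ((φ₁).symm b * y)) ?_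
  refine contMDiffAt_mul_mul (n := n) (G := G) le_rfl (p := fun p : 𝔼 × 𝔼 => (φ₁).symm p.2)
    (q := fun p : 𝔼 × 𝔼 => (extChartAt (𝓡 n) x).symm p.1) ?_ ?_ ?_
  · exact ContMDiffAt.comp_of_eq contMDiffAt_chartOne_symm contDiffAt_snd.contMDiffAt rfl
  · exact ContMDiffAt.comp_of_eq (contMDiffAt_chart_symm x (mem_extChartAt_target x))
      contDiffAt_fst.contMDiffAt rfl
  · simpa [chartOne_symm_one] using hf

lemma mdifferentiableAt_of_smooth {f : G → F} {x : G} (hf : ContMDiffAt (𝓡 n) 𝓘(ℝ, F) ∞ f x) :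
    MDifferentiableAt (𝓡 n) 𝓘(ℝ, F) f x :=
  hf.mdifferentiableAt (by simp)

lemma leftDeriv_clm_apply {F' : Type*} [NormedAddCommGroup F'] [NormedSpace ℝ F']
    {g : G → F' →L[ℝ] F} {x : G} (hg : MDifferentiableAt (𝓡 n) 𝓘(ℝ, F' →L[ℝ] F) g x)
    (w : F') (u : 𝔼) : leftDeriv n (fun y => g y w) x u = leftDeriv n g x u w := by
  have h := (hasFDerivAt_leftDeriv hg).clm_apply (hasFDerivAt_const w (φ₁ 1))
  have h2 := h.fderiv
  refine (congrArg (fun T : 𝔼 →L[ℝ] F => T u) h2).trans ?_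
  simp

lemma eventually_smooth {f : G → F} {x : G} (hf : ContMDiffAt (𝓡 n) 𝓘(ℝ, F) ∞ f x) :
    ∀ᶠ y in 𝓝 x, MDifferentiableAt (𝓡 n) 𝓘(ℝ, F) f y := by
  have h1 : ContMDiffAt (𝓡 n) 𝓘(ℝ, F) 1 f x := hf.of_le (by exact_mod_cast le_top)
  filter_upwards [(contMDiffAt_iff_contMDiffAt_nhds (by simp)).1 h1] with y hy
  exact hy.mdifferentiableAt (by simp)

/-- Near `1`, `leftDeriv f y w = rightDeriv f y (Ad(y) w)`. In the product rule along `u`, the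
derivative of the first factor is computed with `rightDeriv_leftDeriv_comm`, while that of `Ad`
gives the correction. Hence the commutator of two left-invariant derivatives is the derivative of
`Ad`. -/
lemma leftDeriv_mul_rule {f : G → F} (hf : ContMDiffAt (𝓡 n) 𝓘(ℝ, F) ∞ f 1) (u w : 𝔼) :
    leftDeriv n (fun y => leftDeriv n f y w) (1 : G) u =
      leftDeriv n (fun y => leftDeriv n f y u) (1 : G) w +
        leftDeriv n f 1 (leftDeriv n (adjointRep n) (1 : G) u w) := by
  have hA := mdifferentiableAt_of_smooth (contMDiffAt_adjointRep (n := n) (1 : G))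
  have hR := mdifferentiableAt_of_smooth (contMDiffAt_rightDeriv hf)
  have h1 := (hasFDerivAt_leftDeriv hR).clm_apply
    ((hasFDerivAt_leftDeriv hA).clm_apply (hasFDerivAt_const w (φ₁ 1)))
  have h2 : (fun b => leftDeriv n f (1 * (φ₁).symm b) w) =ᶠ[𝓝 (φ₁ 1)]
      fun b => rightDeriv n f (1 * (φ₁).symm b) (adjointRep n (1 * (φ₁).symm b) w) := by
    filter_upwards [tendsto_chartOne_symm.eventually (eventually_smooth hf)] with b hb
    rw [one_mul, leftDeriv_eq_rightDeriv_comp hb]; rfl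
  have h3 := (h1.congr_of_eventuallyEq h2).fderiv
  refine (congrArg (fun T : 𝔼 →L[ℝ] F => T u) h3).trans ?_
  have h4 : leftDeriv n (rightDeriv n f) (1 : G) u w =
      leftDeriv n (fun y => leftDeriv n f y u) (1 : G) w := by
    rw [← leftDeriv_clm_apply hR, ← rightDeriv_leftDeriv_comm hf u w,
      ← leftDeriv_one_eq_rightDeriv]
  rw [← h4]
  simp [adjointRep_one, leftDeriv_one_eq_rightDeriv, add_comm]

/-- The Lie bracket of the Lie algebra of `G`, as a continuous bilinear map. -/
def adCLM (n : ℕ) (G : Type*) [TopologicalSpace G] [ChartedSpace (EuclideanSpace ℝ (Fin n)) G]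
    [Group G] : EuclideanSpace ℝ (Fin n) →L[ℝ] EuclideanSpace ℝ (Fin n) →L[ℝ]
      EuclideanSpace ℝ (Fin n) :=
  leftDeriv n (adjointRep n) (1 : G)

/-- Apply `leftDeriv_mul_rule` to the chart at `1`, whose left derivative there is the identity. -/
lemma lie_eq_adCLM (u w : GroupLieAlgebra (𝓡 n) G) :
    (⁅u, w⁆ : GroupLieAlgebra (𝓡 n) G) = adCLM n G u w := by
  refine (lie_eq_leftDeriv u w).trans ?_
  have h := leftDeriv_mul_rule (n := n) (G := G) contMDiffAt_chartOne_one u w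
  rw [leftDeriv_chartOne_one] at h
  exact (congrArg (fun z : 𝔼 => z - leftDeriv n (fun y => leftDeriv n φ₁ y u) (1 : G) w) h).trans
    (add_sub_cancel_left _ _)

/-- The relation `X_u X_w - X_w X_u = X_[u,w]`, transported from `1` to `x` by left translation.
Applied to a chart, it produces the bracket term of the symplectic form. -/
lemma leftDeriv_leftDeriv_sub {f : G → F} {x : G} (hf : ContMDiffAt (𝓡 n) 𝓘(ℝ, F) ∞ f x)
    (u w : 𝔼) :
    leftDeriv n (leftDeriv n f) x u w - leftDeriv n (leftDeriv n f) x w u =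
      leftDeriv n f x (adCLM n G u w) := by
  have hf' : ContMDiffAt (𝓡 n) 𝓘(ℝ, F) ∞ (fun z => f (x * z)) 1 :=
    ContMDiffAt.comp_of_eq (I' := 𝓡 n) hf (contMDiff_mul_left.contMDiffAt) (by simp)
  have h := leftDeriv_mul_rule hf' u w
  have hL := mdifferentiableAt_of_smooth (contMDiffAt_leftDeriv hf)
  have e : ∀ a : 𝔼, (fun y => leftDeriv n (fun z => f (x * z)) y a) =
      fun y => (fun y => leftDeriv n f y a) (x * y) := by
    intro a; ext y; rw [leftDeriv_comp_mul_left]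
  have e' : ∀ a b : 𝔼, leftDeriv n (fun y => leftDeriv n (fun z => f (x * z)) y a) (1 : G) b =
      leftDeriv n (leftDeriv n f) x b a := by
    intro a b
    rw [e, leftDeriv_comp_mul_left (fun y => leftDeriv n f y a), mul_one, leftDeriv_clm_apply hL]
  rw [e', e', leftDeriv_comp_mul_left, mul_one] at h
  rw [h, add_sub_cancel_left]; rfl

/-- Write `Ad(c s) = Ad(c t) Ad((c t)⁻¹ c s)`, so that only the derivative of `Ad` at `1` matters.
-/
lemma HasLeftVelocity.hasDerivAt_adjointRep {c : ℝ → G} {t : ℝ} {u : 𝔼}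
    (hc : HasLeftVelocity c t u) :
    HasDerivAt (fun s => adjointRep n (c s)) ((adjointRep n (c t)).comp (adCLM n G u)) t := by
  have h1 := hc.mul_left (c t)⁻¹
  have hA := mdifferentiableAt_of_smooth
    (contMDiffAt_adjointRep (n := n) ((c t)⁻¹ * c t))
  have h2 := h1.hasDerivAt (f := adjointRep n) hA
  have h3 := (((ContinuousLinearMap.compL ℝ 𝔼 𝔼 𝔼) (adjointRep n (c t))).hasFDerivAt).comp_hasDerivAt
    t h2
  have e : ((ContinuousLinearMap.compL ℝ 𝔼 𝔼 𝔼) (adjointRep n (c t))) ∘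
      (fun s => adjointRep n ((c t)⁻¹ * c s)) = fun s => adjointRep n (c s) := by
    ext1 s
    simp only [Function.comp_apply, ContinuousLinearMap.compL_apply]
    rw [← adjointRep_mul, mul_inv_cancel_left]
  rw [e] at h3
  simpa [adCLM] using h3

lemma adCLM_swap (u w : 𝔼) : adCLM n G u w = - adCLM n G w u := by
  have h := lie_skew (L := GroupLieAlgebra (𝓡 n) G) u w
  exact (lie_eq_adCLM u w).symm.trans (h.symm.trans (congrArg (fun z : 𝔼 => -z) (lie_eq_adCLM w u)))

lemma adCLM_jacobi (u v w : 𝔼) :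
    adCLM n G u (adCLM n G v w) = adCLM n G (adCLM n G u v) w + adCLM n G v (adCLM n G u w) := by
  have key : ∀ u v w : GroupLieAlgebra (𝓡 n) G,
      (adCLM n G u (adCLM n G v w) : 𝔼) =
        adCLM n G (adCLM n G u v) w + adCLM n G v (adCLM n G u w) := by
    intro u v w
    have h : ⁅u, ⁅v, w⁆⁆ = ⁅⁅u, v⁆, w⁆ + ⁅v, ⁅u, w⁆⁆ := leibniz_lie u v w
    have h1 := (lie_eq_adCLM u ⁅v, w⁆).trans (congrArg (adCLM n G u) (lie_eq_adCLM v w))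
    have h2 := (lie_eq_adCLM v ⁅u, w⁆).trans (congrArg (adCLM n G v) (lie_eq_adCLM u w))
    have h3 := (lie_eq_adCLM ⁅u, v⁆ w).trans
      (congrArg (fun z => adCLM n G z w) (lie_eq_adCLM u v))
    exact h1.symm.trans (h.trans (congrArg₂ (fun a b : 𝔼 => a + b) h3 h2))
  exact key u v w

lemma hasMFDerivAt_curve_iff {c : ℝ → G} {t : ℝ} {ξ : 𝔼} :
    HasMFDerivAt 𝓘(ℝ, ℝ) (𝓡 n) c t
      ((1 : ℝ →L[ℝ] ℝ).smulRight (ξ : TangentSpace (𝓡 n) (c t))) ↔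
      ContinuousAt c t ∧ HasDerivAt (fun s => extChartAt (𝓡 n) (c t) (c s)) ξ t := by
  have aux : ∀ g : ℝ → 𝔼, HasFDerivWithinAt g ((1 : ℝ →L[ℝ] ℝ).smulRight ξ) (range 𝓘(ℝ, ℝ)) t ↔
      HasDerivAt g ξ t := by
    intro g
    rw [show range 𝓘(ℝ, ℝ) = univ by simp, hasFDerivWithinAt_univ, hasDerivAt_iff_hasFDerivAt]
    congr!
  exact and_congr_right fun _ => aux _

lemma hasDerivAt_comp_of_chart {c : ℝ → G} {t : ℝ} {ξ : 𝔼} (hc : ContinuousAt c t) {x₀ : G}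
    (hx : c t ∈ (extChartAt (𝓡 n) x₀).source)
    (h : HasDerivAt (fun s => extChartAt (𝓡 n) x₀ (c s)) ξ t)
    {f : G → F} (hf : MDifferentiableAt (𝓡 n) 𝓘(ℝ, F) f (c t)) :
    HasDerivAt (fun s => f (c s)) (fderiv ℝ (fun b => f ((extChartAt (𝓡 n) x₀).symm b))
      (extChartAt (𝓡 n) x₀ (c t)) ξ) t := by
  have hd : DifferentiableAt ℝ (fun b => f ((extChartAt (𝓡 n) x₀).symm b))
      (extChartAt (𝓡 n) x₀ (c t)) := by
    rw [← mdifferentiableAt_iff_differentiableAt]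
    exact MDifferentiableAt.comp_of_eq (I' := 𝓡 n) (hg := hf)
      (hf := (contMDiffAt_chart_symm x₀ ((extChartAt (𝓡 n) x₀).map_source hx)).mdifferentiableAt
        (by simp)) (hy := (extChartAt (𝓡 n) x₀).left_inv hx)
  refine (hd.hasFDerivAt.comp_hasDerivAt t h).congr_of_eventuallyEq ?_
  filter_upwards [hc.eventually (extChartAt_source_mem_nhds' hx)] with s hs
  rw [Function.comp_apply, (extChartAt (𝓡 n) x₀).left_inv hs]

lemma fderiv_chart_comp_leftDeriv {x₀ x : G} (hx : x ∈ (extChartAt (𝓡 n) x₀).source)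
    {f : G → F} (hf : MDifferentiableAt (𝓡 n) 𝓘(ℝ, F) f x) :
    (fderiv ℝ (fun b => f ((extChartAt (𝓡 n) x₀).symm b)) (extChartAt (𝓡 n) x₀ x)).comp
      (leftDeriv n (extChartAt (𝓡 n) x₀) x) = leftDeriv n f x := by
  have hd : DifferentiableAt ℝ (fun b => f ((extChartAt (𝓡 n) x₀).symm b))
      (extChartAt (𝓡 n) x₀ x) := by
    rw [← mdifferentiableAt_iff_differentiableAt]
    exact MDifferentiableAt.comp_of_eq (I' := 𝓡 n) (hg := hf)
      (hf := (contMDiffAt_chart_symm x₀ ((extChartAt (𝓡 n) x₀).map_source hx)).mdifferentiableAt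
        (by simp)) (hy := (extChartAt (𝓡 n) x₀).left_inv hx)
  have := topologicalGroup_of_lieGroup (𝓡 n) ∞ (G := G)
  have h1 := HasFDerivAt.comp (φ₁ 1) (g := fun b => f ((extChartAt (𝓡 n) x₀).symm b))
    (by simpa using hd.hasFDerivAt) (hasFDerivAt_leftDeriv (mdifferentiableAt_chart x₀ hx))
  refine HasFDerivAt.unique (h1.congr_of_eventuallyEq ?_) (hasFDerivAt_leftDeriv hf)
  have h2 : Tendsto (fun b => x * (φ₁).symm b) (𝓝 (φ₁ 1)) (𝓝 x) := by
    simpa using (tendsto_const_nhds (x := x)).mul tendsto_chartOne_symm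
  filter_upwards [h2.eventually (extChartAt_source_mem_nhds' hx)] with s hs
  rw [Function.comp_apply, (extChartAt (𝓡 n) x₀).left_inv hs]

/-- Converse of `HasLeftVelocity.hasDerivAt` for charts: the velocity in any one chart determines
the left velocity. -/
lemma HasLeftVelocity.of_chart {c : ℝ → G} {t : ℝ} {u : 𝔼} (hc : ContinuousAt c t) {x₀ : G}
    (hx : c t ∈ (extChartAt (𝓡 n) x₀).source)
    (h : HasDerivAt (fun s => extChartAt (𝓡 n) x₀ (c s))
      (leftDeriv n (extChartAt (𝓡 n) x₀) (c t) u) t) : HasLeftVelocity c t u := by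
  refine ⟨hc, ?_⟩
  have hs : ContMDiffAt (𝓡 n) 𝓘(ℝ, 𝔼) ∞ (fun y => φ₁ ((c t)⁻¹ * y)) (c t) :=
    ContMDiffAt.comp_of_eq (I' := 𝓡 n) contMDiffAt_chartOne_one contMDiff_mul_left.contMDiffAt
      (by simp)
  have hf := mdifferentiableAt_of_smooth hs
  have h1 := hasDerivAt_comp_of_chart hc hx h hf
  have h2 := congrArg (fun T : 𝔼 →L[ℝ] 𝔼 => T u) (fderiv_chart_comp_leftDeriv hx hf)
  have h3 := h1.congr_deriv h2
  rw [leftDeriv_comp_mul_left (φ₁ : G → 𝔼), inv_mul_cancel, leftDeriv_chartOne_one] at h3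
  exact h3

lemma leftTrans_eq_leftDeriv (x : G) : leftTrans n x = leftDeriv n (extChartAt (𝓡 n) x) x := by
  rw [← mfderiv_comp_leftTrans (mdifferentiableAt_chart x (mem_extChartAt_source x)),
    mfderiv_chart_self]
  rfl

/-- A curve has left velocity `u` if and only if its derivative is `dL u`. -/
lemma hasLeftVelocity_iff {c : ℝ → G} {t : ℝ} {u : 𝔼} :
    HasLeftVelocity c t u ↔ HasMFDerivAt 𝓘(ℝ, ℝ) (𝓡 n) c t
      ((1 : ℝ →L[ℝ] ℝ).smulRight (leftTrans n (c t) u : TangentSpace (𝓡 n) (c t))) := by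
  have hx := mem_extChartAt_source (I := 𝓡 n) (c t)
  rw [hasMFDerivAt_curve_iff]
  constructor
  · intro h
    refine ⟨h.1, ?_⟩
    rw [leftTrans_eq_leftDeriv]
    exact h.hasDerivAt (mdifferentiableAt_chart (c t) hx)
  · rintro ⟨h1, h2⟩
    rw [leftTrans_eq_leftDeriv] at h2
    exact HasLeftVelocity.of_chart h1 hx h2

/-- The derivative of a chart at a point of its domain, in the left trivialization, as an
isomorphism. -/
lemma exists_equiv_leftDeriv_chart {x₀ x : G} (hx : x ∈ (extChartAt (𝓡 n) x₀).source) :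
    ∃ e : 𝔼 ≃L[ℝ] 𝔼, (e : 𝔼 →L[ℝ] 𝔼) = leftDeriv n (extChartAt (𝓡 n) x₀) x := by
  have hs : ContMDiffAt (𝓡 n) 𝓘(ℝ, 𝔼) ∞ (fun y => φ₁ (x⁻¹ * y)) x :=
    ContMDiffAt.comp_of_eq (I' := 𝓡 n) contMDiffAt_chartOne_one contMDiff_mul_left.contMDiffAt
      (by simp)
  have h := fderiv_chart_comp_leftDeriv hx (mdifferentiableAt_of_smooth hs)
  rw [leftDeriv_comp_mul_left (φ₁ : G → 𝔼), inv_mul_cancel, leftDeriv_chartOne_one] at h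
  have hinj : Function.Injective (leftDeriv n (extChartAt (𝓡 n) x₀) x : 𝔼 →ₗ[ℝ] 𝔼) := by
    refine Function.LeftInverse.injective (g := fderiv ℝ (fun b => φ₁ (x⁻¹ *
      ((extChartAt (𝓡 n) x₀).symm b))) (extChartAt (𝓡 n) x₀ x)) fun v => ?_
    exact congrArg (fun T : 𝔼 →L[ℝ] 𝔼 => T v) h
  refine ⟨(LinearEquiv.ofInjectiveEndo _ hinj).toContinuousLinearEquiv, ?_⟩
  ext1 v
  rfl

end AdjointDerivative
end

/-! ### One-parameter subgroups and the exponential map. -/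

noncomputable section

section Exponential

variable {n : ℕ} {G : Type*} [TopologicalSpace G] [ChartedSpace (EuclideanSpace ℝ (Fin n)) G]
  [Group G] {F : Type*} [NormedAddCommGroup F] [NormedSpace ℝ F]

local notation "𝔼" => EuclideanSpace ℝ (Fin n)
local notation "φ₁" => extChartAt (𝓡 n) (1 : G)
/-- The exponential map of `G`, on the model space of the Lie algebra. -/
def lieExp (n : ℕ) (G : Type*) [TopologicalSpace G] [ChartedSpace (EuclideanSpace ℝ (Fin n)) G]
    [Group G] (v : EuclideanSpace ℝ (Fin n)) : G :=
  groupExp (n := n) (G := G) v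

local notation "ex" => lieExp n G

lemma t1Space_of_chartedSpace {n : ℕ} {M : Type*} [TopologicalSpace M]
    [ChartedSpace (EuclideanSpace ℝ (Fin n)) M] : T1Space M := by
  rw [t1Space_iff_specializes_imp_eq]
  intro x y h
  let e := chartAt (EuclideanSpace ℝ (Fin n)) y
  have hy : y ∈ e.source := mem_chart_source _ y
  have hx : x ∈ e.source := h.mem_open e.open_source hy
  have h1 : e x ⤳ e y := by
    rw [specializes_iff_forall_open]
    intro s hs hys
    have h2 : x ∈ e.source ∩ e ⁻¹' s :=
      h.mem_open (e.isOpen_inter_preimage hs) ⟨hy, hys⟩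
    exact h2.2
  exact e.injOn hx hy h1.eq

variable [LieGroup (𝓡 n) ∞ G]

/-- Charts give T1, and a T1 topological group is Hausdorff. Separation is needed for the uniqueness
of integral curves and for compact sets to be closed. -/
lemma t2Space_of_lieGroup (n : ℕ) (G : Type*) [TopologicalSpace G]
    [ChartedSpace (EuclideanSpace ℝ (Fin n)) G] [Group G] [LieGroup (𝓡 n) ∞ G] : T2Space G := by
  have := topologicalGroup_of_lieGroup (𝓡 n) ∞ (G := G)
  have := t1Space_of_chartedSpace (n := n) (M := G)
  infer_instance

lemma contMDiff_leftInvariant (v : 𝔼) : ContMDiff (𝓡 n) ((𝓡 n).prod 𝓘(ℝ, 𝔼)) 1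
    (fun g : G => (⟨g, mulInvariantVectorField (v : GroupLieAlgebra (𝓡 n) G) g⟩ :
      TangentBundle (𝓡 n) G)) := by
  refine (contMDiff_mulInvariantVectorField (v : GroupLieAlgebra (𝓡 n) G)).of_le ?_
  rw [minSmoothness_of_isRCLikeNormedField]
  exact one_le_two

/-- Left translates of one local integral curve through `1` give integral curves through all points
on the same interval `(-ε, ε)`. This uniform time of existence makes the field complete. -/
lemma exists_one_parameter_curve (v : 𝔼) :
    ∃ c : ℝ → G, c 0 = 1 ∧ ∀ t, HasLeftVelocity c t v := by
  have := t2Space_of_lieGroup n G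
  have hv := contMDiff_leftInvariant (G := G) v
  obtain ⟨γ, hγ0, hγ⟩ := exists_isMIntegralCurveAt_of_contMDiffAt_boundaryless (t₀ := 0)
    (hv.contMDiffAt (x := 1))
  obtain ⟨ε, hε, hball⟩ := Metric.eventually_nhds_iff.1 hγ
  have hloc : ∀ x : G, ∃ c : ℝ → G, c 0 = x ∧ IsMIntegralCurveOn (I := 𝓡 n) c
      (mulInvariantVectorField (v : GroupLieAlgebra (𝓡 n) G)) (Ioo (-ε) ε) := by
    intro x
    refine ⟨fun t => x * γ t, by simp [hγ0], fun t ht => ?_⟩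
    have h1 : HasLeftVelocity γ t v := hasLeftVelocity_iff.2 (hball (by
      rw [Real.dist_eq, sub_zero, abs_lt]; exact ht))
    exact (hasLeftVelocity_iff.1 (h1.mul_left x)).hasMFDerivWithinAt
  obtain ⟨c, hc0, hc⟩ := exists_isMIntegralCurve_of_isMIntegralCurveOn hv hε hloc 1
  exact ⟨c, hc0, fun t => hasLeftVelocity_iff.2 (hc t)⟩

lemma curve_eq_of_leftVelocity {c c' : ℝ → G} {v : 𝔼} (hc : ∀ t, HasLeftVelocity c t v)
    (hc' : ∀ t, HasLeftVelocity c' t v) {t₀ : ℝ} (h : c t₀ = c' t₀) : c = c' := by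
  have := t2Space_of_lieGroup n G
  exact isMIntegralCurve_Ioo_eq_of_contMDiff_boundaryless (contMDiff_leftInvariant (G := G) v)
    (fun t => hasLeftVelocity_iff.1 (hc t)) (fun t => hasLeftVelocity_iff.1 (hc' t)) h

lemma HasLeftVelocity.comp_hasDerivAt {c : ℝ → G} {f : ℝ → ℝ} {t a : ℝ} {u : 𝔼}
    (hc : HasLeftVelocity c (f t) u) (hf : HasDerivAt f a t) :
    HasLeftVelocity (fun s => c (f s)) t (a • u) :=
  ⟨hc.1.comp hf.continuousAt, hc.2.scomp t hf⟩

/-- By uniqueness, the curve chosen in `groupExp` for `t • v` is the reparametrization `s ↦ c (s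
t)`. -/
lemma exp_smul_eq {c : ℝ → G} {v : 𝔼} (hc0 : c 0 = 1) (hc : ∀ t, HasLeftVelocity c t v) (t : ℝ) :
    ex (t • v) = c t := by
  have hex : ∃ c : ℝ → G, c 0 = 1 ∧ IsMIntegralCurve (I := 𝓡 n) c
      (mulInvariantVectorField (t • v : GroupLieAlgebra (𝓡 n) G)) := by
    obtain ⟨c, h0, h⟩ := exists_one_parameter_curve (G := G) (t • v)
    exact ⟨c, h0, fun t => hasLeftVelocity_iff.1 (h t)⟩
  obtain ⟨h0, h⟩ := Classical.epsilon_spec hex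
  have h1 : ∀ s, HasLeftVelocity (fun s => c (s * t)) s (t • v) := fun s =>
    (hc (s * t)).comp_hasDerivAt (f := fun s => s * t) (by simpa using (hasDerivAt_id s).mul_const t)
  have := curve_eq_of_leftVelocity (fun s => hasLeftVelocity_iff.2 (h s)) h1 (t₀ := 0)
    (by rw [h0]; simp [hc0])
  refine (congrFun this 1).trans ?_
  simp

lemma hasLeftVelocity_exp (v : 𝔼) (t : ℝ) : HasLeftVelocity (fun s : ℝ => ex (s • v)) t v := by
  obtain ⟨c, h0, h⟩ := exists_one_parameter_curve (G := G) v
  have : (fun s : ℝ => ex (s • v)) = c := funext fun s => exp_smul_eq h0 h s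
  rw [this]; exact h t

lemma exp_zero : ex (0 : 𝔼) = 1 := by
  obtain ⟨c, h0, h⟩ := exists_one_parameter_curve (G := G) (0 : 𝔼)
  simpa [h0] using exp_smul_eq h0 h 0

lemma exp_add_smul (v : 𝔼) (s t : ℝ) : ex ((s + t) • v) = ex (s • v) * ex (t • v) := by
  have h1 : ∀ t, HasLeftVelocity (fun t : ℝ => ex ((s + t) • v)) t v := fun t => by
    simpa using (hasLeftVelocity_exp v (s + t)).comp_hasDerivAt
      (f := fun t => s + t) ((hasDerivAt_id t).const_add s)
  have h2 : ∀ t, HasLeftVelocity (fun t : ℝ => ex (s • v) * ex (t • v)) t v := fun t =>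
    (hasLeftVelocity_exp v t).mul_left _
  exact congrFun (curve_eq_of_leftVelocity h1 h2 (t₀ := 0) (by simp [exp_zero])) t

lemma exp_neg (v : 𝔼) : ex (-v) = (ex v)⁻¹ := by
  have h := exp_add_smul (G := G) v (-1) 1
  rw [neg_add_cancel, zero_smul, exp_zero, one_smul, neg_one_smul] at h
  exact eq_inv_of_mul_eq_one_left h.symm

/-- Velocity of a quotient of two curves through the identity. -/
lemma hasDerivAt_mul_inv {c₁ c₂ : ℝ → G} {t : ℝ} {u₁ u₂ : 𝔼} (h₁ : HasLeftVelocity c₁ t u₁)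
    (h₂ : HasLeftVelocity c₂ t u₂) (e₁ : c₁ t = 1) (e₂ : c₂ t = 1) {g : G → F}
    (hg : MDifferentiableAt (𝓡 n) 𝓘(ℝ, F) g 1) :
    HasDerivAt (fun s => g (c₁ s * (c₂ s)⁻¹)) (leftDeriv n g 1 (u₁ - u₂)) t := by
  let H : 𝔼 × 𝔼 → F := fun p => g ((φ₁).symm p.1 * ((φ₁).symm p.2)⁻¹)
  have hH : DifferentiableAt ℝ H (φ₁ 1, φ₁ 1) := by
    rw [← mdifferentiableAt_iff_differentiableAt]
    have a1 : ContMDiffAt 𝓘(ℝ, 𝔼 × 𝔼) (𝓡 n) ∞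
        (fun p : 𝔼 × 𝔼 => (φ₁).symm p.1) (φ₁ 1, φ₁ 1) :=
      ContMDiffAt.comp_of_eq contMDiffAt_chartOne_symm contDiffAt_fst.contMDiffAt rfl
    have a2 : ContMDiffAt 𝓘(ℝ, 𝔼 × 𝔼) (𝓡 n) ∞
        (fun p : 𝔼 × 𝔼 => (φ₁).symm p.2) (φ₁ 1, φ₁ 1) :=
      ContMDiffAt.comp_of_eq contMDiffAt_chartOne_symm contDiffAt_snd.contMDiffAt rfl
    exact MDifferentiableAt.comp_of_eq (I' := 𝓡 n) (hg := hg)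
      (hf := (a1.mul a2.inv).mdifferentiableAt (by simp)) (hy := by simp)
  have hl : HasFDerivAt (fun a : 𝔼 => H (a, φ₁ 1)) ((fderiv ℝ H (φ₁ 1, φ₁ 1)).comp
      (ContinuousLinearMap.inl ℝ 𝔼 𝔼)) (φ₁ 1) :=
    HasFDerivAt.comp (φ₁ 1) (g := H) (f := fun a => (a, φ₁ 1)) hH.hasFDerivAt
      (hasFDerivAt_prodMk_left _ _)
  have hl' : HasFDerivAt (fun a : 𝔼 => H (a, φ₁ 1)) (leftDeriv n g 1) (φ₁ 1) := by
    have := hasFDerivAt_leftDeriv hg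
    simpa [H, chartOne_symm_one] using this
  -- `H` is constant on the diagonal, so its partial derivative in the second variable is minus the
  -- one in the first.
  have hd : HasFDerivAt (fun a : 𝔼 => H (a, a)) ((fderiv ℝ H (φ₁ 1, φ₁ 1)).comp
      ((ContinuousLinearMap.id ℝ 𝔼).prod (ContinuousLinearMap.id ℝ 𝔼))) (φ₁ 1) :=
    HasFDerivAt.comp (φ₁ 1) (g := H) (f := fun a => (a, a)) hH.hasFDerivAt
      ((hasFDerivAt_id _).prodMk (hasFDerivAt_id _))
  have hd' : HasFDerivAt (fun a : 𝔼 => H (a, a)) (0 : 𝔼 →L[ℝ] F) (φ₁ 1) := by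
    simpa [H] using hasFDerivAt_const (g 1) (φ₁ 1 : 𝔼)
  have e3 : ∀ u, fderiv ℝ H (φ₁ 1, φ₁ 1) (u, 0) = leftDeriv n g 1 u := fun u => by
    simpa using congrArg (fun T : 𝔼 →L[ℝ] F => T u) (hl.unique hl')
  have e4 : ∀ u, fderiv ℝ H (φ₁ 1, φ₁ 1) (u, u) = 0 := fun u => by
    simpa using congrArg (fun T : 𝔼 →L[ℝ] F => T u) (hd.unique hd')
  have e5 : fderiv ℝ H (φ₁ 1, φ₁ 1) (u₁, u₂) = leftDeriv n g 1 (u₁ - u₂) := by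
    rw [← e3, ← sub_zero (fderiv ℝ H _ (u₁, u₂)), ← e4 u₂, ← map_sub]
    simp
  have d1 := h₁.2
  have d2 := h₂.2
  simp only [e₁, e₂, inv_one, one_mul] at d1 d2
  have h3 := HasFDerivAt.comp_hasDerivAt_of_eq t hH.hasFDerivAt (d1.prodMk d2) (by rw [e₁, e₂])
  rw [e5] at h3
  refine h3.congr_of_eventuallyEq ?_
  have t1 : Tendsto c₁ (𝓝 t) (𝓝 1) := by simpa [e₁] using h₁.1.tendsto
  have t2 : Tendsto c₂ (𝓝 t) (𝓝 1) := by simpa [e₂] using h₂.1.tendsto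
  filter_upwards [t1.eventually (eventually_mem_chartOne_source (n := n)),
    t2.eventually (eventually_mem_chartOne_source (n := n))] with s hs1 hs2
  simp only [Function.comp_apply, H]
  rw [(φ₁).left_inv hs1, (φ₁).left_inv hs2]

lemma mdifferentiableAt_mul_mul {f : G → F} {a b : G}
    (hf : MDifferentiableAt (𝓡 n) 𝓘(ℝ, F) f (a * b)) :
    MDifferentiableAt (𝓡 n) 𝓘(ℝ, F) (fun z => f (a * z * b)) 1 := by
  have : ContMDiffAt (𝓡 n) (𝓡 n) ∞ (fun z : G => a * z * b) 1 :=
    (contMDiffAt_const.mul contMDiffAt_id).mul contMDiffAt_const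
  exact MDifferentiableAt.comp_of_eq (I' := 𝓡 n) (hg := hf)
    (hf := this.mdifferentiableAt (by simp)) (hy := by simp)

lemma mdifferentiableAt_comp_mul_right {f : G → F} {a b : G}
    (hf : MDifferentiableAt (𝓡 n) 𝓘(ℝ, F) f (a * b)) :
    MDifferentiableAt (𝓡 n) 𝓘(ℝ, F) (fun z => f (z * b)) a := by
  have : ContMDiffAt (𝓡 n) (𝓡 n) ∞ (fun z : G => z * b) a :=
    contMDiffAt_id.mul contMDiffAt_const
  exact MDifferentiableAt.comp (I' := 𝓡 n) a hf (this.mdifferentiableAt (by simp))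

lemma leftDeriv_mul_mul {f : G → F} {a b : G}
    (hf : MDifferentiableAt (𝓡 n) 𝓘(ℝ, F) f (a * b)) (w : 𝔼) :
    leftDeriv n (fun z => f (a * z * b)) 1 w = rightDeriv n f (a * b) (adjointRep n a w) := by
  rw [leftDeriv_comp_mul_left (fun z => f (z * b)), mul_one,
    leftDeriv_eq_rightDeriv_comp (mdifferentiableAt_comp_mul_right hf)]
  simp [rightDeriv, mul_assoc]

/-- With `σ = s - t`, the curve is `exp(-tv) · [exp(-σ v) exp(-σ (v + w))⁻¹] · exp(t(v + w))`. The
bracket passes through `1` at `s = t` with velocity `-v + (v + w) = w`, and moving it to the left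
end conjugates `w` by `exp(-tv)`. -/
lemma hasDerivAt_exp_inv_mul_exp (v w : 𝔼) (t : ℝ) {f : G → F}
    (hf : MDifferentiableAt (𝓡 n) 𝓘(ℝ, F) f (ex (-(t • v)) * ex (t • (v + w)))) :
    HasDerivAt (fun s : ℝ => f (ex (-(s • v)) * ex (s • (v + w))))
      (rightDeriv n f (ex (-(t • v)) * ex (t • (v + w))) (adjointRep n (ex (-(t • v))) w)) t := by
  have hv : ∀ u : 𝔼, HasLeftVelocity (fun s : ℝ => ex ((s - t) • u)) t u := fun u => by
    simpa using (hasLeftVelocity_exp u (t - t)).comp_hasDerivAt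
      (f := fun s => s - t) ((hasDerivAt_id t).sub_const t)
  have h := hasDerivAt_mul_inv (hv (-v)) (hv (-(v + w))) (by simp [exp_zero])
    (by simp [exp_zero]) (mdifferentiableAt_mul_mul hf)
  rw [leftDeriv_mul_mul hf] at h
  have e1 : -v - -(v + w) = w := by abel
  rw [e1] at h
  refine h.congr_of_eventuallyEq (Eventually.of_forall fun s => ?_)
  have e2 : ex (-(s • v)) = ex (-(t • v)) * ex ((s - t) • -v) := by
    have := exp_add_smul (G := G) (-v) t (s - t)
    rw [add_sub_cancel, smul_neg, smul_neg t] at this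
    exact this
  have e3 : ex (s • (v + w)) = (ex ((s - t) • -(v + w)))⁻¹ * ex (t • (v + w)) := by
    rw [← exp_neg, smul_neg, neg_neg, ← exp_add_smul, sub_add_cancel]
  simp only [e2, e3, mul_assoc]

end Exponential
end

/-! ### First-order expansion of the exponential map when `ad v` is nilpotent. -/

noncomputable section

section ExpDerivative

variable {n : ℕ} {G : Type*} [TopologicalSpace G] [ChartedSpace (EuclideanSpace ℝ (Fin n)) G]
  [Group G] {F : Type*} [NormedAddCommGroup F] [NormedSpace ℝ F]

local notation "𝔼" => EuclideanSpace ℝ (Fin n)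
local notation "φ₁" => extChartAt (𝓡 n) (1 : G)
local notation "ex" => lieExp n G

/-- The truncated series of `(1 - exp(-A)) / A`. -/
def dexpSeries {E : Type*} [NormedAddCommGroup E] [NormedSpace ℝ E] (K : ℕ) (A : E →L[ℝ] E) :
    E →L[ℝ] E :=
  ∑ k ∈ Finset.range K, ((-1 : ℝ) ^ k / (k + 1).factorial) • A ^ k

/-- The truncated exponential series is the solution of `f' = f A`. -/
lemma eq_sum_of_hasDerivAt_mul {E : Type*} [NormedAddCommGroup E] [NormedSpace ℝ E]
    {K : ℕ} {A : E →L[ℝ] E} (hA : A ^ K = 0)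
    {f : ℝ → E →L[ℝ] E} (hf : ∀ t, HasDerivAt f (f t * A) t) (h0 : f 0 = 1) (t : ℝ) :
    f t = ∑ k ∈ Finset.range K, (t ^ k / k.factorial) • A ^ k := by
  -- `A ^ 0 = 0` forces `1 = 0`, hence all operators vanish. Otherwise the exponent is a successor
  -- and the top term disappears after one more factor `A`.
  obtain _ | K := K
  · have h1 : (1 : E →L[ℝ] E) = 0 := by simpa using hA
    have : ∀ B : E →L[ℝ] E, B = 0 := fun B => by rw [← mul_one B, h1, mul_zero]
    rw [this (f t)]
    simp
  have hP : ∀ t : ℝ, HasDerivAt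
      (fun t : ℝ => ∑ k ∈ Finset.range (K + 1), (t ^ k / (k.factorial : ℝ)) • A ^ k)
      ((∑ k ∈ Finset.range (K + 1), (t ^ k / (k.factorial : ℝ)) • A ^ k) * A) t := by
    intro t
    have h1 : ∀ k ∈ Finset.range (K + 1), HasDerivAt
        (fun t : ℝ => (t ^ k / (k.factorial : ℝ)) • A ^ k)
        (((k : ℝ) * t ^ (k - 1) / (k.factorial : ℝ)) • A ^ k) t := fun k _ =>
      HasDerivAt.smul_const (F := E →L[ℝ] E) ((hasDerivAt_pow k t).div_const _) (A ^ k)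
    refine (HasDerivAt.fun_sum h1).congr_deriv ?_
    rw [Finset.sum_range_succ', Finset.sum_mul, Finset.sum_range_succ]
    rw [smul_mul_assoc _ (A ^ K), ← pow_succ, hA]
    simp only [Nat.cast_zero, zero_mul, zero_div, zero_smul, smul_zero]
    congr 1
    refine Finset.sum_congr rfl fun k _ => ?_
    rw [smul_mul_assoc, ← pow_succ, Nat.factorial_succ, Nat.add_sub_cancel]
    congr 1
    push_cast
    have : (k.factorial : ℝ) ≠ 0 := by positivity
    have : (k : ℝ) + 1 ≠ 0 := by positivity
    field_simp
  have h := ODE_solution_unique_univ (v := fun _ B => B * A) (s := fun _ => univ)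
    (K := ‖A‖₊) (t₀ := 0)
    (fun _ => LipschitzWith.lipschitzOnWith (LipschitzWith.of_dist_le_mul fun B B' => by
      rw [dist_eq_norm, dist_eq_norm, ← sub_mul, mul_comm]
      exact norm_mul_le _ _))
    (fun t => ⟨hf t, mem_univ _⟩) (fun t => ⟨hP t, mem_univ _⟩) (by
      rw [h0, Finset.sum_range_succ']
      simp)
  exact congrFun h t

lemma hasDerivAt_sum_antideriv {E : Type*} [NormedAddCommGroup E] [NormedSpace ℝ E]
    (K : ℕ) (A : E →L[ℝ] E) (t : ℝ) :
    HasDerivAt (fun t : ℝ => ∑ k ∈ Finset.range K,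
      ((-1 : ℝ) ^ k * t ^ (k + 1) / (k + 1).factorial) • A ^ k)
      (∑ k ∈ Finset.range K, ((-t) ^ k / k.factorial) • A ^ k) t := by
  refine HasDerivAt.fun_sum fun k _ => ?_
  have h : HasDerivAt (fun t : ℝ => (-1 : ℝ) ^ k * t ^ (k + 1) / (k + 1).factorial)
      ((-t) ^ k / k.factorial) t := by
    refine (((hasDerivAt_pow (k + 1) t).const_mul ((-1 : ℝ) ^ k)).div_const _).congr_deriv ?_
    rw [Nat.factorial_succ, neg_pow t]
    push_cast
    have : (k.factorial : ℝ) ≠ 0 := by positivity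
    have : (k : ℝ) + 1 ≠ 0 := by positivity
    field_simp
  exact HasDerivAt.smul_const (F := E →L[ℝ] E) h (A ^ k)

/-- Termwise integration of the truncated `exp(-tA)` from `0` to `1` is the origin of the
coefficients of `dexpSeries`. -/
lemma exists_antideriv_sum {E : Type*} [NormedAddCommGroup E] [NormedSpace ℝ E]
    (K : ℕ) (A : E →L[ℝ] E) :
    ∃ r : ℝ → E →L[ℝ] E, r 0 = 0 ∧ r 1 = dexpSeries K A ∧
      ∀ t : ℝ, HasDerivAt r (∑ k ∈ Finset.range K, ((-t) ^ k / (k.factorial : ℝ)) • A ^ k) t :=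
  ⟨_, by simp, by simp [dexpSeries], hasDerivAt_sum_antideriv K A⟩

variable [LieGroup (𝓡 n) ∞ G]

lemma hasDerivAt_adjointRep_exp (v : 𝔼) (t : ℝ) :
    HasDerivAt (fun s : ℝ => adjointRep n (ex (s • v)))
      (adjointRep n (ex (t • v)) * adCLM n G v) t :=
  (hasLeftVelocity_exp v t).hasDerivAt_adjointRep

lemma adjointRep_exp_eq_sum {K : ℕ} {v : 𝔼} (hK : adCLM n G v ^ K = 0) (t : ℝ) :
    adjointRep n (ex (t • v)) =
      ∑ k ∈ Finset.range K, (t ^ k / k.factorial) • adCLM n G v ^ k :=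
  eq_sum_of_hasDerivAt_mul hK (hasDerivAt_adjointRep_exp v)
    (by rw [zero_smul, exp_zero, adjointRep_one]; rfl) t

/-- An antiderivative of `t ↦ Ad(exp(-tv))`. -/
lemma exists_antideriv_adjointRep {K : ℕ} {v : 𝔼} (hK : adCLM n G v ^ K = 0) :
    ∃ r : ℝ → 𝔼 →L[ℝ] 𝔼, r 0 = 0 ∧ r 1 = dexpSeries K (adCLM n G v) ∧
      ∀ t, HasDerivAt r (adjointRep n (ex (-(t • v)))) t := by
  obtain ⟨r, h0, h1, hr⟩ := exists_antideriv_sum K (adCLM n G v)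
  refine ⟨r, h0, h1, fun t => ?_⟩
  rw [← neg_smul, adjointRep_exp_eq_sum hK]
  exact hr t

lemma rightDeriv_chartOne_one : rightDeriv n φ₁ (1 : G) = ContinuousLinearMap.id ℝ 𝔼 := by
  rw [← leftDeriv_one_eq_rightDeriv, leftDeriv_chartOne_one]

/-- A confining set for a continuity argument: its closedness in `G` comes from its being the image
of a compact ball, and the bound on `rightDeriv` from continuity at `1`, where that derivative is
the identity. -/
lemma exists_closed_chart_nhd {ε : ℝ} (hε : 0 < ε) :
    ∃ ρ > 0, IsClosed {z : G | z ∈ (φ₁).source ∧ ‖φ₁ z - φ₁ 1‖ ≤ ρ} ∧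
      ∀ z : G, z ∈ (φ₁).source → ‖φ₁ z - φ₁ 1‖ ≤ ρ →
        ‖rightDeriv n φ₁ z - ContinuousLinearMap.id ℝ 𝔼‖ ≤ ε := by
  have := t2Space_of_lieGroup n G
  have hcont : ContinuousAt (fun b => rightDeriv n φ₁ ((φ₁).symm b)) (φ₁ (1 : G)) := by
    refine ContinuousAt.comp_of_eq (f := (φ₁).symm) (g := rightDeriv n φ₁) ?_ contMDiffAt_chartOne_symm.continuousAt (chartOne_symm_one (n := n) (G := G))
    exact (contMDiffAt_rightDeriv contMDiffAt_chartOne_one).continuousAt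
  have h1 : ∀ᶠ b in 𝓝 (φ₁ (1 : G)),
      ‖rightDeriv n φ₁ ((φ₁).symm b) - ContinuousLinearMap.id ℝ 𝔼‖ < ε := by
    have := Metric.tendsto_nhds.1 hcont.tendsto ε hε
    rw [chartOne_symm_one, rightDeriv_chartOne_one] at this
    simpa only [dist_eq_norm] using this
  obtain ⟨ρ, hρ, hball⟩ := Metric.nhds_basis_closedBall.eventually_iff.1
    (h1.and (extChartAt_target_mem_nhds (I := 𝓡 n) (1 : G)))
  have himg : {z : G | z ∈ (φ₁).source ∧ ‖φ₁ z - φ₁ 1‖ ≤ ρ} =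
      (φ₁).symm '' Metric.closedBall (φ₁ 1) ρ := by
    ext z
    constructor
    · rintro ⟨hz, hz'⟩
      exact ⟨φ₁ z, by simpa [dist_eq_norm] using hz', (φ₁).left_inv hz⟩
    · rintro ⟨b, hb, rfl⟩
      have hbt := (hball hb).2
      refine ⟨(φ₁).map_target hbt, ?_⟩
      rw [(φ₁).right_inv hbt]
      simpa [dist_eq_norm] using hb
  refine ⟨ρ, hρ, ?_, fun z hz hz' => ?_⟩
  · rw [himg]
    refine ((isCompact_closedBall _ _).image_of_continuousOn ?_).isClosed
    exact (continuousOn_extChartAt_symm (I := 𝓡 n) (1 : G)).mono fun b hb => (hball hb).2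
  · have := (hball (x := φ₁ z) (by simpa [dist_eq_norm] using hz')).1
    rw [(φ₁).left_inv hz] at this
    exact this.le

/-- First-order expansion of the exponential map. -/
lemma exp_expansion {K : ℕ} {v : 𝔼} (hK : adCLM n G v ^ K = 0) {ε : ℝ} (hε : 0 < ε) :
    ∃ d > 0, ∀ w : 𝔼, ‖w‖ < d → ex (-v) * ex (v + w) ∈ (φ₁).source ∧
      ‖φ₁ (ex (-v) * ex (v + w)) - φ₁ 1 - dexpSeries K (adCLM n G v) w‖ ≤ ε * ‖w‖ := by
  obtain ⟨r, hr0, hr1, hr⟩ := exists_antideriv_adjointRep (G := G) hK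
  have hAc : Continuous fun t : ℝ => adjointRep n (ex (-(t • v))) := by
    have : (fun t : ℝ => adjointRep n (ex (-(t • v)))) =
        (fun t : ℝ => adjointRep n (ex (t • v))) ∘ fun t => -t := by
      ext1 t; simp
    rw [this]
    refine Continuous.comp ?_ continuous_neg
    exact continuous_iff_continuousAt.2 fun t => (hasDerivAt_adjointRep_exp v t).continuousAt
  obtain ⟨B₀, hB₀⟩ := (isCompact_Icc (a := (0 : ℝ)) (b := 1)).exists_bound_of_continuousOn
    hAc.continuousOn
  set B := max B₀ 1 with hBdef
  have hB1 : 1 ≤ B := le_max_right _ _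
  have hBpos : 0 < B := by linarith
  have hB : ∀ t ∈ Icc (0 : ℝ) 1, ‖adjointRep n (ex (-(t • v)))‖ ≤ B := fun t ht =>
    (hB₀ t ht).trans (le_max_left _ _)
  -- The bound `1` makes `‖rightDeriv‖ ≤ 2` on `C`, which confines the curve; `ε / B` yields the
  -- final error `ε ‖w‖`.
  obtain ⟨ρ, hρ, hCclosed, hC⟩ := exists_closed_chart_nhd (n := n) (G := G)
    (ε := min (ε / B) 1) (by positivity)
  set C : Set G := {z : G | z ∈ (φ₁).source ∧ ‖φ₁ z - φ₁ 1‖ ≤ ρ} with hCdef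
  -- In the chart the speed is at most `2 * B * ‖w‖ < ρ`, so the curve cannot reach the boundary of
  -- `C` before time `1`.
  refine ⟨ρ / (2 * B), by positivity, fun w hw => ?_⟩
  set δ : ℝ → G := fun t => ex (-(t • v)) * ex (t • (v + w)) with hδ
  have hδ0 : δ 0 = 1 := by simp [hδ, exp_zero]
  have hδc : Continuous δ := by
    have := topologicalGroup_of_lieGroup (𝓡 n) ∞ (G := G)
    have h1 : ∀ u : 𝔼, Continuous fun t : ℝ => ex (t • u) := fun u =>
      continuous_iff_continuousAt.2 fun t => (hasLeftVelocity_exp u t).1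
    have h2 := h1 (-v)
    simp only [smul_neg] at h2
    exact h2.mul (h1 _)
  have hderiv : ∀ t, δ t ∈ C → HasDerivAt (fun s => φ₁ (δ s))
      (rightDeriv n φ₁ (δ t) (adjointRep n (ex (-(t • v))) w)) t := fun t ht =>
    hasDerivAt_exp_inv_mul_exp v w t (mdifferentiableAt_chart 1 ht.1)
  have hnorm : ∀ z ∈ C, ‖rightDeriv n φ₁ z‖ ≤ 2 := by
    intro z hz
    have h1 := (hC z hz.1 hz.2).trans (min_le_right _ _)
    calc ‖rightDeriv n φ₁ z‖ = ‖(rightDeriv n φ₁ z - ContinuousLinearMap.id ℝ 𝔼) +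
          ContinuousLinearMap.id ℝ 𝔼‖ := by rw [sub_add_cancel]
      _ ≤ 1 + 1 := (norm_add_le _ _).trans
          (add_le_add h1 ContinuousLinearMap.norm_id_le)
      _ = 2 := by norm_num
  have hwB : 2 * B * ‖w‖ < ρ := by
    rw [lt_div_iff₀ (by positivity)] at hw
    linarith
  -- the curve stays in `C`
  have hstay : Icc (0 : ℝ) 1 ⊆ {t | ∀ θ ∈ Icc (0 : ℝ) 1, δ (θ * t) ∈ C} := by
    refine IsClosed.Icc_subset_of_forall_mem_nhdsWithin ?_ ?_ ?_
    · refine IsClosed.inter ?_ isClosed_Icc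
      simp only [ofPred_forall]
      refine isClosed_biInter fun θ _ => ?_
      exact hCclosed.preimage (hδc.comp (continuous_const.mul continuous_id))
    · intro θ _
      rw [mul_zero, hδ0]
      exact ⟨mem_extChartAt_source 1, by simpa using hρ.le⟩
    · rintro x ⟨hx, hx0, hx1⟩
      -- The rescalings `θ` were included in the set for this purpose: membership of `x` alone
      -- controls the curve on all of `[0, x]`.
      have hin : ∀ τ ∈ Icc 0 x, δ τ ∈ C := by
        intro τ hτ
        rcases hx0.eq_or_lt with h | h
        · have : τ = 0 := le_antisymm (h ▸ hτ.2) hτ.1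
          have := hx 0 (by simp)
          rw [zero_mul] at this
          simpa [‹τ = 0›] using this
        · have := hx (τ / x) ⟨by have := hτ.1; positivity, (div_le_one h).2 hτ.2⟩
          rwa [div_mul_cancel₀ _ h.ne'] at this
      have hbd := norm_image_sub_le_of_norm_deriv_le_segment' (C := 2 * B * ‖w‖)
        (f := fun s => φ₁ (δ s)) (a := 0) (b := x)
        (fun τ hτ => (hderiv τ (hin τ hτ)).hasDerivWithinAt) (fun τ hτ => by
          have hτ' : τ ∈ Icc 0 x := Ico_subset_Icc_self hτ
          have h1 := hB τ ⟨hτ.1, hτ.2.le.trans hx1.le⟩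
          calc _ ≤ ‖rightDeriv n φ₁ (δ τ)‖ * (‖adjointRep n (ex (-(τ • v)))‖ * ‖w‖) :=
                (ContinuousLinearMap.le_opNorm _ _).trans
                  (mul_le_mul_of_nonneg_left (ContinuousLinearMap.le_opNorm _ _) (norm_nonneg _))
            _ ≤ 2 * (B * ‖w‖) := by
                gcongr
                exact hnorm _ (hin τ hτ')
            _ = 2 * B * ‖w‖ := by ring) x (right_mem_Icc.2 hx0)
      have hlt : ‖φ₁ (δ x) - φ₁ 1‖ < ρ := by
        rw [hδ0, sub_zero] at hbd
        refine lt_of_le_of_lt (hbd.trans ?_) hwB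
        exact mul_le_of_le_one_right (by positivity) hx1.le
      have hxs := (hin x (right_mem_Icc.2 hx0)).1
      have hev : ∀ᶠ t in 𝓝 x, δ t ∈ C := by
        have h1 : ContinuousAt (fun t => ‖φ₁ (δ t) - φ₁ 1‖) x := by
          refine ((ContinuousAt.comp (continuousAt_extChartAt' (by simpa using hxs))
            hδc.continuousAt).sub continuousAt_const).norm
        filter_upwards [h1.eventually_lt continuousAt_const hlt,
          hδc.continuousAt.eventually (extChartAt_source_mem_nhds' hxs)] with t ht1 ht2
        exact ⟨ht2, ht1.le⟩
      obtain ⟨η, hη, hball⟩ := Metric.eventually_nhds_iff.1 hev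
      filter_upwards [Ioo_mem_nhdsGT (show x < x + η by linarith)] with t ht θ hθ
      by_cases hle : θ * t ≤ x
      · exact hin _ ⟨mul_nonneg hθ.1 (hx0.trans ht.1.le), hle⟩
      · push Not at hle
        apply hball
        have : θ * t ≤ t := mul_le_of_le_one_left (hx0.trans ht.1.le) hθ.2
        rw [Real.dist_eq, abs_lt]
        constructor <;> linarith [ht.2]
  have hin : ∀ t ∈ Icc (0 : ℝ) 1, δ t ∈ C := fun t ht => by
    simpa using hstay ht 1 (by simp)
  have hδ1 : δ 1 = ex (-v) * ex (v + w) := by simp [hδ]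
  rw [← hδ1]
  refine ⟨(hin 1 (by simp)).1, ?_⟩
  -- The derivative of `r s w` is `Ad(exp(-sv)) w`, which is the velocity of the curve in the chart
  -- up to the error `rightDeriv n φ₁ - id`.
  have hfin := norm_image_sub_le_of_norm_deriv_le_segment_01' (C := ε * ‖w‖)
    (f := fun s => φ₁ (δ s) - r s w)
    (fun τ hτ => ((hderiv τ (hin τ hτ)).sub
      ((hr τ).clm_apply (hasDerivAt_const τ w))).hasDerivWithinAt) (fun τ hτ => by
        have hτ' : τ ∈ Icc (0 : ℝ) 1 := Ico_subset_Icc_self hτ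
        have h1 := (hC _ (hin τ hτ').1 (hin τ hτ').2).trans (min_le_left _ _)
        have h2 : rightDeriv n φ₁ (δ τ) (adjointRep n (ex (-(τ • v))) w) -
            (adjointRep n (ex (-(τ • v))) w + r τ 0) =
            (rightDeriv n φ₁ (δ τ) - ContinuousLinearMap.id ℝ 𝔼)
              (adjointRep n (ex (-(τ • v))) w) := by simp
        rw [h2]
        calc _ ≤ (ε / B) * (B * ‖w‖) :=
              (ContinuousLinearMap.le_opNorm _ _).trans (mul_le_mul h1
                ((ContinuousLinearMap.le_opNorm _ _).trans
                  (mul_le_mul_of_nonneg_right (hB τ hτ') (norm_nonneg _)))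
                (norm_nonneg _) (by positivity))
          _ = ε * ‖w‖ := by field_simp)
  simp only [hδ0, hr0, hr1] at hfin
  refine le_trans (le_of_eq ?_) hfin
  congr 1
  simp only [zero_apply, sub_zero]
  abel

end ExpDerivative
end

/-! ### Differentiability of the exponential map. -/

noncomputable section

section ExpRegularity

variable {n : ℕ} {G : Type*} [TopologicalSpace G] [ChartedSpace (EuclideanSpace ℝ (Fin n)) G]
  [Group G] {F : Type*} [NormedAddCommGroup F] [NormedSpace ℝ F]

local notation "𝔼" => EuclideanSpace ℝ (Fin n)
local notation "φ₁" => extChartAt (𝓡 n) (1 : G)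
local notation "ex" => lieExp n G

variable [LieGroup (𝓡 n) ∞ G]

/-- The exponential map followed by translation, read in the chart at the identity. -/
lemma hasFDerivAt_chart_exp_inv_mul {K : ℕ} {v : 𝔼} (hK : adCLM n G v ^ K = 0) :
    HasFDerivAt (fun w => φ₁ (ex (-v) * ex (v + w))) (dexpSeries K (adCLM n G v)) 0 := by
  rw [hasFDerivAt_iff_isLittleO_nhds_zero, Asymptotics.isLittleO_iff]
  intro ε hε
  obtain ⟨d, hd, h⟩ := exp_expansion hK hε
  filter_upwards [Metric.ball_mem_nhds (0 : 𝔼) hd] with w hw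
  have := (h w (by simpa using hw)).2
  rw [zero_add, add_zero, exp_neg v, inv_mul_cancel, ← exp_neg v]
  exact this

lemma tendsto_exp_inv_mul {K : ℕ} {v : 𝔼} (hK : adCLM n G v ^ K = 0) :
    Tendsto (fun w => ex (-v) * ex (v + w)) (𝓝 0) (𝓝 1) := by
  obtain ⟨d, hd, h⟩ := exp_expansion hK one_pos
  have h1 := (hasFDerivAt_chart_exp_inv_mul hK).continuousAt.tendsto
  simp only [add_zero] at h1
  rw [exp_neg v, inv_mul_cancel, ← exp_neg v] at h1
  refine (tendsto_chartOne_symm.comp h1).congr' ?_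
  filter_upwards [Metric.ball_mem_nhds (0 : 𝔼) hd] with w hw
  exact (φ₁).left_inv (h w (by simpa using hw)).1

lemma continuousAt_exp {K : ℕ} {v : 𝔼} (hK : adCLM n G v ^ K = 0) : ContinuousAt ex v := by
  have := topologicalGroup_of_lieGroup (𝓡 n) ∞ (G := G)
  have h := (tendsto_exp_inv_mul hK).const_mul (ex v)
  rw [mul_one] at h
  rw [ContinuousAt, ← map_add_left_nhds_zero v]
  refine tendsto_map'_iff.2 (h.congr fun w => ?_)
  rw [exp_neg, mul_inv_cancel_left]
  rfl

/-- Factor `exp(v + w) = exp v · (exp(-v) exp(v + w))`: the second factor has the expansion above,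
and the left translation by `exp v` becomes `leftDeriv`. -/
lemma hasFDerivAt_comp_exp {K : ℕ} {v : 𝔼} (hK : adCLM n G v ^ K = 0) {f : G → F}
    (hf : MDifferentiableAt (𝓡 n) 𝓘(ℝ, F) f (ex v)) :
    HasFDerivAt (fun w => f (ex w))
      ((leftDeriv n f (ex v)).comp (dexpSeries K (adCLM n G v))) v := by
  have h1 : HasFDerivAt (fun b => f (ex v * (φ₁).symm b)) (leftDeriv n f (ex v))
      (φ₁ (ex (-v) * ex (v + 0))) := by
    rw [add_zero, exp_neg, inv_mul_cancel]
    exact hasFDerivAt_leftDeriv hf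
  have h2 := h1.comp (0 : 𝔼) (hasFDerivAt_chart_exp_inv_mul hK)
  have h3 : HasFDerivAt (fun w => f (ex (v + w)))
      ((leftDeriv n f (ex v)).comp (dexpSeries K (adCLM n G v))) 0 := by
    refine h2.congr_of_eventuallyEq ?_
    obtain ⟨d, hd, h⟩ := exp_expansion hK one_pos
    filter_upwards [Metric.ball_mem_nhds (0 : 𝔼) hd] with w hw
    simp only [Function.comp_apply]
    rw [(φ₁).left_inv (h w (by simpa using hw)).1, exp_neg, mul_inv_cancel_left]
  have h4 := (hasFDerivAt_comp_add_left (f := fun w => f (ex w)) v (x := 0)).1 h3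
  rwa [add_zero] at h4

lemma hasLeftVelocity_exp_comp {K : ℕ} {x : ℝ → 𝔼} {t : ℝ} {u : 𝔼}
    (hK : adCLM n G (x t) ^ K = 0) (hx : HasDerivAt x u t) :
    HasLeftVelocity (fun s => ex (x s)) t (dexpSeries K (adCLM n G (x t)) u) := by
  refine ⟨ContinuousAt.comp (f := x) (g := ex) (continuousAt_exp hK) hx.continuousAt, ?_⟩
  have h1 : MDifferentiableAt (𝓡 n) 𝓘(ℝ, 𝔼) φ₁ ((ex (x t))⁻¹ * ex (x t)) := by
    rw [inv_mul_cancel]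
    exact mdifferentiableAt_chart 1 (mem_extChartAt_source 1)
  have h2 : MDifferentiableAt (𝓡 n) 𝓘(ℝ, 𝔼) (fun z => φ₁ ((ex (x t))⁻¹ * z)) (ex (x t)) :=
    MDifferentiableAt.comp (I' := 𝓡 n) (g := φ₁) (ex (x t)) h1 (mdifferentiableAt_leftMul _ _)
  have h3 := (hasFDerivAt_comp_exp hK h2).comp_hasDerivAt t hx
  refine h3.congr_deriv ?_
  rw [leftDeriv_comp_mul_left (φ₁), inv_mul_cancel, leftDeriv_chartOne_one]
  rfl

lemma continuous_dexpSeries (K : ℕ) {H E : Type*} [NormedAddCommGroup E] [NormedSpace ℝ E]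
    [TopologicalSpace H] {A : H → E →L[ℝ] E} (hA : Continuous A) :
    Continuous fun v => dexpSeries K (A v) := by
  unfold dexpSeries
  refine continuous_finsetSum _ fun k _ => ?_
  have h : Continuous fun v => A v ^ k := hA.pow k
  exact h.const_smul ((-1 : ℝ) ^ k / (k + 1).factorial)

/-- Smooth functions of the exponential map are strictly differentiable. -/
lemma hasStrictFDerivAt_comp_exp {K : ℕ} (hK : ∀ v, adCLM n G v ^ K = 0) {v : 𝔼}
    {f : G → F} (hf : ContMDiffAt (𝓡 n) 𝓘(ℝ, F) ∞ f (ex v)) :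
    HasStrictFDerivAt (fun w => f (ex w))
      ((leftDeriv n f (ex v)).comp (dexpSeries K (adCLM n G v))) v :=
  hasStrictFDerivAt_of_hasFDerivAt_of_continuousAt
    (f := fun w => f (ex w))
    (f' := fun w => (leftDeriv n f (ex w)).comp (dexpSeries K (adCLM n G w))) (x := v)
    (((continuousAt_exp (hK v)).eventually (eventually_smooth hf)).mono
      fun w hw => hasFDerivAt_comp_exp (hK w) hw)
    (ContinuousAt.clm_comp
      (ContinuousAt.comp (f := ex) (g := leftDeriv n f) (contMDiffAt_leftDeriv hf).continuousAt
        (continuousAt_exp (hK v)))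
      (continuous_dexpSeries K (adCLM n G).continuous).continuousAt)

end ExpRegularity
end

/-! ### Absolute continuity around a time of `[0,1]`. -/

noncomputable section

section LocalAbsoluteContinuity


/-- Only increments enter the definition, so domination of increments transfers absolute continuity,
also between different target spaces. -/
lemma AbsolutelyContinuousOnInterval.of_dist_le {X Y : Type*} [PseudoMetricSpace X]
    [PseudoMetricSpace Y] {g : ℝ → X} {h : ℝ → Y} {a b : ℝ} (C : ℝ)
    (hg : AbsolutelyContinuousOnInterval g a b)
    (hd : ∀ s ∈ uIcc a b, ∀ t ∈ uIcc a b, dist (h s) (h t) ≤ C * dist (g s) (g t)) :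
    AbsolutelyContinuousOnInterval h a b := by
  have h0 := Tendsto.const_mul C hg
  rw [mul_zero] at h0
  refine squeeze_zero' (Eventually.of_forall fun E => Finset.sum_nonneg fun _ _ => dist_nonneg)
    ?_ h0
  filter_upwards [eventually_inf_principal.2 (Eventually.of_forall fun E hE => hE)] with E hE
  rw [Finset.mul_sum]
  exact Finset.sum_le_sum fun i hi => hd _ (hE.1 i hi).1 _ (hE.1 i hi).2

lemma AbsolutelyContinuousOnInterval.prodMk {X Y : Type*} [PseudoMetricSpace X]
    [PseudoMetricSpace Y] {g : ℝ → X} {h : ℝ → Y} {a b : ℝ}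
    (hg : AbsolutelyContinuousOnInterval g a b) (hh : AbsolutelyContinuousOnInterval h a b) :
    AbsolutelyContinuousOnInterval (fun t => (g t, h t)) a b := by
  have h0 := Tendsto.add hg hh
  rw [add_zero] at h0
  refine squeeze_zero (fun E => Finset.sum_nonneg fun _ _ => dist_nonneg) (fun E => ?_) h0
  rw [← Finset.sum_add_distrib]
  exact Finset.sum_le_sum fun i _ => max_le_add_of_nonneg dist_nonneg dist_nonneg

variable {X Y : Type*} [NormedAddCommGroup X] [NormedSpace ℝ X] [NormedAddCommGroup Y]
  [NormedSpace ℝ Y]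

/-- Absolute continuity, as a function on `[0,1]`, around a time. -/
def LocallyACAt (g : ℝ → X) (t₀ : ℝ) : Prop :=
  ∃ a b : ℝ, Icc a b ⊆ Icc 0 1 ∧ Icc a b ∈ 𝓝[Icc (0 : ℝ) 1] t₀ ∧
    AbsolutelyContinuousOnInterval g a b

variable {g : ℝ → X} {t₀ : ℝ}

lemma exists_Icc_subset_of_mem_nhdsWithin (ht₀ : t₀ ∈ Icc (0 : ℝ) 1) {s : Set ℝ}
    (hs : s ∈ 𝓝[Icc (0 : ℝ) 1] t₀) :
    ∃ a b : ℝ, a ≤ b ∧ Icc a b ⊆ Icc 0 1 ∧ Icc a b ∈ 𝓝[Icc (0 : ℝ) 1] t₀ ∧ Icc a b ⊆ s := by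
  obtain ⟨ε, hε, h⟩ := Metric.mem_nhdsWithin_iff.1 hs
  have h0 := ht₀.1
  have h1 := ht₀.2
  refine ⟨max 0 (t₀ - ε / 2), min 1 (t₀ + ε / 2), ?_, ?_, ?_, ?_⟩
  · exact (max_le h0 (by linarith)).trans (le_min h1 (by linarith))
  · exact Icc_subset_Icc (le_max_left _ _) (min_le_left _ _)
  · refine mem_of_superset (inter_mem self_mem_nhdsWithin
      (mem_nhdsWithin_of_mem_nhds (Icc_mem_nhds (a := t₀ - ε / 2) (b := t₀ + ε / 2)
        (by linarith) (by linarith)))) ?_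
    rw [Icc_inter_Icc]
  · intro t ht
    have h2 := max_le_iff.1 ht.1
    have h3 := le_min_iff.1 ht.2
    refine h ⟨?_, h2.1, h3.1⟩
    rw [Metric.mem_ball, Real.dist_eq, abs_lt]
    constructor <;> linarith [h2.2, h3.2]

lemma LocallyACAt.shrink (hg : LocallyACAt g t₀) (ht₀ : t₀ ∈ Icc (0 : ℝ) 1) {s : Set ℝ}
    (hs : s ∈ 𝓝[Icc (0 : ℝ) 1] t₀) :
    ∃ a b : ℝ, a ≤ b ∧ Icc a b ⊆ Icc 0 1 ∧ Icc a b ∈ 𝓝[Icc (0 : ℝ) 1] t₀ ∧ Icc a b ⊆ s ∧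
      AbsolutelyContinuousOnInterval g a b := by
  obtain ⟨a, b, hab, hnhds, hac⟩ := hg
  obtain ⟨c, d, hcd, h01, hcdn, hsub⟩ :=
    exists_Icc_subset_of_mem_nhdsWithin ht₀ (inter_mem hs hnhds)
  refine ⟨c, d, hcd, h01, hcdn, fun t ht => (hsub ht).1, hac.mono ?_⟩
  rw [uIcc_of_le hcd]
  exact fun t ht => Icc_subset_uIcc (hsub ht).2

lemma LocallyACAt.continuousWithinAt (hg : LocallyACAt g t₀) (ht₀ : t₀ ∈ Icc (0 : ℝ) 1) :
    ContinuousWithinAt g (Icc 0 1) t₀ := by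
  obtain ⟨a, b, hab, h01, hn, -, hac⟩ := hg.shrink ht₀ univ_mem
  have hd : AbsolutelyContinuousOnInterval (fun t => dist (g t) (g t₀)) a b :=
    hac.of_dist_le 1 fun s _ t _ => by
      rw [one_mul, Real.dist_eq]
      exact abs_dist_sub_le _ _ _
  have hc := hd.uniformContinuousOn.continuousOn
  rw [uIcc_of_le hab] at hc
  have h := (hc t₀ (mem_of_mem_nhdsWithin ht₀ hn)).mono_of_mem_nhdsWithin hn
  rw [ContinuousWithinAt, dist_self] at h
  exact tendsto_iff_dist_tendsto_zero.2 h

lemma LocallyACAt.comp_lipschitzOnWith (hg : LocallyACAt g t₀) (ht₀ : t₀ ∈ Icc (0 : ℝ) 1)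
    {f : X → Y} {C : NNReal} {U : Set X} (hU : U ∈ 𝓝 (g t₀)) (hf : LipschitzOnWith C f U) :
    LocallyACAt (fun t => f (g t)) t₀ := by
  obtain ⟨a, b, hab, h01, hn, hs, hac⟩ := hg.shrink ht₀ (hg.continuousWithinAt ht₀ hU)
  refine ⟨a, b, h01, hn, hac.of_dist_le C fun s hs' t ht' => ?_⟩
  rw [uIcc_of_le hab] at hs' ht'
  exact hf.dist_le_mul _ (hs hs') _ (hs ht')

lemma LocallyACAt.prodMk {h : ℝ → Y} (hg : LocallyACAt g t₀) (hh : LocallyACAt h t₀)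
    (ht₀ : t₀ ∈ Icc (0 : ℝ) 1) : LocallyACAt (fun t => (g t, h t)) t₀ := by
  obtain ⟨a, b, h01, hn, hac⟩ := hg
  obtain ⟨c, d, hcd, h01', hn', hs, hac'⟩ := hh.shrink ht₀ hn
  refine ⟨c, d, h01', hn', AbsolutelyContinuousOnInterval.prodMk (hac.mono ?_) hac'⟩
  rw [uIcc_of_le hcd]
  exact fun t ht => Icc_subset_uIcc (hs ht)

lemma LocallyACAt.congr {h : ℝ → X} (hg : LocallyACAt g t₀) (ht₀ : t₀ ∈ Icc (0 : ℝ) 1)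
    (hgh : ∀ᶠ t in 𝓝[Icc (0 : ℝ) 1] t₀, g t = h t) : LocallyACAt h t₀ := by
  obtain ⟨a, b, hab, h01, hn, hs, hac⟩ := hg.shrink ht₀ hgh
  refine ⟨a, b, h01, hn, hac.of_dist_le 1 fun s hs' t ht' => ?_⟩
  rw [uIcc_of_le hab] at hs' ht'
  have e1 : g s = h s := hs hs'
  have e2 : g t = h t := hs ht'
  rw [e1, e2, one_mul]

lemma LocallyACAt.comp_hasStrictFDerivAt (hg : LocallyACAt g t₀)
    (ht₀ : t₀ ∈ Icc (0 : ℝ) 1) {f : X → Y} {f' : X →L[ℝ] Y} (hf : HasStrictFDerivAt f f' (g t₀)) :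
    LocallyACAt (fun t => f (g t)) t₀ := by
  obtain ⟨C, U, hU, h⟩ := hf.exists_lipschitzOnWith
  exact hg.comp_lipschitzOnWith ht₀ hU h

lemma LocallyACAt.comp_contDiffAt (hg : LocallyACAt g t₀) (ht₀ : t₀ ∈ Icc (0 : ℝ) 1)
    {f : X → Y} (hf : ContDiffAt ℝ ∞ f (g t₀)) : LocallyACAt (fun t => f (g t)) t₀ :=
  hg.comp_hasStrictFDerivAt ht₀ (hf.hasStrictFDerivAt (by simp))

/-- Connectedness of `[0,1]` passes from local constancy, which can be checked in charts, to
constancy. -/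
lemma eq_of_eventually_eq_nhdsWithin {α : Type*} {g : ℝ → α}
    (h : ∀ t₀ ∈ Icc (0 : ℝ) 1, ∀ᶠ t in 𝓝[Icc (0 : ℝ) 1] t₀, g t = g t₀)
    {t : ℝ} (ht : t ∈ Icc (0 : ℝ) 1) : g t = g 0 := by
  have h1 : IsLocallyConstant fun t : Icc (0 : ℝ) 1 => g t := by
    rw [IsLocallyConstant.iff_eventually_eq]
    intro x
    rw [nhds_subtype_eq_comap_nhdsWithin]
    exact (h x x.2).comap _
  exact h1.apply_eq_of_preconnectedSpace ⟨t, ht⟩ ⟨0, by simp⟩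

lemma LocallyACAt.eventually_eq {F : Type*} [NormedAddCommGroup F] [NormedSpace ℝ F]
    {g : ℝ → F} (hg : LocallyACAt g t₀) (ht₀ : t₀ ∈ Icc (0 : ℝ) 1) {s : Set ℝ}
    (hs : s ∈ 𝓝[Icc (0 : ℝ) 1] t₀)
    (h : ∀ᵐ t ∂(volume.restrict (Icc (0 : ℝ) 1)), t ∈ s → HasDerivAt g 0 t) :
    ∀ᶠ t in 𝓝[Icc (0 : ℝ) 1] t₀, g t = g t₀ := by
  obtain ⟨a, b, hab, h01, hn, hsub, hac⟩ := hg.shrink ht₀ hs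
  obtain ⟨C, hC⟩ := hac.const_of_ae_hasDerivAt_zero (by
    rw [ae_restrict_iff' measurableSet_Icc] at h
    filter_upwards [h] with t ht ht'
    rw [uIcc_of_le hab] at ht'
    exact ht (h01 ht') (hsub ht'))
  rw [uIcc_of_le hab] at hC
  filter_upwards [hn] with t ht
  rw [hC t ht, hC t₀ (mem_of_mem_nhdsWithin ht₀ hn)]

lemma eq_of_locallyACAt_of_ae_hasDerivAt_zero {F : Type*} [NormedAddCommGroup F]
    [NormedSpace ℝ F] {g : ℝ → F} (hg : ∀ t₀ ∈ Icc (0 : ℝ) 1, LocallyACAt g t₀)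
    (h : ∀ᵐ t ∂(volume.restrict (Icc (0 : ℝ) 1)), HasDerivAt g 0 t) {t : ℝ}
    (ht : t ∈ Icc (0 : ℝ) 1) : g t = g 0 :=
  eq_of_eventually_eq_nhdsWithin (fun t₀ ht₀ => (hg t₀ ht₀).eventually_eq ht₀ univ_mem
    (h.mono fun _ ht _ => ht)) ht

/-- Primitives are absolutely continuous. -/
lemma absolutelyContinuousOnInterval_integral {F : Type*} [NormedAddCommGroup F]
    [NormedSpace ℝ F] {v : ℝ → F} {a b : ℝ} (hv : IntervalIntegrable v volume a b)
    {c : ℝ} (hc : c ∈ uIcc a b) :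
    AbsolutelyContinuousOnInterval (fun t => ∫ s in c..t, v s) a b := by
  refine (hv.norm.absolutelyContinuousOnInterval_intervalIntegral hc).of_dist_le 1
    fun s hs t ht => ?_
  have h1 : ∀ r ∈ uIcc a b, ∀ r' ∈ uIcc a b, IntervalIntegrable v volume r r' :=
    fun r hr r' hr' => hv.mono_set (uIcc_subset_uIcc hr hr')
  rw [one_mul, dist_eq_norm, dist_eq_norm,
    intervalIntegral.integral_interval_sub_left (h1 c hc s hs) (h1 c hc t ht),
    intervalIntegral.integral_interval_sub_left (h1 c hc s hs).norm (h1 c hc t ht).norm]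
  exact intervalIntegral.norm_integral_le_abs_integral_norm

end LocalAbsoluteContinuity
end

/-! ### Horizontal paths as curves driven by square integrable controls. -/

noncomputable section

section HorizontalPaths

variable {n : ℕ} {G : Type*} [TopologicalSpace G] [ChartedSpace (EuclideanSpace ℝ (Fin n)) G]
  [Group G] {F : Type*} [NormedAddCommGroup F] [NormedSpace ℝ F]

local notation "𝔼" => EuclideanSpace ℝ (Fin n)
local notation "φ₁" => extChartAt (𝓡 n) (1 : G)
local notation "ex" => lieExp n G

variable [LieGroup (𝓡 n) ∞ G]

lemma memLp_clm_apply {E : Type*} [NormedAddCommGroup E] [NormedSpace ℝ E]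
    {A : ℝ → E →L[ℝ] F} {w : ℝ → E} {a b : ℝ} (hA : ContinuousOn A (Icc a b))
    (hw : MemLp w 2 (volume.restrict (Icc a b))) :
    MemLp (fun t => A t (w t)) 2 (volume.restrict (Icc a b)) := by
  obtain ⟨C, hC⟩ := isCompact_Icc.exists_bound_of_continuousOn hA
  refine MemLp.of_le_mul (c := C) hw ?_ ?_
  · exact (ContinuousLinearMap.id ℝ (E →L[ℝ] F)).aestronglyMeasurable_comp₂
      (hA.aestronglyMeasurable_of_isCompact isCompact_Icc measurableSet_Icc)
      hw.aestronglyMeasurable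
  · filter_upwards [self_mem_ae_restrict measurableSet_Icc] with t ht
    exact (A t).le_of_opNorm_le (hC t ht) _

lemma memLp_Icc_of_locally {w : ℝ → F}
    (h : ∀ t₀ ∈ Icc (0 : ℝ) 1, ∃ s ∈ 𝓝[Icc (0 : ℝ) 1] t₀, MemLp w 2 (volume.restrict s)) :
    MemLp w 2 (volume.restrict (Icc (0 : ℝ) 1)) := by
  refine isCompact_Icc.induction_on (p := fun s => MemLp w 2 (volume.restrict s)) ?_ ?_ ?_ h
  · simp
  · exact fun s t hst ht => ht.mono_measure (Measure.restrict_mono hst le_rfl)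
  · intro s t hs ht
    have hm := aestronglyMeasurable_union_iff.2 ⟨hs.1, ht.1⟩
    rw [memLp_two_iff_integrable_sq_norm hm]
    exact IntegrableOn.union ((memLp_two_iff_integrable_sq_norm hs.1).1 hs)
      ((memLp_two_iff_integrable_sq_norm ht.1).1 ht)

lemma leftDeriv_chart_isInvertible {x₀ x : G} (hx : x ∈ (extChartAt (𝓡 n) x₀).source) :
    (leftDeriv n (extChartAt (𝓡 n) x₀) x).IsInvertible := by
  obtain ⟨e, he⟩ := exists_equiv_leftDeriv_chart hx
  exact ⟨e, he⟩

/-- Local absolute continuity and continuity, within `[0,1]`, of a curve of `G`. -/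
def CurveACAt (n : ℕ) {G : Type*} [TopologicalSpace G]
    [ChartedSpace (EuclideanSpace ℝ (Fin n)) G] (γ : ℝ → G) (t₀ : ℝ) : Prop :=
  ContinuousWithinAt γ (Icc 0 1) t₀ ∧
    LocallyACAt (fun t => extChartAt (𝓡 n) (γ t₀) (γ t)) t₀

variable {γ γ' : ℝ → G} {t₀ : ℝ}

lemma CurveACAt.eventually_mem_source (h : CurveACAt n γ t₀) {x₀ : G}
    (hx : γ t₀ ∈ (extChartAt (𝓡 n) x₀).source) :
    ∀ᶠ t in 𝓝[Icc (0 : ℝ) 1] t₀, γ t ∈ (extChartAt (𝓡 n) x₀).source :=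
  h.1 (extChartAt_source_mem_nhds' hx)

lemma curveACAt_of_eventually_mem_source (ht₀ : t₀ ∈ Icc (0 : ℝ) 1)
    (hs : ∀ᶠ t in 𝓝[Icc (0 : ℝ) 1] t₀, γ t ∈ (extChartAt (𝓡 n) (γ t₀)).source)
    (h : LocallyACAt (fun t => extChartAt (𝓡 n) (γ t₀) (γ t)) t₀) : CurveACAt n γ t₀ := by
  refine ⟨?_, h⟩
  have h1 : ContinuousAt (extChartAt (𝓡 n) (γ t₀)).symm (extChartAt (𝓡 n) (γ t₀) (γ t₀)) :=
    continuousAt_extChartAt_symm (I := 𝓡 n) (γ t₀)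
  have h2 := h1.tendsto.comp (h.continuousWithinAt ht₀)
  rw [extChartAt_to_inv] at h2
  refine h2.congr' ?_
  filter_upwards [hs] with t ht
  exact (extChartAt (𝓡 n) (γ t₀)).left_inv ht

lemma CurveACAt.comp_smooth (h : CurveACAt n γ t₀) (ht₀ : t₀ ∈ Icc (0 : ℝ) 1) {f : G → F}
    (hf : ContMDiffAt (𝓡 n) 𝓘(ℝ, F) ∞ f (γ t₀)) : LocallyACAt (fun t => f (γ t)) t₀ := by
  refine (h.2.comp_contDiffAt ht₀ (chart_comp_contDiffAt (mem_extChartAt_source (γ t₀)) le_rfl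
    hf)).congr ht₀ ?_
  filter_upwards [h.eventually_mem_source (mem_extChartAt_source (γ t₀))] with t ht
  simp only [Function.comp_apply]
  rw [(extChartAt (𝓡 n) (γ t₀)).left_inv ht]

lemma CurveACAt.mul (h : CurveACAt n γ t₀) (h' : CurveACAt n γ' t₀)
    (ht₀ : t₀ ∈ Icc (0 : ℝ) 1) : CurveACAt n (fun t => γ t * γ' t) t₀ := by
  have := topologicalGroup_of_lieGroup (𝓡 n) ∞ (G := G)
  refine ⟨h.1.mul h'.1, ?_⟩
  have h1 : ContMDiffAt 𝓘(ℝ, 𝔼 × 𝔼) (𝓡 n) ∞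
      (fun p : 𝔼 × 𝔼 => (extChartAt (𝓡 n) (γ t₀)).symm p.1)
      (extChartAt (𝓡 n) (γ t₀) (γ t₀), extChartAt (𝓡 n) (γ' t₀) (γ' t₀)) :=
    ContMDiffAt.comp_of_eq (I' := 𝓘(ℝ, 𝔼)) (g := (extChartAt (𝓡 n) (γ t₀)).symm)
      (f := Prod.fst)
      (contMDiffAt_chart_symm (γ t₀) (mem_extChartAt_target (γ t₀)))
      contDiff_fst.contDiffAt.contMDiffAt rfl
  have h2 : ContMDiffAt 𝓘(ℝ, 𝔼 × 𝔼) (𝓡 n) ∞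
      (fun p : 𝔼 × 𝔼 => (extChartAt (𝓡 n) (γ' t₀)).symm p.2)
      (extChartAt (𝓡 n) (γ t₀) (γ t₀), extChartAt (𝓡 n) (γ' t₀) (γ' t₀)) :=
    ContMDiffAt.comp_of_eq (I' := 𝓘(ℝ, 𝔼)) (g := (extChartAt (𝓡 n) (γ' t₀)).symm)
      (f := Prod.snd)
      (contMDiffAt_chart_symm (γ' t₀) (mem_extChartAt_target (γ' t₀)))
      contDiff_snd.contDiffAt.contMDiffAt rfl
  have h3 := contMDiffAt_mul_mul (f := extChartAt (𝓡 n) (γ t₀ * γ' t₀)) le_rfl h1 h2 (by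
    simp only [extChartAt_to_inv]
    exact contMDiffAt_chart _ (mem_extChartAt_source _))
  refine (LocallyACAt.comp_contDiffAt (LocallyACAt.prodMk h.2 h'.2 ht₀) ht₀ h3).congr ht₀ ?_
  filter_upwards [h.eventually_mem_source (mem_extChartAt_source (γ t₀)),
    h'.eventually_mem_source (mem_extChartAt_source (γ' t₀))] with t ht ht'
  rw [(extChartAt (𝓡 n) (γ t₀)).left_inv ht, (extChartAt (𝓡 n) (γ' t₀)).left_inv ht']

lemma CurveACAt.inv (h : CurveACAt n γ t₀) (ht₀ : t₀ ∈ Icc (0 : ℝ) 1) :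
    CurveACAt n (fun t => (γ t)⁻¹) t₀ := by
  have := topologicalGroup_of_lieGroup (𝓡 n) ∞ (G := G)
  refine ⟨h.1.inv, h.comp_smooth (f := fun x => extChartAt (𝓡 n) (γ t₀)⁻¹ x⁻¹) ht₀ ?_⟩
  exact ContMDiffAt.comp (I' := 𝓡 n) (γ t₀) (g := extChartAt (𝓡 n) (γ t₀)⁻¹)
    (f := fun x : G => x⁻¹)
    (contMDiffAt_chart _ (mem_extChartAt_source _)) contMDiffAt_id.inv

lemma CurveACAt.const (g : G) (t₀ : ℝ) :
    CurveACAt n (fun _ => g) t₀ :=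
  ⟨continuousWithinAt_const, 0, 1, Subset.rfl, self_mem_nhdsWithin, by
    refine (absolutelyContinuousOnInterval_iff _ _ _).2 fun ε hε => ⟨1, one_pos, ?_⟩
    intros
    simpa using hε⟩

/-- A curve which is absolutely continuous with vanishing velocity is constant. -/
lemma CurveACAt.eq_of_ae_hasDerivAt_zero (h : ∀ t ∈ Icc (0 : ℝ) 1, CurveACAt n γ t)
    (h0 : ∀ᵐ t ∂(volume.restrict (Icc (0 : ℝ) 1)), ∀ x₀ : G,
      γ t ∈ (extChartAt (𝓡 n) x₀).source →
        HasDerivAt (fun s => extChartAt (𝓡 n) x₀ (γ s)) 0 t) {t : ℝ}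
    (ht : t ∈ Icc (0 : ℝ) 1) : γ t = γ 0 := by
  refine eq_of_eventually_eq_nhdsWithin (fun t₀ ht₀ => ?_) ht
  have hs := (h t₀ ht₀).eventually_mem_source (mem_extChartAt_source (γ t₀))
  filter_upwards [hs, (h t₀ ht₀).2.eventually_eq ht₀ hs
    (h0.mono fun t ht h' => ht _ h')] with t h1 h2
  exact (extChartAt (𝓡 n) (γ t₀)).injOn h1 (mem_extChartAt_source _) h2

lemma continuousOn_of_continuousOn_chart {x₀ : G} {s : Set ℝ}
    (hs : ∀ t ∈ s, γ t ∈ (extChartAt (𝓡 n) x₀).source)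
    (hc : ContinuousOn (fun t => extChartAt (𝓡 n) x₀ (γ t)) s) : ContinuousOn γ s := by
  have h1 := (continuousOn_extChartAt_symm (I := 𝓡 n) x₀).comp hc
    fun t ht => (extChartAt (𝓡 n) x₀).map_source (hs t ht)
  exact h1.congr fun t ht => ((extChartAt (𝓡 n) x₀).left_inv (hs t ht)).symm

lemma continuousOn_leftDeriv_chart {x₀ : G} {s : Set ℝ}
    (hs : ∀ t ∈ s, γ t ∈ (extChartAt (𝓡 n) x₀).source) (hc : ContinuousOn γ s) :
    ContinuousOn (fun t => leftDeriv n (extChartAt (𝓡 n) x₀) (γ t)) s := fun t ht =>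
  ContinuousAt.comp_continuousWithinAt (f := γ) (g := leftDeriv n (extChartAt (𝓡 n) x₀))
    (contMDiffAt_leftDeriv (contMDiffAt_chart x₀ (hs t ht))).continuousAt (hc t ht)

lemma continuousOn_leftDeriv_chart_inverse {x₀ : G} {s : Set ℝ}
    (hs : ∀ t ∈ s, γ t ∈ (extChartAt (𝓡 n) x₀).source) (hc : ContinuousOn γ s) :
    ContinuousOn (fun t => (leftDeriv n (extChartAt (𝓡 n) x₀) (γ t)).inverse) s := fun t ht =>
  ContinuousAt.comp_continuousWithinAt (g := ContinuousLinearMap.inverse)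
    ((leftDeriv_chart_isInvertible (hs t ht)).contDiffAt_map_inverse (n := 0)).continuousAt
    (continuousOn_leftDeriv_chart hs hc t ht)

/-- Horizontal paths of a left-invariant distribution are the absolutely continuous curves driven
by a square integrable control with values in `V`. -/
lemma isHorizontalPath_iff {V : Submodule ℝ 𝔼} :
    IsHorizontalPath (leftInvariantDistribution (G := G) V) γ ↔
      (∀ t ∈ Icc (0 : ℝ) 1, CurveACAt n γ t) ∧
      ∃ u : ℝ → 𝔼, MemLp u 2 (volume.restrict (Icc (0 : ℝ) 1)) ∧
        ∀ᵐ t ∂(volume.restrict (Icc (0 : ℝ) 1)),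
          u t ∈ V ∧ HasLeftVelocity γ t (u t) := by
  constructor
  · rintro ⟨h1, h2⟩
    have hex : ∀ᵐ t ∂(volume.restrict (Icc (0 : ℝ) 1)), ∃ u : 𝔼,
        u ∈ V ∧ HasLeftVelocity γ t u := by
      filter_upwards [h2] with t ht
      obtain ⟨v, hv, hd⟩ := ht
      obtain ⟨u, hu, rfl⟩ := hv
      exact ⟨u, hu, hasLeftVelocity_iff.2 hd⟩
    -- This choice carries no measurability by itself. It is recovered below: in each chart `u`
    -- agrees almost everywhere with the inverse of the left derivative of the chart applied to the
    -- `L²` chart velocity.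
    let u : ℝ → 𝔼 := fun t => Classical.epsilon fun u : 𝔼 =>
      u ∈ V ∧ HasLeftVelocity γ t u
    have hu : ∀ᵐ t ∂(volume.restrict (Icc (0 : ℝ) 1)),
        u t ∈ V ∧ HasLeftVelocity γ t (u t) := by
      filter_upwards [hex] with t ht
      exact Classical.epsilon_spec ht
    refine ⟨fun t₀ ht₀ => ?_, u, memLp_Icc_of_locally fun t₀ ht₀ => ?_, hu⟩
    · obtain ⟨a, b, hab, hn, hs, hac, -⟩ := h1 t₀ ht₀
      exact curveACAt_of_eventually_mem_source ht₀ (mem_of_superset hn hs) ⟨a, b, hab, hn, hac⟩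
    · obtain ⟨a, b, hab, hn, hs, hac, hL⟩ := h1 t₀ ht₀
      refine ⟨Icc a b, hn, ?_⟩
      have hle : a ≤ b := nonempty_Icc.1 ⟨t₀, mem_of_mem_nhdsWithin ht₀ hn⟩
      have hc := hac.continuousOn
      rw [uIcc_of_le hle] at hc
      refine (memLp_congr_ae ?_).1
        (memLp_clm_apply (continuousOn_leftDeriv_chart_inverse hs
          (continuousOn_of_continuousOn_chart hs hc)) hL)
      filter_upwards [ae_restrict_of_ae_restrict_of_subset hab hu,
        self_mem_ae_restrict measurableSet_Icc] with t ht ht'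
      rw [(ht.2.hasDerivAt (mdifferentiableAt_chart _ (hs t ht'))).deriv]
      exact (leftDeriv_chart_isInvertible (hs t ht')).inverse_apply_self _
  · rintro ⟨h1, u, hL, hu⟩
    refine ⟨fun t₀ ht₀ => ?_, ?_⟩
    · obtain ⟨a, b, hle, hab, hn, hs, hac⟩ := (h1 t₀ ht₀).2.shrink ht₀
        ((h1 t₀ ht₀).eventually_mem_source (mem_extChartAt_source (γ t₀)))
      refine ⟨a, b, hab, hn, hs, hac, ?_⟩
      have hc := hac.continuousOn
      rw [uIcc_of_le hle] at hc
      refine (memLp_congr_ae ?_).1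
        (memLp_clm_apply (continuousOn_leftDeriv_chart hs
          (continuousOn_of_continuousOn_chart hs hc))
          (hL.mono_measure (Measure.restrict_mono hab le_rfl)))
      filter_upwards [ae_restrict_of_ae_restrict_of_subset hab hu,
        self_mem_ae_restrict measurableSet_Icc] with t ht ht'
      exact (ht.2.hasDerivAt (mdifferentiableAt_chart _ (hs ht'))).deriv.symm
    · filter_upwards [hu] with t ht
      exact ⟨_, ⟨u t, ht.1, rfl⟩, hasLeftVelocity_iff.1 ht.2⟩

/-- Strict differentiability of the exponential in charts makes it locally Lipschitz, which
preserves absolute continuity. -/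
lemma curveACAt_exp_comp {K : ℕ} (hK : ∀ v, adCLM n G v ^ K = 0) {x : ℝ → 𝔼}
    (ht₀ : t₀ ∈ Icc (0 : ℝ) 1) (hx : LocallyACAt x t₀) : CurveACAt n (fun t => ex (x t)) t₀ := by
  refine ⟨ContinuousAt.comp_continuousWithinAt (f := x) (g := ex) (continuousAt_exp (hK (x t₀)))
    (hx.continuousWithinAt ht₀), ?_⟩
  have h1 := hasStrictFDerivAt_comp_exp hK
    (contMDiffAt_chart (ex (x t₀)) (mem_extChartAt_source (ex (x t₀))))
  have h2 := LocallyACAt.comp_hasStrictFDerivAt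
    (f := fun w => extChartAt (𝓡 n) (ex (x t₀)) (ex w)) hx ht₀ h1
  exact h2

end HorizontalPaths
end

/-! ### Nilpotent filtrations and the equation `Φ(x) x' = u`. -/

noncomputable section

section NilpotentControl

/-- The lower filtration attached to a bracket-generating nilpotent subspace of a Lie algebra. -/
lemma exists_filtration_of_bracket {L : Type*} [LieRing L] [LieAlgebra ℝ L]
    {P : ℕ → Submodule ℝ L}
    (hP : ∀ k, P (k + 1) = Submodule.span ℝ {u | ∃ v ∈ P 0, ∃ w ∈ P k, ⁅v, w⁆ = u})
    {s k : ℕ} (hs : ∑ i ∈ Finset.range s, P i = ⊤) (hk : P k = ⊥) :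
    ∃ D : ℕ → Submodule ℝ L, D 0 = ⊤ ∧ Antitone D ∧ D k = ⊥ ∧
      ∀ j, ∀ x : L, ∀ d ∈ D j, ⁅x, d⁆ ∈ D (j + 1) := by
  -- Induction on `a` by the Jacobi identity. The extra `1` is there because `P i` stands for
  -- `V^(i+1)`.
  have hmul : ∀ a b, ∀ x ∈ P a, ∀ y ∈ P b, ⁅x, y⁆ ∈ P (a + b + 1) := by
    intro a
    induction a with
    | zero =>
      intro b x hx y hy
      rw [zero_add, hP]
      exact Submodule.subset_span ⟨x, hx, y, hy, rfl⟩
    | succ a ih =>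
      intro b x hx y hy
      rw [hP] at hx
      induction hx using Submodule.span_induction with
      | mem x hx =>
        obtain ⟨v, hv, w, hw, rfl⟩ := hx
        rw [lie_lie]
        refine Submodule.sub_mem _ ?_ ?_
        · have h1 := ih b w hw y hy
          rw [show a + 1 + b + 1 = (a + b + 1) + 1 by ring, hP]
          exact Submodule.subset_span ⟨v, hv, _, h1, rfl⟩
        · have h1 : ⁅v, y⁆ ∈ P (b + 1) := by
            rw [hP]
            exact Submodule.subset_span ⟨v, hv, y, hy, rfl⟩
          have h2 := ih (b + 1) w hw _ h1
          rwa [show a + (b + 1) + 1 = a + 1 + b + 1 by ring] at h2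
      | zero => rw [zero_lie]; exact Submodule.zero_mem _
      | add x x' _ _ h h' => rw [add_lie]; exact Submodule.add_mem _ h h'
      | smul c x _ h => rw [smul_lie]; exact Submodule.smul_mem _ c h
  have hbot : ∀ i, P (k + i) = ⊥ := by
    intro i
    induction i with
    | zero => exact hk
    | succ i ih =>
      rw [← add_assoc, hP, Submodule.span_eq_bot]
      rintro _ ⟨v, -, w, hw, rfl⟩
      rw [ih, Submodule.mem_bot] at hw
      rw [hw, lie_zero]
  have htop : ⨆ i, P (0 + i) = ⊤ := by
    rw [eq_top_iff, ← hs]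
    refine Finset.sum_induction P (· ≤ ⨆ i, P (0 + i)) (fun _ _ h h' => sup_le h h') bot_le
      fun i _ => ?_
    have := le_iSup (fun i => P (0 + i)) i
    rwa [zero_add] at this
  -- `D j` collects the brackets of length greater than `j`. Any `x` is a sum of elements of the `P
  -- a`, so `hmul` shows that bracketing with it goes at least one level down.
  refine ⟨fun j => ⨆ i, P (j + i), htop, ?_, ?_, fun j x d hd => ?_⟩
  · intro a b hab
    refine iSup_le fun i => ?_
    have := le_iSup (fun i => P (a + i)) (b - a + i)
    rwa [show a + (b - a + i) = b + i by omega] at this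
  · simp only [hbot, iSup_const]
  · have hx : x ∈ ⨆ i, P (0 + i) := htop ▸ Submodule.mem_top
    induction hx using Submodule.iSup_induction' with
    | mem a x hx =>
      rw [zero_add] at hx
      induction hd using Submodule.iSup_induction' with
      | mem b d hd =>
        have h1 := hmul a (j + b) x hx d hd
        rw [show a + (j + b) + 1 = j + 1 + (a + b) by ring] at h1
        exact Submodule.mem_iSup_of_mem _ h1
      | zero => rw [lie_zero]; exact Submodule.zero_mem _
      | add d d' _ _ h h' => rw [lie_add]; exact Submodule.add_mem _ h h'
    | zero => rw [zero_lie]; exact Submodule.zero_mem _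
    | add x x' _ _ h h' => rw [add_lie]; exact Submodule.add_mem _ h h'

variable {E : Type*} [NormedAddCommGroup E] [NormedSpace ℝ E]

lemma pow_apply_mem_of_filtration {B : E →L[ℝ] E →L[ℝ] E} {D : ℕ → Submodule ℝ E}
    (hB : ∀ j, ∀ x, ∀ d ∈ D j, B x d ∈ D (j + 1)) (x : E) (k j : ℕ) {d : E} (hd : d ∈ D j) :
    (B x ^ k) d ∈ D (j + k) := by
  induction k with
  | zero => simpa using hd
  | succ k ih =>
    rw [pow_succ']
    exact hB (j + k) x _ ih

lemma pow_eq_zero_of_filtration {B : E →L[ℝ] E →L[ℝ] E} {D : ℕ → Submodule ℝ E}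
    (hB : ∀ j, ∀ x, ∀ d ∈ D j, B x d ∈ D (j + 1)) (h0 : D 0 = ⊤) {K : ℕ} (hK : D K = ⊥)
    (x : E) : B x ^ K = 0 := by
  ext d
  have := pow_apply_mem_of_filtration hB x K 0 (d := d) (h0 ▸ Submodule.mem_top)
  rw [zero_add, hK, Submodule.mem_bot] at this
  rw [this]
  rfl

lemma dexpSeries_apply (K : ℕ) (A : E →L[ℝ] E) (d : E) :
    dexpSeries K A d = ∑ k ∈ Finset.range K, ((-1 : ℝ) ^ k / (k + 1).factorial) • (A ^ k) d := by
  simp [dexpSeries]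

lemma dexpSeries_apply_mem {K : ℕ} {A : E →L[ℝ] E} {H : Submodule ℝ E}
    (hA : ∀ d ∈ H, A d ∈ H) {d : E} (hd : d ∈ H) : dexpSeries K A d ∈ H := by
  rw [dexpSeries_apply]
  refine Submodule.sum_mem _ fun k hk => Submodule.smul_mem _ _ ?_
  clear hk
  induction k with
  | zero => simpa using hd
  | succ k ih =>
    rw [pow_succ']
    exact hA _ ih

/-- The series starts with the identity, and every other term brackets with `x` at least once. With
the next lemma, this is the contraction behind the Picard iteration. -/
lemma sub_dexpSeries_mem_of_filtration {B : E →L[ℝ] E →L[ℝ] E} {D : ℕ → Submodule ℝ E}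
    (hB : ∀ j, ∀ x, ∀ d ∈ D j, B x d ∈ D (j + 1)) (hD : Antitone D) (K : ℕ) (x : E) {j : ℕ}
    {d : E} (hd : d ∈ D j) : d - dexpSeries (K + 1) (B x) d ∈ D (j + 1) := by
  rw [dexpSeries_apply, Finset.sum_range_succ']
  simp only [pow_zero, zero_add, Nat.factorial_one, Nat.cast_one, div_one, one_smul,
    one_apply_eq_self]
  rw [sub_add_cancel_right, Submodule.neg_mem_iff]
  refine Submodule.sum_mem _ fun k _ => Submodule.smul_mem _ _ ?_
  exact hD (by omega) (pow_apply_mem_of_filtration hB x (k + 1) j hd)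

/-- Telescoping the powers isolates factors `B (x - y)`. Antisymmetry moves `x - y ∈ D j` to the
second argument, where the filtration gains a level. -/
lemma dexpSeries_sub_mem_of_filtration {B : E →L[ℝ] E →L[ℝ] E} {D : ℕ → Submodule ℝ E}
    (hB : ∀ j, ∀ x, ∀ d ∈ D j, B x d ∈ D (j + 1)) (hD : Antitone D)
    (hsw : ∀ x y, B x y = -B y x) (K : ℕ) {x y : E} {j : ℕ} (hxy : x - y ∈ D j) (d : E) :
    dexpSeries K (B x) d - dexpSeries K (B y) d ∈ D (j + 1) := by
  rw [dexpSeries_apply, dexpSeries_apply, ← Finset.sum_sub_distrib]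
  refine Submodule.sum_mem _ fun k hk => ?_
  clear hk
  rw [← smul_sub]
  refine Submodule.smul_mem _ _ ?_
  induction k with
  | zero => simp
  | succ k ih =>
    rw [pow_succ', pow_succ']
    have h1 : (B x * B x ^ k) d - (B y * B y ^ k) d =
        B x ((B x ^ k) d - (B y ^ k) d) + B (x - y) ((B y ^ k) d) := by
      simp only [mul_apply_eq_comp, map_sub, sub_apply]
      abel
    rw [h1]
    refine Submodule.add_mem _ (hD (Nat.le_succ _) (hB _ x _ ih)) ?_
    rw [hsw, Submodule.neg_mem_iff]
    exact hB _ _ _ hxy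

/-- A subspace is an intersection of kernels of linear forms, and these commute with the integral.
-/
lemma intervalIntegral_mem_of_ae_mem [FiniteDimensional ℝ E] (H : Submodule ℝ E) {v : ℝ → E}
    (hi : IntegrableOn v (Icc 0 1))
    (hv : ∀ᵐ t ∂(volume.restrict (Icc (0 : ℝ) 1)), v t ∈ H) {t : ℝ} (ht : t ∈ Icc (0 : ℝ) 1) :
    ∫ s in (0 : ℝ)..t, v s ∈ H := by
  rw [intervalIntegral.integral_of_le ht.1]
  have hsub : Ioc 0 t ⊆ Icc (0 : ℝ) 1 := fun s hs => ⟨hs.1.le, hs.2.trans ht.2⟩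
  have := FiniteDimensional.complete ℝ E
  by_contra hne
  obtain ⟨f, hf, hf'⟩ := Submodule.exists_le_ker_of_notMem hne
  apply hf
  have h2 := (LinearMap.toContinuousLinearMap f).integral_comp_comm (hi.mono_set hsub)
  refine h2.symm.trans (integral_eq_zero_of_ae ?_)
  filter_upwards [ae_restrict_of_ae_restrict_of_subset hsub hv] with s hs
  exact hf' hs

/-- The Picard iterates for the equation `Φ (a + ∫ v) v = u`. -/
def dexpPicard (B : E →L[ℝ] E →L[ℝ] E) (K : ℕ) (u : ℝ → E) (a : E) : ℕ → ℝ → E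
  | 0 => 0
  | j + 1 => fun t => u t + (dexpPicard B K u a j t -
      dexpSeries K (B (a + ∫ s in (0 : ℝ)..t, dexpPicard B K u a j s)) (dexpPicard B K u a j t))

lemma continuousOn_primitive_unit [CompleteSpace E] {v : ℝ → E} (hv : IntegrableOn v (Icc 0 1)) :
    ContinuousOn (fun t => ∫ s in (0 : ℝ)..t, v s) (Icc 0 1) := by
  have := intervalIntegral.continuousOn_primitive_interval (μ := volume) (a := 0) (b := 1)
    (f := v) (by rwa [uIcc_of_le zero_le_one])
  rwa [uIcc_of_le zero_le_one] at this

lemma integrableOn_clm_apply {A : ℝ → E →L[ℝ] E} {w : ℝ → E} {a b : ℝ}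
    (hA : ContinuousOn A (Icc a b)) (hw : IntegrableOn w (Icc a b)) :
    IntegrableOn (fun t => A t (w t)) (Icc a b) := by
  obtain ⟨C, hC⟩ := isCompact_Icc.exists_bound_of_continuousOn hA
  refine Integrable.mono' (hw.norm.const_mul C) ?_ ?_
  · exact (ContinuousLinearMap.id ℝ (E →L[ℝ] E)).aestronglyMeasurable_comp₂
      (hA.aestronglyMeasurable_of_isCompact isCompact_Icc measurableSet_Icc)
      hw.aestronglyMeasurable
  · filter_upwards [self_mem_ae_restrict measurableSet_Icc] with t ht
    exact (A t).le_of_opNorm_le (hC t ht) _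

lemma integrableOn_dexpPicard [CompleteSpace E] (B : E →L[ℝ] E →L[ℝ] E) (K : ℕ) {u : ℝ → E}
    (a : E) (hu : IntegrableOn u (Icc 0 1)) (j : ℕ) :
    IntegrableOn (dexpPicard B K u a j) (Icc 0 1) := by
  induction j with
  | zero => exact integrableOn_zero
  | succ j ih =>
    refine hu.add (ih.sub (integrableOn_clm_apply ?_ ih))
    exact (continuous_dexpSeries K B.continuous).comp_continuousOn
      (continuousOn_const.add (continuousOn_primitive_unit ih))

/-- In a nilpotent Lie algebra, every integrable control with values in a subalgebra is the
control of `exp x` for some absolutely continuous curve `x` in the subalgebra. -/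
lemma exists_dexpSeries_eq [FiniteDimensional ℝ E] {B : E →L[ℝ] E →L[ℝ] E}
    {D : ℕ → Submodule ℝ E} (hB : ∀ j, ∀ x, ∀ d ∈ D j, B x d ∈ D (j + 1)) (hD : Antitone D)
    (hsw : ∀ x y, B x y = -B y x) (h0 : D 0 = ⊤) {K : ℕ} (hK : D (K + 1) = ⊥)
    {H : Submodule ℝ E} (hH : ∀ x ∈ H, ∀ y ∈ H, B x y ∈ H) {a : E} (ha : a ∈ H) {u : ℝ → E}
    (hu : IntegrableOn u (Icc 0 1))
    (huH : ∀ᵐ t ∂(volume.restrict (Icc (0 : ℝ) 1)), u t ∈ H) :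
    ∃ v : ℝ → E, IntegrableOn v (Icc 0 1) ∧
      (∀ t ∈ Icc (0 : ℝ) 1, a + ∫ s in (0 : ℝ)..t, v s ∈ H) ∧
      ∀ᵐ t ∂(volume.restrict (Icc (0 : ℝ) 1)),
        dexpSeries (K + 1) (B (a + ∫ s in (0 : ℝ)..t, v s)) (v t) = u t := by
  have := FiniteDimensional.complete ℝ E
  set v := dexpPicard B (K + 1) u a with hv
  have hi := integrableOn_dexpPicard B (K + 1) a hu
  have hmem : ∀ j, ∀ᵐ t ∂(volume.restrict (Icc (0 : ℝ) 1)), v j t ∈ H := by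
    intro j
    induction j with
    | zero => exact Eventually.of_forall fun t => Submodule.zero_mem _
    | succ j ih =>
      filter_upwards [ih, huH, self_mem_ae_restrict measurableSet_Icc] with t ht hut htI
      refine Submodule.add_mem _ hut (Submodule.sub_mem _ ht (dexpSeries_apply_mem ?_ ht))
      exact hH _ (Submodule.add_mem _ ha (intervalIntegral_mem_of_ae_mem H (hi j) ih htI))
  -- Consecutive iterates agree modulo `D j`. Since `D (K + 1) = ⊥`, the iterate `K + 1` is almost
  -- everywhere a fixed point, that is, a solution.
  have hdiff : ∀ j, ∀ᵐ t ∂(volume.restrict (Icc (0 : ℝ) 1)), v (j + 1) t - v j t ∈ D j := by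
    intro j
    induction j with
    | zero => exact Eventually.of_forall fun t => h0 ▸ Submodule.mem_top
    | succ j ih =>
      filter_upwards [ih, self_mem_ae_restrict measurableSet_Icc] with t ht htI
      have hx : (a + ∫ s in (0 : ℝ)..t, v j s) - (a + ∫ s in (0 : ℝ)..t, v (j + 1) s) ∈ D j := by
        have h1 := intervalIntegral_mem_of_ae_mem (D j) ((hi (j + 1)).sub (hi j)) ih htI
        have h2 : ∀ i, IntervalIntegrable (v i) volume 0 t := fun i =>
          ((hi i).mono_set (by
            rw [uIcc_of_le htI.1]; exact Icc_subset_Icc_right htI.2)).intervalIntegrable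
        rw [← neg_sub, Submodule.neg_mem_iff, add_sub_add_left_eq_sub,
          ← intervalIntegral.integral_sub (h2 _) (h2 _)]
        exact h1
      -- With `x_j = a + ∫ v_j` and `d = v_(j+1) - v_j`, the next difference is `(d - Φ(x_(j+1)) d)
      -- + (Φ(x_j) - Φ(x_(j+1))) v_j`; `h3` and `h4` treat the two summands.
      have h3 := sub_dexpSeries_mem_of_filtration hB hD K
        (a + ∫ s in (0 : ℝ)..t, v (j + 1) s) ht
      have h4 := dexpSeries_sub_mem_of_filtration hB hD hsw (K + 1) hx (v j t)
      have h5 := Submodule.add_mem _ h3 h4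
      convert h5 using 1
      have e1 : v (j + 1 + 1) t = u t + (v (j + 1) t -
        dexpSeries (K + 1) (B (a + ∫ s in (0 : ℝ)..t, v (j + 1) s)) (v (j + 1) t)) := rfl
      have e2 : v (j + 1) t = u t + (v j t -
        dexpSeries (K + 1) (B (a + ∫ s in (0 : ℝ)..t, v j s)) (v j t)) := rfl
      rw [e1, map_sub]
      nth_rw 3 [e2]
      abel
  refine ⟨v (K + 1), hi _, fun t ht => Submodule.add_mem _ ha
    (intervalIntegral_mem_of_ae_mem H (hi _) (hmem _) ht), ?_⟩
  filter_upwards [hdiff (K + 1)] with t ht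
  rw [hK, Submodule.mem_bot, sub_eq_zero] at ht
  have e1 : v (K + 1 + 1) t = u t + (v (K + 1) t -
    dexpSeries (K + 1) (B (a + ∫ s in (0 : ℝ)..t, v (K + 1) s)) (v (K + 1) t)) := rfl
  rw [e1] at ht
  have h6 := sub_eq_zero.2 ht
  rw [← sub_eq_zero, ← neg_eq_zero, ← h6]
  abel

end NilpotentControl
end

/-! ### Curves of `G` with control in a subalgebra. -/

noncomputable section

section ControlledCurves

variable {n : ℕ} {G : Type*} [TopologicalSpace G] [ChartedSpace (EuclideanSpace ℝ (Fin n)) G]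
  [Group G] {F : Type*} [NormedAddCommGroup F] [NormedSpace ℝ F]

local notation "𝔼" => EuclideanSpace ℝ (Fin n)
local notation "φ₁" => extChartAt (𝓡 n) (1 : G)
local notation "ex" => lieExp n G

variable [LieGroup (𝓡 n) ∞ G]

/-- A filtration of the Lie algebra of `G` witnessing its nilpotency. -/
structure IsNilpotentFiltration (n : ℕ) (G : Type*) [TopologicalSpace G]
    [ChartedSpace (EuclideanSpace ℝ (Fin n)) G] [Group G] (K : ℕ)
    (D : ℕ → Submodule ℝ (EuclideanSpace ℝ (Fin n))) : Prop where
  zero_eq_top : D 0 = ⊤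
  antitone : Antitone D
  eq_bot : D (K + 1) = ⊥
  ad_mem : ∀ j, ∀ x, ∀ d ∈ D j, adCLM n G x d ∈ D (j + 1)

lemma exists_isNilpotentFiltration {V : Submodule ℝ (GroupLieAlgebra (𝓡 n) G)} {s : ℕ}
    (hs : bracketSum V s = ⊤) (hnil : IsBracketNilpotent V) :
    ∃ K D, IsNilpotentFiltration n G K D := by
  obtain ⟨k, hk⟩ := hnil
  obtain ⟨D, h0, hanti, hbot, hlie⟩ := exists_filtration_of_bracket (L := GroupLieAlgebra (𝓡 n) G)
    (P := bracketPower V) (fun _ => rfl) hs hk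
  refine ⟨k, D, h0, hanti, ?_, fun j x d hd => ?_⟩
  -- Vanishing is recorded at `k + 1` so that the truncated series always contains its identity
  -- term.
  · exact le_bot_iff.1 ((hanti (Nat.le_succ k)).trans hbot.le)
  · have h1 := hlie j x d hd
    exact (congrArg (fun z : GroupLieAlgebra (𝓡 n) G => z ∈ D (j + 1)) (lie_eq_adCLM x d)).mp h1

lemma IsNilpotentFiltration.pow_eq_zero {K : ℕ} {D : ℕ → Submodule ℝ 𝔼}
    (h : IsNilpotentFiltration n G K D) (v : 𝔼) : adCLM n G v ^ (K + 1) = 0 :=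
  pow_eq_zero_of_filtration h.ad_mem h.zero_eq_top h.eq_bot v

variable {γ γ' : ℝ → G}

/-- After translating both curves to `1`, the quotient has velocity `u - u`. This gives uniqueness
of the curve driven by a given control, in `eq_mul_of_hasLeftVelocity`. -/
lemma hasDerivAt_zero_mul_inv {t : ℝ} {u : 𝔼} (h : HasLeftVelocity γ t u)
    (h' : HasLeftVelocity γ' t u) {f : G → F}
    (hf : MDifferentiableAt (𝓡 n) 𝓘(ℝ, F) f (γ t * (γ' t)⁻¹)) :
    HasDerivAt (fun s => f (γ s * (γ' s)⁻¹)) 0 t := by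
  have h1 := hasDerivAt_mul_inv (h.mul_left (γ t)⁻¹) (h'.mul_left (γ' t)⁻¹)
    (inv_mul_cancel _) (inv_mul_cancel _) (mdifferentiableAt_mul_mul hf)
  rw [sub_self, map_zero] at h1
  refine h1.congr_of_eventuallyEq (Eventually.of_forall fun s => ?_)
  group

lemma eq_mul_of_hasLeftVelocity (hγ : ∀ t ∈ Icc (0 : ℝ) 1, CurveACAt n γ t)
    (hγ' : ∀ t ∈ Icc (0 : ℝ) 1, CurveACAt n γ' t) {u : ℝ → 𝔼}
    (hu : ∀ᵐ t ∂(volume.restrict (Icc (0 : ℝ) 1)), HasLeftVelocity γ t (u t))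
    (hu' : ∀ᵐ t ∂(volume.restrict (Icc (0 : ℝ) 1)), HasLeftVelocity γ' t (u t))
    (h0 : γ 0 = γ' 0) {t : ℝ} (ht : t ∈ Icc (0 : ℝ) 1) : γ t = γ' t := by
  have h1 := CurveACAt.eq_of_ae_hasDerivAt_zero (γ := fun t => γ t * (γ' t)⁻¹)
    (fun t ht => (hγ t ht).mul ((hγ' t ht).inv ht) ht) (by
      filter_upwards [hu, hu'] with s hs hs' x₀ hx₀
      exact hasDerivAt_zero_mul_inv hs hs' (mdifferentiableAt_chart x₀ hx₀)) ht
  simp only [h0, mul_inv_cancel] at h1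
  exact mul_inv_eq_one.1 h1

lemma locallyACAt_add_integral {E : Type*} [NormedAddCommGroup E] [NormedSpace ℝ E] {v : ℝ → E}
    (hv : IntegrableOn v (Icc 0 1)) (a : E) (t₀ : ℝ) :
    LocallyACAt (fun t => a + ∫ s in (0 : ℝ)..t, v s) t₀ := by
  have h1 : IntervalIntegrable v volume 0 1 := by
    refine IntegrableOn.intervalIntegrable ?_
    rwa [uIcc_of_le zero_le_one]
  refine ⟨0, 1, Subset.rfl, self_mem_nhdsWithin,
    (absolutelyContinuousOnInterval_integral h1 left_mem_uIcc).of_dist_le 1 ?_⟩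
  intro s _ t _
  rw [dist_add_left, one_mul]

lemma ae_hasDerivAt_add_integral {E : Type*} [NormedAddCommGroup E] [NormedSpace ℝ E]
    [CompleteSpace E] {v : ℝ → E} (hv : IntegrableOn v (Icc 0 1)) (a : E) :
    ∀ᵐ t ∂(volume.restrict (Icc (0 : ℝ) 1)),
      HasDerivAt (fun t => a + ∫ s in (0 : ℝ)..t, v s) (v t) t := by
  have h1 : IntervalIntegrable v volume 0 1 := by
    refine IntegrableOn.intervalIntegrable ?_
    rwa [uIcc_of_le zero_le_one]
  rw [ae_restrict_iff' measurableSet_Icc]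
  filter_upwards [h1.ae_hasDerivAt_integral] with t ht htI
  rw [uIcc_of_le zero_le_one] at ht
  exact (ht htI 0 (by simp)).const_add a

/-- A curve issued from `exp a` whose control lies in a subalgebra stays in the exponential of
the subalgebra. -/
lemma mem_exp_image_of_control {K : ℕ} {D : ℕ → Submodule ℝ 𝔼}
    (h : IsNilpotentFiltration n G K D) {H : Submodule ℝ 𝔼}
    (hH : ∀ x ∈ H, ∀ y ∈ H, adCLM n G x y ∈ H) {a : 𝔼} (ha : a ∈ H)
    (hγ : ∀ t ∈ Icc (0 : ℝ) 1, CurveACAt n γ t) {u : ℝ → 𝔼} (hu : IntegrableOn u (Icc 0 1))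
    (huH : ∀ᵐ t ∂(volume.restrict (Icc (0 : ℝ) 1)), u t ∈ H)
    (huγ : ∀ᵐ t ∂(volume.restrict (Icc (0 : ℝ) 1)), HasLeftVelocity γ t (u t))
    (h0 : γ 0 = ex a) : γ 1 ∈ ex '' H := by
  -- The curve `x = a + ∫ v` stays in `H` and `exp x` has control `Φ(x) v = u`, so it coincides with
  -- `γ`.
  obtain ⟨v, hv, hx, hvu⟩ := exists_dexpSeries_eq h.ad_mem h.antitone adCLM_swap h.zero_eq_top
    h.eq_bot hH ha hu huH
  have h1 : (1 : ℝ) ∈ Icc (0 : ℝ) 1 := right_mem_Icc.2 zero_le_one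
  refine ⟨_, hx 1 h1, ?_⟩
  refine (eq_mul_of_hasLeftVelocity (γ' := fun t => ex (a + ∫ s in (0 : ℝ)..t, v s)) hγ
    (fun t ht => curveACAt_exp_comp h.pow_eq_zero ht (locallyACAt_add_integral hv a t)) huγ ?_ ?_
    h1).symm
  · filter_upwards [ae_hasDerivAt_add_integral hv a, hvu] with t ht hvut
    rw [← hvut]
    exact hasLeftVelocity_exp_comp (x := fun t => a + ∫ s in (0 : ℝ)..t, v s)
      (h.pow_eq_zero _) ht
  · rw [h0, intervalIntegral.integral_same, add_zero]

lemma curveACAt_exp_smul {K : ℕ} {D : ℕ → Submodule ℝ 𝔼}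
    (h : IsNilpotentFiltration n G K D) (v : 𝔼) {t : ℝ} (ht : t ∈ Icc (0 : ℝ) 1) :
    CurveACAt n (fun t : ℝ => ex (t • v)) t := by
  refine curveACAt_exp_comp h.pow_eq_zero ht ?_
  have h1 := locallyACAt_add_integral (v := fun _ => v) (integrable_const v) 0 t
  refine h1.congr ht (Eventually.of_forall fun s => ?_)
  simp

/-- The curve `exp a · exp(t b)` starts at `exp a` and has constant control `b`, so the previous
result replaces a product formula for exponentials. -/
lemma exp_mul_exp_mem {K : ℕ} {D : ℕ → Submodule ℝ 𝔼}
    (h : IsNilpotentFiltration n G K D) {H : Submodule ℝ 𝔼}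
    (hH : ∀ x ∈ H, ∀ y ∈ H, adCLM n G x y ∈ H) {a b : 𝔼} (ha : a ∈ H) (hb : b ∈ H) :
    ex a * ex b ∈ ex '' H := by
  have h1 := mem_exp_image_of_control (γ := fun t : ℝ => ex a * ex (t • b)) h hH ha
    (fun t ht => (CurveACAt.const _ t).mul (curveACAt_exp_smul h b ht) ht)
    (u := fun _ => b) (integrable_const b) (Eventually.of_forall fun _ => hb)
    (Eventually.of_forall fun t => (hasLeftVelocity_exp b t).mul_left _)
    (by rw [zero_smul, exp_zero, mul_one])
  rwa [one_smul] at h1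

/-- The exponential image of a subalgebra is a subgroup. -/
def expSubgroup {K : ℕ} {D : ℕ → Submodule ℝ (EuclideanSpace ℝ (Fin n))}
    (h : IsNilpotentFiltration n G K D) (H : Submodule ℝ (EuclideanSpace ℝ (Fin n)))
    (hH : ∀ x ∈ H, ∀ y ∈ H, adCLM n G x y ∈ H) : Subgroup G where
  carrier := lieExp n G '' H
  mul_mem' := by
    rintro _ _ ⟨a, ha, rfl⟩ ⟨b, hb, rfl⟩
    exact exp_mul_exp_mem h hH ha hb
  one_mem' := ⟨0, H.zero_mem, exp_zero⟩
  inv_mem' := by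
    rintro _ ⟨a, ha, rfl⟩
    exact ⟨-a, H.neg_mem ha, exp_neg a⟩

lemma IsHorizontalPath.mul_left {V : Submodule ℝ 𝔼}
    (h : IsHorizontalPath (leftInvariantDistribution (G := G) V) γ) (g : G) :
    IsHorizontalPath (leftInvariantDistribution (G := G) V) fun t => g * γ t := by
  obtain ⟨h1, u, hL, hu⟩ := isHorizontalPath_iff.1 h
  exact isHorizontalPath_iff.2 ⟨fun t ht => (CurveACAt.const g t).mul (h1 t ht) ht, u, hL,
    hu.mono fun t ht => ⟨ht.1, ht.2.mul_left g⟩⟩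

lemma isHorizontalPath_mul_exp {K : ℕ} {D : ℕ → Submodule ℝ 𝔼}
    (h : IsNilpotentFiltration n G K D) {V : Submodule ℝ 𝔼} {v : 𝔼} (hv : v ∈ V) (g : G) :
    IsHorizontalPath (leftInvariantDistribution (G := G) V) fun t : ℝ => g * ex (t • v) :=
  isHorizontalPath_iff.2 ⟨fun t ht => (CurveACAt.const g t).mul (curveACAt_exp_smul h v ht) ht,
    fun _ => v, memLp_const v, Eventually.of_forall fun t =>
      ⟨hv, (hasLeftVelocity_exp v t).mul_left g⟩⟩

end ControlledCurves
end

/-! ### The cotangent bundle and its symplectic form in the left trivialization. -/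

noncomputable section

section Covectors

variable {n : ℕ} {G : Type*} [TopologicalSpace G] [ChartedSpace (EuclideanSpace ℝ (Fin n)) G]
  [Group G] {F : Type*} [NormedAddCommGroup F] [NormedSpace ℝ F]

local notation "𝔼" => EuclideanSpace ℝ (Fin n)
local notation "φ₁" => extChartAt (𝓡 n) (1 : G)
local notation "ex" => lieExp n G

variable [LieGroup (𝓡 n) ∞ G]

lemma leftTrans_isInvertible (x : G) : (leftTrans n x).IsInvertible := by
  rw [leftTrans_eq_leftDeriv]
  exact leftDeriv_chart_isInvertible (mem_extChartAt_source x)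

/-- A covector of `G` in the left trivialization of the cotangent bundle. -/
def leftCovector {n : ℕ} {G : Type*} [TopologicalSpace G]
    [ChartedSpace (EuclideanSpace ℝ (Fin n)) G] [Group G] (a : CotangentPoint n G) :
    EuclideanSpace ℝ (Fin n) →L[ℝ] ℝ :=
  ContinuousLinearMap.comp (a.2 : EuclideanSpace ℝ (Fin n) →L[ℝ] ℝ) (leftTrans n a.1)

/-- The point of the cotangent bundle of `G` with given left trivialization. -/
def ofLeftCovector {n : ℕ} {G : Type*} [TopologicalSpace G]
    [ChartedSpace (EuclideanSpace ℝ (Fin n)) G] [Group G] (x : G)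
    (l : EuclideanSpace ℝ (Fin n) →L[ℝ] ℝ) : CotangentPoint n G :=
  ⟨x, (l.comp (leftTrans n x).inverse : EuclideanSpace ℝ (Fin n) →L[ℝ] ℝ)⟩

lemma leftCovector_ofLeftCovector (x : G) (l : 𝔼 →L[ℝ] ℝ) :
    leftCovector (ofLeftCovector x l) = l := by
  have h1 := (leftTrans_isInvertible (n := n) x).inverse_comp_self
  change (l.comp (leftTrans n x).inverse).comp (leftTrans n x) = l
  rw [ContinuousLinearMap.comp_assoc, h1, ContinuousLinearMap.comp_id]

lemma ofLeftCovector_leftCovector (a : CotangentPoint n G) :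
    ofLeftCovector a.1 (leftCovector a) = a := by
  obtain ⟨x, p⟩ := a
  have h1 := (leftTrans_isInvertible (n := n) x).self_comp_inverse
  have aux : ∀ q : 𝔼 →L[ℝ] ℝ, (q.comp (leftTrans n x)).comp (leftTrans n x).inverse = q := by
    intro q
    rw [ContinuousLinearMap.comp_assoc, h1, ContinuousLinearMap.comp_id]
  exact congrArg (Sigma.mk x) (aux p)

lemma mem_nonzeroAnnihilator_iff {V : Submodule ℝ 𝔼} {a : CotangentPoint n G} :
    a ∈ nonzeroAnnihilator (leftInvariantDistribution (G := G) V) ↔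
      leftCovector a ≠ 0 ∧ ∀ w ∈ V, leftCovector a w = 0 := by
  have h0 : leftCovector a = 0 ↔ a.2 = 0 := by
    constructor
    · intro h
      have h1 := congrArg (fun l => (ofLeftCovector a.1 l : CotangentPoint n G)) h
      simp only [ofLeftCovector_leftCovector] at h1
      rw [h1]
      exact ContinuousLinearMap.zero_comp _
    · intro h
      unfold leftCovector
      rw [h]
      exact ContinuousLinearMap.zero_comp _
  refine and_congr (not_congr h0).symm ⟨fun h w hw => h _ ⟨w, hw, rfl⟩, ?_⟩
  rintro h _ ⟨w, hw, rfl⟩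
  exact h w hw

lemma cotangentCoord_snd_comp {x₀ : G} {a : CotangentPoint n G}
    (hx : a.1 ∈ (extChartAt (𝓡 n) x₀).source) :
    (cotangentCoord x₀ a).2.comp (leftDeriv n (extChartAt (𝓡 n) x₀) a.1) = leftCovector a := by
  rw [← mfderiv_comp_leftTrans (mdifferentiableAt_chart x₀ hx)]
  have h1 : (mfderiv (𝓡 n) 𝓘(ℝ, 𝔼) (extChartAt (𝓡 n) x₀) a.1).IsInvertible :=
    isInvertible_mfderiv_extChartAt hx
  have h2 := h1.inverse_comp_self
  have aux : ∀ (M T L : 𝔼 →L[ℝ] 𝔼) (p : 𝔼 →L[ℝ] ℝ),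
      M.comp T = ContinuousLinearMap.id ℝ 𝔼 → (p.comp M).comp (T.comp L) = p.comp L := by
    intro M T L p h
    rw [ContinuousLinearMap.comp_assoc, ← ContinuousLinearMap.comp_assoc M, h,
      ContinuousLinearMap.id_comp]
  exact aux _ _ _ _ h2

lemma cotangentCoord_snd_eq {x₀ : G} {a : CotangentPoint n G}
    (hx : a.1 ∈ (extChartAt (𝓡 n) x₀).source) :
    (cotangentCoord x₀ a).2 =
      (leftCovector a).comp (leftDeriv n (extChartAt (𝓡 n) x₀) a.1).inverse := by
  rw [← cotangentCoord_snd_comp hx, ContinuousLinearMap.comp_assoc,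
    (leftDeriv_chart_isInvertible hx).self_comp_inverse, ContinuousLinearMap.comp_id]

lemma continuousAt_of_chart {γ : ℝ → G} {t : ℝ} {x₀ : G}
    (hs : ∀ᶠ s in 𝓝 t, γ s ∈ (extChartAt (𝓡 n) x₀).source)
    (hc : ContinuousAt (fun s => extChartAt (𝓡 n) x₀ (γ s)) t) : ContinuousAt γ t := by
  have h1 := (contMDiffAt_chart_symm x₀
    ((extChartAt (𝓡 n) x₀).map_source hs.self_of_nhds)).continuousAt
  have h2 := h1.tendsto.comp hc
  rw [(extChartAt (𝓡 n) x₀).left_inv hs.self_of_nhds] at h2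
  refine h2.congr' ?_
  filter_upwards [hs] with s hs
  exact (extChartAt (𝓡 n) x₀).left_inv hs

/-- Derivative of the left trivialization of a curve in the cotangent bundle. -/
lemma hasDerivAt_leftCovector {c : ℝ → CotangentPoint n G} {t : ℝ} {x₀ : G}
    {ζ : CotangentModel n} (hs : ∀ᶠ s in 𝓝 t, (c s).1 ∈ (extChartAt (𝓡 n) x₀).source)
    (hd : HasDerivAt (fun s => cotangentCoord x₀ (c s)) ζ t) :
    ∃ z : 𝔼, leftDeriv n (extChartAt (𝓡 n) x₀) (c t).1 z = ζ.1 ∧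
      HasLeftVelocity (fun s => (c s).1) t z ∧
      HasDerivAt (fun s => leftCovector (c s))
        (ζ.2.comp (leftDeriv n (extChartAt (𝓡 n) x₀) (c t).1) + (cotangentCoord x₀ (c t)).2.comp
          (leftDeriv n (leftDeriv n (extChartAt (𝓡 n) x₀)) (c t).1 z)) t := by
  have hst := hs.self_of_nhds
  have hd1 : HasDerivAt (fun s => extChartAt (𝓡 n) x₀ (c s).1) ζ.1 t := hd.fst
  have hd2 : HasDerivAt (fun s => (cotangentCoord x₀ (c s)).2) ζ.2 t := hd.snd
  have hc := continuousAt_of_chart hs hd1.continuousAt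
  have hz := (leftDeriv_chart_isInvertible hst).self_apply_inverse ζ.1
  set z := (leftDeriv n (extChartAt (𝓡 n) x₀) (c t).1).inverse ζ.1
  have hv : HasLeftVelocity (fun s => (c s).1) t z :=
    HasLeftVelocity.of_chart (c := fun s => (c s).1) hc hst (by rw [hz]; exact hd1)
  refine ⟨z, hz, hv, ?_⟩
  have h1 := hv.hasDerivAt (mdifferentiableAt_of_smooth
    (contMDiffAt_leftDeriv (contMDiffAt_chart x₀ hst)))
  refine (hd2.clm_comp h1).congr_of_eventuallyEq ?_
  filter_upwards [hs] with s hs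
  exact (cotangentCoord_snd_comp hs).symm

/-- The velocity of a curve of the cotangent bundle given in the left trivialization. -/
lemma exists_hasDerivAt_cotangentCoord {γ : ℝ → G} {l : ℝ → 𝔼 →L[ℝ] ℝ} {t : ℝ} {x₀ : G}
    (hx : γ t ∈ (extChartAt (𝓡 n) x₀).source) {z : 𝔼} (hγ : HasLeftVelocity γ t z)
    {ν : 𝔼 →L[ℝ] ℝ} (hl : HasDerivAt l ν t) :
    ∃ ζ : CotangentModel n,
      HasDerivAt (fun s => cotangentCoord x₀ (ofLeftCovector (γ s) (l s))) ζ t ∧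
      leftDeriv n (extChartAt (𝓡 n) x₀) (γ t) z = ζ.1 ∧
      ζ.2.comp (leftDeriv n (extChartAt (𝓡 n) x₀) (γ t)) +
        (cotangentCoord x₀ (ofLeftCovector (γ t) (l t))).2.comp
          (leftDeriv n (leftDeriv n (extChartAt (𝓡 n) x₀)) (γ t) z) = ν := by
  have hs : ∀ᶠ s in 𝓝 t, γ s ∈ (extChartAt (𝓡 n) x₀).source :=
    hγ.1 (extChartAt_source_mem_nhds' hx)
  have h1 := hγ.hasDerivAt (mdifferentiableAt_of_smooth
    (contMDiffAt_leftDeriv (contMDiffAt_chart x₀ hx)))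
  have h2 := (((leftDeriv_chart_isInvertible hx).contDiffAt_map_inverse (n := 1)).differentiableAt
    one_ne_zero).hasFDerivAt.comp_hasDerivAt t h1
  have h3 := (hγ.hasDerivAt (mdifferentiableAt_chart x₀ hx)).prodMk (hl.clm_comp h2)
  have he : (fun s => cotangentCoord x₀ (ofLeftCovector (γ s) (l s))) =ᶠ[𝓝 t] fun s =>
      (extChartAt (𝓡 n) x₀ (γ s),
        (l s).comp (leftDeriv n (extChartAt (𝓡 n) x₀) (γ s)).inverse) := by
    filter_upwards [hs] with s hs
    refine Prod.ext rfl ?_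
    rw [cotangentCoord_snd_eq (a := ofLeftCovector (γ s) (l s)) hs, leftCovector_ofLeftCovector]
    rfl
  have h4 := h3.congr_of_eventuallyEq he
  -- The relation for `ν` comes from reading the coordinate velocity back with
  -- `hasDerivAt_leftCovector` and from uniqueness of derivatives; the derivative of the operator
  -- inverse is never computed.
  obtain ⟨z', hz', hv', hd'⟩ :=
    hasDerivAt_leftCovector (c := fun s => ofLeftCovector (γ s) (l s)) hs h4
  refine ⟨_, h4, rfl, ?_⟩
  have hzz : z' = z := hv'.2.unique hγ.2
  rw [hzz] at hd'
  simp only [leftCovector_ofLeftCovector] at hd'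
  exact hd'.unique hl

/-- The symplectic form in the left trivialization. -/
lemma symplecticForm_eq {a : CotangentPoint n G} {ζ ζ' : CotangentModel n} {z z' : 𝔼}
    {ν ν' : 𝔼 →L[ℝ] ℝ}
    (hz : leftDeriv n (extChartAt (𝓡 n) a.1) a.1 z = ζ.1)
    (hν : ζ.2.comp (leftDeriv n (extChartAt (𝓡 n) a.1) a.1) + (cotangentCoord a.1 a).2.comp
      (leftDeriv n (leftDeriv n (extChartAt (𝓡 n) a.1)) a.1 z) = ν)
    (hz' : leftDeriv n (extChartAt (𝓡 n) a.1) a.1 z' = ζ'.1)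
    (hν' : ζ'.2.comp (leftDeriv n (extChartAt (𝓡 n) a.1) a.1) + (cotangentCoord a.1 a).2.comp
      (leftDeriv n (leftDeriv n (extChartAt (𝓡 n) a.1)) a.1 z') = ν') :
    symplecticForm ζ ζ' = ν' z - ν z' + leftCovector a (adCLM n G z z') := by
  have hx := mem_extChartAt_source (I := 𝓡 n) a.1
  rw [← hν, ← hν', ← cotangentCoord_snd_comp hx, symplecticForm, ← hz, ← hz']
  -- The second left derivative of the chart is not symmetric. Its antisymmetric part is the image
  -- of `[z, z']`, which the covector turns into `l [z, z']`.
  have h1 := leftDeriv_leftDeriv_sub (contMDiffAt_chart a.1 hx) z z'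
  simp only [add_apply, ContinuousLinearMap.comp_apply]
  rw [← h1, map_sub]
  ring

/-- Tangent vectors are defined by curves that lie in `Δ^⊥` at all times. Since a derivative is
local, the curve may be replaced by the constant `a` wherever it leaves `Δ^⊥` or the chart. -/
lemma mem_annihilatorTangent_of_eventually {Δ : ∀ x : G, Submodule ℝ (TangentSpace (𝓡 n) x)}
    {c : ℝ → CotangentPoint n G} {t : ℝ} {a : CotangentPoint n G} (hca : c t = a)
    (hc : ∀ᶠ s in 𝓝 t, c s ∈ nonzeroAnnihilator Δ ∧ (c s).1 ∈ (extChartAt (𝓡 n) a.1).source)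
    {ζ : CotangentModel n} (hd : HasDerivAt (fun s => cotangentCoord a.1 (c s)) ζ t) :
    ζ ∈ annihilatorTangent Δ a := by
  classical
  have ht := hc.self_of_nhds
  rw [hca] at ht
  refine ⟨fun s => if c (t + s) ∈ nonzeroAnnihilator Δ ∧
    (c (t + s)).1 ∈ (extChartAt (𝓡 n) a.1).source then c (t + s) else a, ?_, ?_, ?_⟩
  · simp [hca]
  · intro s
    dsimp only
    split_ifs with h
    · exact h
    · exact ht
  · have h1 : HasDerivAt (fun s => cotangentCoord a.1 (c (t + s))) ζ 0 :=
      HasDerivAt.comp_const_add t 0 (by rwa [add_zero])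
    refine h1.congr_of_eventuallyEq ?_
    have h2 : Tendsto (fun s : ℝ => t + s) (𝓝 0) (𝓝 t) := by
      have := (continuous_const_add t).tendsto 0
      rwa [add_zero] at this
    filter_upwards [h2.eventually hc] with s hs
    rw [if_pos hs]

/-- The left-invariant vector fields lift to `Δ^⊥`. -/
lemma exists_mem_annihilatorTangent {V : Submodule ℝ 𝔼} {a : CotangentPoint n G}
    (ha : a ∈ nonzeroAnnihilator (leftInvariantDistribution (G := G) V)) (z : 𝔼) :
    ∃ ζ ∈ annihilatorTangent (leftInvariantDistribution (G := G) V) a,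
      leftDeriv n (extChartAt (𝓡 n) a.1) a.1 z = ζ.1 ∧
      ζ.2.comp (leftDeriv n (extChartAt (𝓡 n) a.1) a.1) + (cotangentCoord a.1 a).2.comp
        (leftDeriv n (leftDeriv n (extChartAt (𝓡 n) a.1)) a.1 z) = 0 := by
  have hv := (hasLeftVelocity_exp (G := G) z 0).mul_left a.1
  have h0 : a.1 * ex ((0 : ℝ) • z) = a.1 := by rw [zero_smul, exp_zero, mul_one]
  obtain ⟨ζ, hd, hz, hν⟩ := exists_hasDerivAt_cotangentCoord (x₀ := a.1)
    (γ := fun s : ℝ => a.1 * ex (s • z)) (l := fun _ => leftCovector a) (t := 0)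
    (by simp only [h0]; exact mem_extChartAt_source _) hv (hasDerivAt_const _ _)
  simp only [h0, ofLeftCovector_leftCovector] at hz hν
  refine ⟨ζ, mem_annihilatorTangent_of_eventually
    (c := fun s => ofLeftCovector (a.1 * ex (s • z)) (leftCovector a)) (t := 0) ?_ ?_ hd, hz, hν⟩
  · simp only [h0, ofLeftCovector_leftCovector]
  · have h1 : ContinuousAt (fun s : ℝ => a.1 * ex (s • z)) 0 := hv.1
    have h2 : (extChartAt (𝓡 n) a.1).source ∈ 𝓝 (a.1 * ex ((0 : ℝ) • z)) := by
      rw [h0]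
      exact extChartAt_source_mem_nhds a.1
    filter_upwards [h1 h2] with s hs
    refine ⟨?_, hs⟩
    rw [mem_nonzeroAnnihilator_iff] at ha ⊢
    rwa [leftCovector_ofLeftCovector]

lemma exists_of_mem_annihilatorTangent {V : Submodule ℝ 𝔼} {a : CotangentPoint n G}
    {ζ : CotangentModel n}
    (hζ : ζ ∈ annihilatorTangent (leftInvariantDistribution (G := G) V) a) :
    ∃ z : 𝔼, ∃ ν : 𝔼 →L[ℝ] ℝ, (∀ w ∈ V, ν w = 0) ∧
      leftDeriv n (extChartAt (𝓡 n) a.1) a.1 z = ζ.1 ∧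
      ζ.2.comp (leftDeriv n (extChartAt (𝓡 n) a.1) a.1) + (cotangentCoord a.1 a).2.comp
        (leftDeriv n (leftDeriv n (extChartAt (𝓡 n) a.1)) a.1 z) = ν := by
  obtain ⟨c, rfl, hc, hd⟩ := hζ
  obtain ⟨z, hz, -, hl⟩ :=
    hasDerivAt_leftCovector (Eventually.of_forall fun s => (hc s).2) hd
  refine ⟨z, _, fun w hw => ?_, hz, rfl⟩
  have h1 := hl.clm_apply (hasDerivAt_const (0 : ℝ) w)
  simp only [map_zero, add_zero] at h1
  refine h1.unique ?_
  have h2 : (fun s => leftCovector (c s) w) = fun _ => 0 :=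
    funext fun s => (mem_nonzeroAnnihilator_iff.1 (hc s).1).2 w hw
  rw [h2]
  exact hasDerivAt_const _ _

end Covectors
end

/-! ### Abnormal lifts are the covectors constant in the right trivialization. -/

noncomputable section

section AbnormalLifts

variable {n : ℕ} {G : Type*} [TopologicalSpace G] [ChartedSpace (EuclideanSpace ℝ (Fin n)) G]
  [Group G] {F : Type*} [NormedAddCommGroup F] [NormedSpace ℝ F]

local notation "𝔼" => EuclideanSpace ℝ (Fin n)
local notation "φ₁" => extChartAt (𝓡 n) (1 : G)
local notation "ex" => lieExp n G

variable [LieGroup (𝓡 n) ∞ G]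

variable {γ : ℝ → G}

lemma contMDiffAt_adjointRep_inv (x : G) :
    ContMDiffAt (𝓡 n) 𝓘(ℝ, 𝔼 →L[ℝ] 𝔼) ∞ (fun y : G => adjointRep n y⁻¹) x :=
  ContMDiffAt.comp (I' := 𝓡 n) x (g := adjointRep n) (f := fun y : G => y⁻¹)
    (contMDiffAt_adjointRep x⁻¹) contMDiffAt_id.inv

lemma HasLeftVelocity.hasDerivAt_adjointRep_inv {t : ℝ} {u : 𝔼} (h : HasLeftVelocity γ t u) :
    HasDerivAt (fun s => adjointRep n (γ s)⁻¹)
      (-(adCLM n G u).comp (adjointRep n (γ t)⁻¹)) t := by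
  have h1 := h.hasDerivAt (mdifferentiableAt_of_smooth (contMDiffAt_adjointRep_inv (γ t)))
  have h2 := h1.clm_comp h.hasDerivAt_adjointRep
  simp only [adjointRep_inv_comp] at h2
  have h3 := h2.unique (hasDerivAt_const t _)
  refine h1.congr_deriv ?_
  have aux : ∀ A A' B' C : 𝔼 →L[ℝ] 𝔼, A'.comp A = ContinuousLinearMap.id ℝ 𝔼 →
      A.comp A' = ContinuousLinearMap.id ℝ 𝔼 → B'.comp A + A'.comp (A.comp C) = 0 →
      B' = -C.comp A' := by
    intro A A' B' C h h' h0
    rw [← ContinuousLinearMap.comp_assoc, h, ContinuousLinearMap.id_comp] at h0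
    have h4 := congrArg (fun T : 𝔼 →L[ℝ] 𝔼 => T.comp A') h0
    simp only [ContinuousLinearMap.add_comp, ContinuousLinearMap.zero_comp] at h4
    rw [ContinuousLinearMap.comp_assoc, h', ContinuousLinearMap.comp_id] at h4
    exact eq_neg_of_add_eq_zero_left h4
  exact aux _ _ _ _ (adjointRep_inv_comp (γ t)) (adjointRep_comp_inv (γ t)) h3

lemma locallyACAt_leftCovector {c : ℝ → CotangentPoint n G} (hc : IsACCotangent c) {t₀ : ℝ}
    (ht₀ : t₀ ∈ Icc (0 : ℝ) 1) : LocallyACAt (fun t => leftCovector (c t)) t₀ := by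
  obtain ⟨a, b, hab, hn, hs, hac⟩ := hc t₀ ht₀
  have h1 : LocallyACAt (fun t => cotangentCoord (c t₀).1 (c t)) t₀ := ⟨a, b, hab, hn, hac⟩
  have hx := mem_extChartAt_source (I := 𝓡 n) (c t₀).1
  have h2 := chart_comp_contDiffAt hx le_rfl
    (contMDiffAt_leftDeriv (contMDiffAt_chart (c t₀).1 hx))
  have h3 : ContDiffAt ℝ ∞ (fun ζ : CotangentModel n => ζ.2.comp
      ((leftDeriv n (extChartAt (𝓡 n) (c t₀).1) ∘ (extChartAt (𝓡 n) (c t₀).1).symm) ζ.1))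
      (cotangentCoord (c t₀).1 (c t₀)) :=
    contDiffAt_snd.clm_comp (ContDiffAt.comp (cotangentCoord (c t₀).1 (c t₀))
      (g := leftDeriv n (extChartAt (𝓡 n) (c t₀).1) ∘ (extChartAt (𝓡 n) (c t₀).1).symm)
      (f := fun ζ : CotangentModel n => ζ.1) h2 contDiffAt_fst)
  refine (h1.comp_contDiffAt ht₀ h3).congr ht₀ ?_
  filter_upwards [hn] with t ht
  simp only [Function.comp_apply]
  rw [show (cotangentCoord (c t₀).1 (c t)).1 = extChartAt (𝓡 n) (c t₀).1 (c t).1 from rfl,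
    (extChartAt (𝓡 n) (c t₀).1).left_inv (hs t ht), cotangentCoord_snd_comp (hs t ht)]

/-- Abnormal lifts are parallel in the right trivialization. -/
lemma exists_eq_comp_adjointRep_of_isAbnormalLift {V : Submodule ℝ 𝔼}
    (hγ : IsHorizontalPath (leftInvariantDistribution (G := G) V) γ)
    {p : ∀ t : ℝ, TangentSpace (𝓡 n) (γ t) →L[ℝ] ℝ}
    (hp : IsAbnormalLift (leftInvariantDistribution (G := G) V) γ p) :
    ∃ μ : 𝔼 →L[ℝ] ℝ, μ ≠ 0 ∧ ∀ t ∈ Icc (0 : ℝ) 1,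
      leftCovector (⟨γ t, p t⟩ : CotangentPoint n G) = μ.comp (adjointRep n (γ t)) := by
  obtain ⟨hac, u, -, hu⟩ := isHorizontalPath_iff.1 hγ
  obtain ⟨hann, hpac, hker⟩ := hp
  set l : ℝ → 𝔼 →L[ℝ] ℝ := fun t => leftCovector (⟨γ t, p t⟩ : CotangentPoint n G) with hl
  have hlac : ∀ t₀ ∈ Icc (0 : ℝ) 1,
      LocallyACAt (fun t => (l t).comp (adjointRep n (γ t)⁻¹)) t₀ := by
    intro t₀ ht₀
    have h1 : LocallyACAt l t₀ := locallyACAt_leftCovector hpac ht₀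
    have h2 := (hac t₀ ht₀).comp_smooth ht₀ (contMDiffAt_adjointRep_inv (γ t₀))
    have h3 : ContDiff ℝ ∞ fun q : (𝔼 →L[ℝ] ℝ) × (𝔼 →L[ℝ] 𝔼) => q.1.comp q.2 :=
      contDiff_fst.clm_comp contDiff_snd
    exact LocallyACAt.comp_contDiffAt (f := fun q : (𝔼 →L[ℝ] ℝ) × (𝔼 →L[ℝ] 𝔼) => q.1.comp q.2)
      (LocallyACAt.prodMk h1 h2 ht₀) ht₀ h3.contDiffAt
  have hderiv : ∀ᵐ t ∂(volume.restrict (Icc (0 : ℝ) 1)),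
      HasDerivAt (fun t => (l t).comp (adjointRep n (γ t)⁻¹)) 0 t := by
    filter_upwards [hu, hker, self_mem_ae_restrict measurableSet_Icc] with t ht hkt htI
    obtain ⟨ζ, ⟨-, hζ⟩, hd⟩ := hkt
    obtain ⟨z, hz, hv, hd'⟩ := hasDerivAt_leftCovector
      (c := fun s => (⟨γ s, p s⟩ : CotangentPoint n G)) (x₀ := γ t)
      (ht.2.1 (extChartAt_source_mem_nhds (γ t))) hd
    have hzu : z = u t := hv.2.unique ht.2.2
    have hν := hd'.clm_comp ht.2.hasDerivAt_adjointRep_inv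
    refine hν.congr_deriv ?_
    -- Pairing with the lift `(z', 0)` of a left-invariant field, the kernel condition reads `-ν z'
    -- + l [u, z'] = 0`, that is `l' = l ∘ ad u`. This cancels the derivative of `Ad(γ⁻¹)`.
    have key : ∀ z' : 𝔼, (ζ.2.comp (leftDeriv n (extChartAt (𝓡 n) (γ t)) (γ t)) +
        (cotangentCoord (γ t) (⟨γ t, p t⟩ : CotangentPoint n G)).2.comp
          (leftDeriv n (leftDeriv n (extChartAt (𝓡 n) (γ t))) (γ t) z)) z' =
        l t (adCLM n G (u t) z') := by
      intro z'
      obtain ⟨ζ', hζ', hz', hν'⟩ := exists_mem_annihilatorTangent (hann t htI) z'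
      have h1 := symplecticForm_eq (a := (⟨γ t, p t⟩ : CotangentPoint n G)) hz rfl hz' hν'
      rw [hζ ζ' hζ', zero_apply, hzu] at h1
      rw [hzu]
      linarith
    ext z'
    simp only [add_apply, ContinuousLinearMap.comp_apply, neg_apply, map_neg]
    have := key (adjointRep n (γ t)⁻¹ z')
    simp only [add_apply, ContinuousLinearMap.comp_apply] at this
    rw [this]
    exact add_neg_cancel _
  have hconst : ∀ t ∈ Icc (0 : ℝ) 1, (l t).comp (adjointRep n (γ t)⁻¹) =
      (l 0).comp (adjointRep n (γ 0)⁻¹) := fun t ht =>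
    eq_of_locallyACAt_of_ae_hasDerivAt_zero hlac hderiv ht
  have hback : ∀ (q : 𝔼 →L[ℝ] ℝ) (x : G),
      (q.comp (adjointRep n x⁻¹)).comp (adjointRep n x) = q := by
    intro q x
    rw [ContinuousLinearMap.comp_assoc, adjointRep_inv_comp, ContinuousLinearMap.comp_id]
  refine ⟨(l 0).comp (adjointRep n (γ 0)⁻¹), fun h0 => ?_, fun t ht => ?_⟩
  · refine (mem_nonzeroAnnihilator_iff.1 (hann 0 (by simp))).1 ?_
    have := hback (l 0) (γ 0)
    rw [h0, ContinuousLinearMap.zero_comp] at this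
    exact this.symm
  · rw [← hconst t ht, hback]

/-- Endpoints are discarded because velocities are two-sided while the paths are constrained only on
`[0,1]`. -/
lemma ae_mem_Ioo : ∀ᵐ t ∂(volume.restrict (Icc (0 : ℝ) 1)), t ∈ Ioo (0 : ℝ) 1 := by
  rw [← Measure.restrict_congr_set (Ioo_ae_eq_Icc (a := (0 : ℝ)) (b := 1))]
  exact self_mem_ae_restrict measurableSet_Ioo

/-- The candidate lift is the restriction to `γ` of the smooth section `y ↦ μ ∘ Ad y`, hence
inherits the absolute continuity of `γ`. -/
lemma contMDiffAt_cotangentCoord_comp_adjointRep (x : G) (μ : 𝔼 →L[ℝ] ℝ) :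
    ContMDiffAt (𝓡 n) 𝓘(ℝ, CotangentModel n) ∞
      (fun y => (extChartAt (𝓡 n) x y, (μ.comp (adjointRep n y)).comp
        (leftDeriv n (extChartAt (𝓡 n) x) y).inverse)) x := by
  have hx := mem_extChartAt_source (I := 𝓡 n) x
  have h1 : ContMDiffAt (𝓡 n) 𝓘(ℝ, 𝔼 →L[ℝ] 𝔼) ∞
      (fun y => (leftDeriv n (extChartAt (𝓡 n) x) y).inverse) x :=
    ContMDiffAt.comp (I' := 𝓘(ℝ, 𝔼 →L[ℝ] 𝔼)) x
      (g := (ContinuousLinearMap.inverse : (𝔼 →L[ℝ] 𝔼) → 𝔼 →L[ℝ] 𝔼))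
      (f := leftDeriv n (extChartAt (𝓡 n) x))
      (leftDeriv_chart_isInvertible hx).contDiffAt_map_inverse.contMDiffAt
      (contMDiffAt_leftDeriv (contMDiffAt_chart x hx))
  have h2 : ContMDiffAt (𝓡 n) 𝓘(ℝ, 𝔼 →L[ℝ] ℝ) ∞ (fun y => μ.comp (adjointRep n y)) x :=
    contMDiffAt_const.clm_comp (contMDiffAt_adjointRep x)
  exact (contMDiffAt_chart x hx).prodMk_space (h2.clm_comp h1)

/-- Covectors annihilating all `Ad(γ t) V` give abnormal lifts. -/
lemma isAbnormalLift_of_comp_adjointRep {V : Submodule ℝ 𝔼}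
    (hγ : IsHorizontalPath (leftInvariantDistribution (G := G) V) γ) {μ : 𝔼 →L[ℝ] ℝ}
    (hμ : μ ≠ 0) (h : ∀ t ∈ Icc (0 : ℝ) 1, ∀ w ∈ V, μ (adjointRep n (γ t) w) = 0) :
    IsAbnormalLift (leftInvariantDistribution (G := G) V) γ
      fun t => (ofLeftCovector (γ t) (μ.comp (adjointRep n (γ t)))).2 := by
  obtain ⟨hac, u, -, hu⟩ := isHorizontalPath_iff.1 hγ
  set c : ℝ → CotangentPoint n G := fun t => ofLeftCovector (γ t) (μ.comp (adjointRep n (γ t)))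
    with hc
  have hann : ∀ t ∈ Icc (0 : ℝ) 1,
      c t ∈ nonzeroAnnihilator (leftInvariantDistribution (G := G) V) := by
    intro t ht
    rw [mem_nonzeroAnnihilator_iff, hc]
    simp only [leftCovector_ofLeftCovector]
    refine ⟨fun h0 => hμ ?_, h t ht⟩
    have h1 := congrArg (fun q : 𝔼 →L[ℝ] ℝ => q.comp (adjointRep n (γ t)⁻¹)) h0
    simpa only [ContinuousLinearMap.comp_assoc, adjointRep_comp_inv, ContinuousLinearMap.comp_id,
      ContinuousLinearMap.zero_comp] using h1
  refine ⟨hann, fun t₀ ht₀ => ?_, ?_⟩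
  · have hs := (hac t₀ ht₀).eventually_mem_source (mem_extChartAt_source (γ t₀))
    have h1 := (hac t₀ ht₀).comp_smooth ht₀
      (contMDiffAt_cotangentCoord_comp_adjointRep (γ t₀) μ)
    have h2 : LocallyACAt (fun t => cotangentCoord (γ t₀) (c t)) t₀ := by
      refine h1.congr ht₀ ?_
      filter_upwards [hs] with t ht
      refine Prod.ext rfl ?_
      rw [cotangentCoord_snd_eq (a := c t) ht, hc]
      simp only [leftCovector_ofLeftCovector]
      rfl
    obtain ⟨a, b, -, hab, hn, hsub, hac'⟩ := h2.shrink ht₀ hs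
    exact ⟨a, b, hab, hn, hsub, hac'⟩
  · filter_upwards [hu, ae_mem_Ioo] with t ht htI
    have hl : HasDerivAt (fun s => μ.comp (adjointRep n (γ s)))
        (μ.comp ((adjointRep n (γ t)).comp (adCLM n G (u t)))) t := by
      refine ((hasDerivAt_const t μ).clm_comp ht.2.hasDerivAt_adjointRep).congr_deriv ?_
      rw [ContinuousLinearMap.zero_comp, zero_add]
    obtain ⟨ζ, hd, hz, hν⟩ := exists_hasDerivAt_cotangentCoord (x₀ := γ t)
      (mem_extChartAt_source (I := 𝓡 n) (γ t)) ht.2 hl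
    refine ⟨ζ, ⟨?_, fun ζ' hζ' => ?_⟩, hd⟩
    · refine mem_annihilatorTangent_of_eventually (c := c) (t := t) rfl ?_ hd
      filter_upwards [Ioo_mem_nhds htI.1 htI.2,
        ht.2.1 (extChartAt_source_mem_nhds (I := 𝓡 n) (γ t))] with s hs hs'
      exact ⟨hann s (Ioo_subset_Icc_self hs), hs'⟩
    -- Here `ω = ν' u - l [u, z'] + l [u, z']`, and `ν' u = 0` because `u ∈ V`.
    · obtain ⟨z', ν', hν'V, hz', hν'⟩ := exists_of_mem_annihilatorTangent hζ'
      have h1 := symplecticForm_eq (a := c t) hz hν hz' hν'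
      refine h1.trans ?_
      rw [hν'V _ ht.1, hc]
      simp only [leftCovector_ofLeftCovector, ContinuousLinearMap.comp_apply]
      ring

end AbnormalLifts
end

/-! ### The corank of a horizontal path. -/

noncomputable section

section Corank

variable {n : ℕ} {G : Type*} [TopologicalSpace G] [ChartedSpace (EuclideanSpace ℝ (Fin n)) G]
  [Group G] {F : Type*} [NormedAddCommGroup F] [NormedSpace ℝ F]

local notation "𝔼" => EuclideanSpace ℝ (Fin n)
local notation "φ₁" => extChartAt (𝓡 n) (1 : G)
local notation "ex" => lieExp n G

variable [LieGroup (𝓡 n) ∞ G]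

/-- The continuous linear forms vanishing on a subspace. -/
def continuousAnnihilator {E : Type*} [NormedAddCommGroup E] [NormedSpace ℝ E]
    (U : Submodule ℝ E) : Submodule ℝ (E →L[ℝ] ℝ) where
  carrier := {μ | ∀ u ∈ U, μ u = 0}
  add_mem' := by
    intro μ ν hμ hν u hu
    rw [add_apply, hμ u hu, hν u hu, add_zero]
  zero_mem' := fun _ _ => rfl
  smul_mem' := by
    intro c μ hμ u hu
    rw [smul_apply, hμ u hu, smul_zero]

lemma finrank_add_finrank_continuousAnnihilator {E : Type*} [NormedAddCommGroup E]
    [NormedSpace ℝ E] [FiniteDimensional ℝ E] (U : Submodule ℝ E) :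
    Module.finrank ℝ U + Module.finrank ℝ (continuousAnnihilator U) = Module.finrank ℝ E := by
  rw [← Subspace.finrank_add_finrank_dualAnnihilator_eq U]
  congr 1
  have h : continuousAnnihilator U = U.dualAnnihilator.map
      (LinearMap.toContinuousLinearMap : (E →ₗ[ℝ] ℝ) ≃ₗ[ℝ] (E →L[ℝ] ℝ)).toLinearMap := by
    ext μ
    constructor
    · intro hμ
      refine ⟨μ.toLinearMap, (Submodule.mem_dualAnnihilator _).2 hμ, ?_⟩
      ext
      rfl
    · rintro ⟨f, hf, rfl⟩ u hu
      exact (Submodule.mem_dualAnnihilator _).1 hf u hu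
  rw [h]
  exact LinearEquiv.finrank_map_eq _ _

lemma mem_of_continuousAnnihilator {E : Type*} [NormedAddCommGroup E]
    [NormedSpace ℝ E] [FiniteDimensional ℝ E] {U : Submodule ℝ E} {x : E}
    (h : ∀ μ ∈ continuousAnnihilator U, μ x = 0) : x ∈ U := by
  by_contra hx
  obtain ⟨f, hf, hf'⟩ := Submodule.exists_le_ker_of_notMem hx
  exact hf (h (LinearMap.toContinuousLinearMap f) fun u hu => hf' hu)

/-- The linear forms vanishing on all `Ad(γ t) V`. -/
def pathAnnihilator {n : ℕ} {G : Type*} [TopologicalSpace G]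
    [ChartedSpace (EuclideanSpace ℝ (Fin n)) G] [Group G]
    (V : Submodule ℝ (EuclideanSpace ℝ (Fin n))) (γ : ℝ → G) :
    Submodule ℝ (EuclideanSpace ℝ (Fin n) →L[ℝ] ℝ) :=
  ⨅ t ∈ Icc (0 : ℝ) 1, continuousAnnihilator (V.map (adjointRep n (γ t)).toLinearMap)

/-- The covector field along `γ` which is parallel, in the right trivialization, to a covector. -/
def parallelCovector {n : ℕ} {G : Type*} [TopologicalSpace G]
    [ChartedSpace (EuclideanSpace ℝ (Fin n)) G] [Group G] (γ : ℝ → G) :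
    (EuclideanSpace ℝ (Fin n) →L[ℝ] ℝ) →ₗ[ℝ]
      (∀ t : Icc (0 : ℝ) 1, TangentSpace (𝓡 n) (γ t) →L[ℝ] ℝ) where
  toFun μ t := (ofLeftCovector (γ t) (μ.comp (adjointRep n (γ t)))).2
  map_add' _ _ := rfl
  map_smul' _ _ := rfl

variable {γ : ℝ → G} {V : Submodule ℝ (EuclideanSpace ℝ (Fin n))}

lemma mem_pathAnnihilator_iff {μ : 𝔼 →L[ℝ] ℝ} :
    μ ∈ pathAnnihilator V γ ↔ ∀ t ∈ Icc (0 : ℝ) 1, ∀ w ∈ V, μ (adjointRep n (γ t) w) = 0 := by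
  simp only [pathAnnihilator, Submodule.mem_iInf]
  refine forall₂_congr fun t _ => ⟨fun h w hw => h _ ⟨w, hw, rfl⟩, ?_⟩
  rintro h _ ⟨w, hw, rfl⟩
  exact h w hw

lemma parallelCovector_injective (γ : ℝ → G) :
    Function.Injective (parallelCovector (n := n) γ) := by
  have h0 : (0 : ℝ) ∈ Icc (0 : ℝ) 1 := by simp
  intro μ μ' h
  have h1 := congrArg (Sigma.mk (γ 0) : _ → CotangentPoint n G) (congrFun h ⟨0, h0⟩)
  have h2 : μ.comp (adjointRep n (γ 0)) = μ'.comp (adjointRep n (γ 0)) := by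
    rw [← leftCovector_ofLeftCovector (γ 0) (μ.comp (adjointRep n (γ 0))),
      ← leftCovector_ofLeftCovector (γ 0) (μ'.comp (adjointRep n (γ 0)))]
    exact congrArg leftCovector h1
  have h3 := congrArg (fun q : 𝔼 →L[ℝ] ℝ => q.comp (adjointRep n (γ 0)⁻¹)) h2
  simpa only [ContinuousLinearMap.comp_assoc, adjointRep_comp_inv, ContinuousLinearMap.comp_id]
    using h3

lemma mem_pathAnnihilator_of_isAbnormalLift
    {p : ∀ t : ℝ, TangentSpace (𝓡 n) (γ t) →L[ℝ] ℝ}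
    (hp : IsAbnormalLift (leftInvariantDistribution (G := G) V) γ p) {μ : 𝔼 →L[ℝ] ℝ}
    (h : ∀ t ∈ Icc (0 : ℝ) 1,
      leftCovector (⟨γ t, p t⟩ : CotangentPoint n G) = μ.comp (adjointRep n (γ t))) :
    μ ∈ pathAnnihilator V γ := by
  rw [mem_pathAnnihilator_iff]
  intro t ht w hw
  have h1 := (mem_nonzeroAnnihilator_iff.1 (hp.1 t ht)).2 w hw
  rwa [h t ht] at h1

/-- Both directions of the preceding part, with the linear structure added: the nonzero elements of
the right side are exactly lifts, and zero is supplied by the span. -/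
lemma abnormalLiftSpace_eq
    (hγ : IsHorizontalPath (leftInvariantDistribution (G := G) V) γ) :
    abnormalLiftSpace (leftInvariantDistribution (G := G) V) γ =
      (pathAnnihilator V γ).map (parallelCovector γ) := by
  refine le_antisymm (Submodule.span_le.2 ?_) ?_
  · rintro q ⟨p, hp, hq⟩
    obtain ⟨μ, -, h⟩ := exists_eq_comp_adjointRep_of_isAbnormalLift hγ hp
    refine ⟨μ, mem_pathAnnihilator_of_isAbnormalLift hp h, funext fun t => ?_⟩
    rw [hq t]
    have h1 := ofLeftCovector_leftCovector (⟨γ t, p t⟩ : CotangentPoint n G)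
    rw [h t t.2] at h1
    exact eq_of_heq (Sigma.ext_iff.1 h1).2
  · rintro _ ⟨μ, hμ, rfl⟩
    by_cases h0 : μ = 0
    · rw [h0, map_zero]
      exact Submodule.zero_mem _
    · exact Submodule.subset_span
        ⟨_, isAbnormalLift_of_comp_adjointRep hγ h0 (mem_pathAnnihilator_iff.1 hμ),
          fun _ => rfl⟩

lemma pathCorank_eq (hγ : IsHorizontalPath (leftInvariantDistribution (G := G) V) γ) :
    pathCorank (leftInvariantDistribution (G := G) V) γ =
      Module.finrank ℝ (pathAnnihilator V γ) := by
  rw [pathCorank, abnormalLiftSpace_eq hγ]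
  exact ((pathAnnihilator V γ).equivMapOfInjective _
    (parallelCovector_injective γ)).finrank_eq.symm

lemma finrank_map_adjointRep (x : G) :
    Module.finrank ℝ (V.map (adjointRep n x).toLinearMap) = Module.finrank ℝ V := by
  refine (V.equivMapOfInjective _ ?_).finrank_eq.symm
  refine Function.LeftInverse.injective (g := adjointRep n x⁻¹) fun w => ?_
  exact congrArg (fun T : 𝔼 →L[ℝ] 𝔼 => T w) (adjointRep_inv_comp x)

/-- End-points of minimal rank singular paths are the end-points of horizontal paths along which
`Ad(γ) V` is constant. -/
lemma mem_abnSet_iff (hV : V ≠ ⊤) {x y : G} :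
    y ∈ abnSet (leftInvariantDistribution (G := G) V) (Module.finrank ℝ V) x ↔
      ∃ γ : ℝ → G, γ 0 = x ∧ γ 1 = y ∧
        IsHorizontalPath (leftInvariantDistribution (G := G) V) γ ∧
        ∀ t ∈ Icc (0 : ℝ) 1, ∀ w ∈ V,
          adjointRep n (γ t) w ∈ V.map (adjointRep n (γ 0)).toLinearMap := by
  -- The annihilator of the initial space alone has dimension `n - m` and contains `pathAnnihilator
  -- V γ`. Corank `n - m` therefore means equality, so no `Ad(γ t) V` adds anything.
  have hrank : ∀ γ : ℝ → G, Module.finrank ℝ V + Module.finrank ℝ (continuousAnnihilator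
      (V.map (adjointRep n (γ 0)).toLinearMap)) = n := by
    intro γ
    have h1 := finrank_add_finrank_continuousAnnihilator
      (V.map (adjointRep n (γ 0)).toLinearMap)
    rwa [finrank_map_adjointRep, finrank_euclideanSpace_fin] at h1
  have hle : ∀ γ : ℝ → G, pathAnnihilator V γ ≤ continuousAnnihilator
      (V.map (adjointRep n (γ 0)).toLinearMap) := fun γ =>
    iInf₂_le (0 : ℝ) (by simp)
  refine exists_congr fun γ => and_congr_right fun _ => and_congr_right fun _ => ?_
  constructor
  · rintro ⟨⟨hγ, -⟩, hc⟩
    rw [pathCorank_eq hγ] at hc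
    have heq := Submodule.eq_of_le_of_finrank_eq (hle γ) (by have := hrank γ; omega)
    refine ⟨hγ, fun t ht w hw => mem_of_continuousAnnihilator fun μ hμ => ?_⟩
    rw [← heq, mem_pathAnnihilator_iff] at hμ
    exact hμ t ht w hw
  · rintro ⟨hγ, h⟩
    have heq : pathAnnihilator V γ = continuousAnnihilator
        (V.map (adjointRep n (γ 0)).toLinearMap) :=
      le_antisymm (hle γ) fun μ hμ =>
        mem_pathAnnihilator_iff.2 fun t ht w hw => hμ _ (h t ht w hw)
    -- Properness of `V` provides a nonzero covector, without which the path would not be singular.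
    have hlt : Module.finrank ℝ V < n := by
      have := Submodule.finrank_lt hV
      rwa [finrank_euclideanSpace_fin] at this
    have hne : pathAnnihilator V γ ≠ ⊥ := by
      intro h0
      have := hrank γ
      rw [← heq, h0, finrank_bot] at this
      omega
    obtain ⟨μ, hμ, hμ0⟩ := Submodule.exists_mem_ne_zero_of_ne_bot hne
    refine ⟨⟨hγ, _, isAbnormalLift_of_comp_adjointRep hγ hμ0 (mem_pathAnnihilator_iff.1 hμ)⟩, ?_⟩
    rw [pathCorank_eq hγ, heq]
    exact hrank γ

end Corank
end

/-! ### End-points of minimal rank paths and null sets. -/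

noncomputable section

section MinimalRank

variable {n : ℕ} {G : Type*} [TopologicalSpace G] [ChartedSpace (EuclideanSpace ℝ (Fin n)) G]
  [Group G] {F : Type*} [NormedAddCommGroup F] [NormedSpace ℝ F]

local notation "𝔼" => EuclideanSpace ℝ (Fin n)
local notation "φ₁" => extChartAt (𝓡 n) (1 : G)
local notation "ex" => lieExp n G

variable [LieGroup (𝓡 n) ∞ G]

/-- The subspace of the elements of `V` which normalize `V`. -/
def stabilizerSubmodule (n : ℕ) (G : Type*) [TopologicalSpace G]
    [ChartedSpace (EuclideanSpace ℝ (Fin n)) G] [Group G]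
    (V : Submodule ℝ (EuclideanSpace ℝ (Fin n))) : Submodule ℝ (EuclideanSpace ℝ (Fin n)) where
  carrier := {v | v ∈ V ∧ ∀ w ∈ V, adCLM n G v w ∈ V}
  add_mem' := by
    rintro a b ⟨ha, ha'⟩ ⟨hb, hb'⟩
    refine ⟨V.add_mem ha hb, fun w hw => ?_⟩
    rw [map_add]
    exact V.add_mem (ha' w hw) (hb' w hw)
  zero_mem' := by
    refine ⟨V.zero_mem, fun w _ => ?_⟩
    rw [map_zero]
    exact V.zero_mem
  smul_mem' := by
    rintro c a ⟨ha, ha'⟩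
    refine ⟨V.smul_mem c ha, fun w hw => ?_⟩
    rw [map_smul]
    exact V.smul_mem c (ha' w hw)

variable {γ : ℝ → G} {V : Submodule ℝ (EuclideanSpace ℝ (Fin n))}

/-- By the Jacobi identity, `ad [x, y]` is the commutator of two operators preserving `V`. -/
lemma adCLM_mem_stabilizerSubmodule :
    ∀ x ∈ stabilizerSubmodule n G V, ∀ y ∈ stabilizerSubmodule n G V,
      adCLM n G x y ∈ stabilizerSubmodule n G V := by
  rintro x ⟨-, hx⟩ y ⟨hyV, hy⟩
  refine ⟨hx y hyV, fun w hw => ?_⟩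
  rw [← sub_eq_iff_eq_add.2 (adCLM_jacobi x y w)]
  exact V.sub_mem (hx _ (hy w hw)) (hy _ (hx w hw))

lemma stabilizerSubmodule_le : stabilizerSubmodule n G V ≤ V := fun _ h => h.1

lemma map_adjointRep_eq {x : G} (h : ∀ w ∈ V, adjointRep n x w ∈ V) :
    V.map (adjointRep n x).toLinearMap = V := by
  refine Submodule.eq_of_le_of_finrank_eq ?_ (finrank_map_adjointRep x)
  rintro _ ⟨w, hw, rfl⟩
  exact h w hw

/-- The control of a curve along which `Ad(γ)` preserves `V` normalizes `V`. -/
lemma mem_stabilizerSubmodule_of_hasLeftVelocity {t : ℝ} {u : 𝔼} (hu : HasLeftVelocity γ t u)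
    (huV : u ∈ V) (h : ∀ᶠ s in 𝓝 t, ∀ w ∈ V, adjointRep n (γ s) w ∈ V) :
    u ∈ stabilizerSubmodule n G V := by
  refine ⟨huV, fun w hw => ?_⟩
  -- This vector is the derivative at `t` of `Ad(γ s) w`, which stays in `V`; linear forms vanishing
  -- on `V` detect that the derivative does too.
  have h1 : adjointRep n (γ t) (adCLM n G u w) ∈ V := by
    refine mem_of_continuousAnnihilator fun μ hμ => ?_
    have h2 := (hasDerivAt_const t μ).clm_apply
      (hu.hasDerivAt_adjointRep.clm_apply (hasDerivAt_const t w))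
    have h3 : (fun s => μ (adjointRep n (γ s) w)) =ᶠ[𝓝 t] fun _ => 0 := by
      filter_upwards [h] with s hs
      exact hμ _ (hs w hw)
    have h4 := h2.unique ((hasDerivAt_const t (0 : ℝ)).congr_of_eventuallyEq h3)
    simpa using h4
  -- By dimension `Ad(γ t)` maps `V` onto `V`, so it can be removed.
  rw [← map_adjointRep_eq h.self_of_nhds] at h1
  obtain ⟨w', hw', he⟩ := h1
  have h5 := congrArg (adjointRep n (γ t)⁻¹) he
  have h6 : ∀ z, adjointRep n (γ t)⁻¹ (adjointRep n (γ t) z) = z := fun z =>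
    congrArg (fun T : 𝔼 →L[ℝ] 𝔼 => T z) (adjointRep_inv_comp (γ t))
  have h7 : w' = adCLM n G u w := (h6 w').symm.trans (h5.trans (h6 _))
  rwa [← h7]

lemma adjointRep_exp_mem {K : ℕ} {D : ℕ → Submodule ℝ 𝔼} (h : IsNilpotentFiltration n G K D)
    {v : 𝔼} (hv : v ∈ stabilizerSubmodule n G V) (t : ℝ) {w : 𝔼} (hw : w ∈ V) :
    adjointRep n (ex (t • v)) w ∈ V := by
  rw [adjointRep_exp_eq_sum (h.pow_eq_zero v)]
  have h1 : ∀ k : ℕ, (adCLM n G v ^ k) w ∈ V := by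
    intro k
    induction k with
    | zero => simpa using hw
    | succ k ih =>
      rw [pow_succ']
      exact hv.2 _ ih
  rw [sum_apply]
  exact V.sum_mem fun k _ => V.smul_mem _ (h1 k)

lemma map_adjointRep_one : V.map (adjointRep n (1 : G)).toLinearMap = V := by
  rw [adjointRep_one]
  exact Submodule.map_id V

lemma abnSet_one_eq {K : ℕ} {D : ℕ → Submodule ℝ 𝔼} (h : IsNilpotentFiltration n G K D)
    (hV : V ≠ ⊤) :
    abnSet (leftInvariantDistribution V) (Module.finrank ℝ V) (1 : G) =
      ex '' stabilizerSubmodule n G V := by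
  ext y
  rw [mem_abnSet_iff hV]
  constructor
  · rintro ⟨γ, h0, rfl, hγ, hAd⟩
    rw [h0, map_adjointRep_one] at hAd
    obtain ⟨hac, u, hL, hu⟩ := isHorizontalPath_iff.1 hγ
    refine mem_exp_image_of_control h adCLM_mem_stabilizerSubmodule (a := 0)
      (Submodule.zero_mem _) hac (hL.integrable one_le_two) ?_ (hu.mono fun t ht => ht.2)
      (by rw [h0, exp_zero])
    filter_upwards [hu, ae_mem_Ioo] with t ht htI
    refine mem_stabilizerSubmodule_of_hasLeftVelocity ht.2 ht.1 ?_
    filter_upwards [Ioo_mem_nhds htI.1 htI.2] with s hs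
    exact hAd s (Ioo_subset_Icc_self hs)
  · rintro ⟨v, hv, rfl⟩
    refine ⟨fun t : ℝ => 1 * ex (t • v), by simp [exp_zero], by simp,
      isHorizontalPath_mul_exp h (stabilizerSubmodule_le hv) 1, fun t _ w hw => ?_⟩
    simp only [one_mul, zero_smul, exp_zero, map_adjointRep_one]
    exact adjointRep_exp_mem h hv t hw

/-- The criterion of `mem_abnSet_iff` is left invariant: `Ad(g)` acts on both sides of the
inclusion. -/
lemma mul_mem_abnSet (hV : V ≠ ⊤) (g : G) {x y : G}
    (hy : y ∈ abnSet (leftInvariantDistribution V) (Module.finrank ℝ V) x) :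
    g * y ∈ abnSet (leftInvariantDistribution V) (Module.finrank ℝ V) (g * x) := by
  rw [mem_abnSet_iff hV] at hy ⊢
  obtain ⟨γ, rfl, rfl, hγ, hAd⟩ := hy
  refine ⟨fun t => g * γ t, rfl, rfl, hγ.mul_left g, fun t ht w hw => ?_⟩
  obtain ⟨w', hw', he⟩ := hAd t ht w hw
  refine ⟨w', hw', ?_⟩
  rw [adjointRep_mul, adjointRep_mul]
  exact congrArg (adjointRep n g) he

lemma abnSet_eq_image (hV : V ≠ ⊤) (g : G) :
    abnSet (leftInvariantDistribution V) (Module.finrank ℝ V) g =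
      (fun h : G => g * h) ''
        abnSet (leftInvariantDistribution V) (Module.finrank ℝ V) (1 : G) := by
  ext y
  constructor
  · intro hy
    have h1 := mul_mem_abnSet hV g⁻¹ hy
    rw [inv_mul_cancel] at h1
    exact ⟨_, h1, mul_inv_cancel_left g y⟩
  · rintro ⟨z, hz, rfl⟩
    have h1 := mul_mem_abnSet hV g hz
    rwa [mul_one] at h1

/-- A proper subspace is null, and differentiable maps between spaces of equal dimension send null
sets to null sets. -/
lemma isLebesgueNull_mul_exp {K : ℕ} {D : ℕ → Submodule ℝ 𝔼}
    (h : IsNilpotentFiltration n G K D) {H : Submodule ℝ 𝔼} (hH : H ≠ ⊤) (g : G) :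
    IsLebesgueNull n ((fun x : G => g * x) '' (ex '' H)) := by
  intro e he
  have h1 : e '' ((fun x : G => g * x) '' (ex '' H) ∩ e.source) =
      (fun v : 𝔼 => e (g * ex v)) '' {v : 𝔼 | v ∈ H ∧ g * ex v ∈ e.source} := by
    ext z
    constructor
    · rintro ⟨_, ⟨⟨_, ⟨v, hv, rfl⟩, rfl⟩, hs⟩, rfl⟩
      exact ⟨v, ⟨hv, hs⟩, rfl⟩
    · rintro ⟨v, ⟨hv, hs⟩, rfl⟩
      exact ⟨_, ⟨⟨_, ⟨v, hv, rfl⟩, rfl⟩, hs⟩, rfl⟩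
  rw [h1]
  refine addHaar_image_eq_zero_of_differentiableOn_of_addHaar_eq_zero volume ?_
    (measure_mono_null (fun v hv => hv.1) (Measure.addHaar_submodule volume H hH))
  rintro v ⟨-, hs⟩
  have h2 : MDifferentiableAt (𝓡 n) 𝓘(ℝ, 𝔼) e (g * ex v) :=
    (contMDiffAt_of_mem_maximalAtlas he hs).mdifferentiableAt (by simp)
  have h3 : MDifferentiableAt (𝓡 n) 𝓘(ℝ, 𝔼) (fun z => e (g * z)) (ex v) :=
    MDifferentiableAt.comp (I' := 𝓡 n) (g := e) (ex v) h2 (mdifferentiableAt_leftMul _ _)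
  exact (hasFDerivAt_comp_exp (h.pow_eq_zero v) h3).differentiableAt.differentiableWithinAt

lemma isLebesgueNull_exp {K : ℕ} {D : ℕ → Submodule ℝ 𝔼}
    (h : IsNilpotentFiltration n G K D) {H : Submodule ℝ 𝔼} (hH : H ≠ ⊤) :
    IsLebesgueNull n (ex '' H) := by
  have h1 := isLebesgueNull_mul_exp h hH 1
  simpa only [one_mul, image_id'] using h1

lemma not_isLebesgueNull_univ : ¬ IsLebesgueNull n (univ : Set G) := by
  intro h
  have h1 := h (chartAt 𝔼 (1 : G)) (IsManifold.chart_mem_maximalAtlas 1)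
  rw [univ_inter, OpenPartialHomeomorph.image_source_eq_target] at h1
  exact ((chartAt 𝔼 (1 : G)).open_target.measure_pos volume
    ⟨_, (chartAt 𝔼 (1 : G)).map_source (mem_chart_source 𝔼 1)⟩).ne' h1

/-- The normalizer of `V` in `V` as a Lie subalgebra. -/
def stabilizerLieSubalgebra (V : Submodule ℝ (GroupLieAlgebra (𝓡 n) G)) :
    LieSubalgebra ℝ (GroupLieAlgebra (𝓡 n) G) where
  carrier := stabilizerSet V
  add_mem' := by
    rintro a b ⟨ha, ha'⟩ ⟨hb, hb'⟩
    refine ⟨V.add_mem ha hb, fun w hw => ?_⟩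
    rw [add_lie]
    exact V.add_mem (ha' w hw) (hb' w hw)
  zero_mem' := by
    refine ⟨V.zero_mem, fun w _ => ?_⟩
    rw [zero_lie]
    exact V.zero_mem
  smul_mem' := by
    rintro c a ⟨ha, ha'⟩
    refine ⟨V.smul_mem c ha, fun w hw => ?_⟩
    rw [smul_lie]
    exact V.smul_mem c (ha' w hw)
  lie_mem' := by
    rintro a b ⟨-, ha⟩ ⟨hbV, hb⟩
    refine ⟨ha b hbV, fun w hw => ?_⟩
    rw [lie_lie]
    exact V.sub_mem (ha _ (hb w hw)) (hb _ (ha w hw))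

lemma image_stabilizerSet (V : Submodule ℝ (GroupLieAlgebra (𝓡 n) G)) :
    groupExp '' stabilizerSet V = ex '' stabilizerSubmodule n G V := by
  have h1 : ∀ v : GroupLieAlgebra (𝓡 n) G,
      v ∈ stabilizerSet V ↔ (v : 𝔼) ∈ stabilizerSubmodule n G V := by
    intro v
    refine and_congr_right fun _ => forall₂_congr fun w _ => ?_
    exact iff_of_eq (congrArg (fun z : GroupLieAlgebra (𝓡 n) G => z ∈ V) (lie_eq_adCLM v w))
  ext y
  constructor
  · rintro ⟨v, hv, rfl⟩
    exact ⟨v, (h1 v).1 hv, rfl⟩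
  · rintro ⟨v, hv, rfl⟩
    exact ⟨v, (h1 v).2 hv, rfl⟩

/-- `V` is the first summand of the sum as soon as the sum is nonempty. -/
lemma ne_top_of_bracketSum_ne_top {V : Submodule ℝ (GroupLieAlgebra (𝓡 n) G)} {k : ℕ}
    (hk : 1 ≤ k) (h : bracketSum V k ≠ ⊤) : V ≠ ⊤ := by
  rintro rfl
  obtain ⟨j, rfl⟩ := Nat.exists_eq_add_of_le' hk
  apply h
  rw [bracketSum, Finset.sum_range_succ']
  exact top_le_iff.1 (le_sup_right (b := (⊤ : Submodule ℝ (GroupLieAlgebra (𝓡 n) G))))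

end MinimalRank
end

theorem mainTheorem9 (n : ℕ) (G : Type*) [TopologicalSpace G]
    [ChartedSpace (EuclideanSpace ℝ (Fin n)) G] [Group G] [LieGroup (𝓡 n) ∞ G] [ConnectedSpace G]
    (V : Submodule ℝ (GroupLieAlgebra (𝓡 n) G)) (s : ℕ) (hs : 2 ≤ s)
    (hV : IsBracketGeneratingOfStep V s) (hnil : IsBracketNilpotent V) :
    (∃ 𝔥 : LieSubalgebra ℝ (GroupLieAlgebra (𝓡 n) G),
      (𝔥 : Set (GroupLieAlgebra (𝓡 n) G)) = stabilizerSet V ∧ 𝔥 ≠ ⊤) ∧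
    abnSet (leftInvariantDistribution V) (Module.finrank ℝ V) (1 : G) =
      groupExp '' stabilizerSet V ∧
    (∃ H : Subgroup G, (H : Set G) = groupExp '' stabilizerSet V ∧ H ≠ ⊤) ∧
    IsLebesgueNull n (groupExp '' stabilizerSet V) ∧
    (∀ g : G, abnSet (leftInvariantDistribution V) (Module.finrank ℝ V) g =
      (fun h : G => g * h) '' abnSet (leftInvariantDistribution V) (Module.finrank ℝ V) (1 : G)) ∧
    MinimalRankSard (leftInvariantDistribution V) (Module.finrank ℝ V) := by
  -- Here `s ≥ 2` enters: the proper subspace `V^1 + ⋯ + V^(s-1)` contains `V`.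
  have hVtop : V ≠ ⊤ := ne_top_of_bracketSum_ne_top (by omega) hV.1
  obtain ⟨K, D, hD⟩ := exists_isNilpotentFiltration hV.2 hnil
  have hStop : stabilizerSubmodule n G V ≠ ⊤ := fun h =>
    hVtop (top_le_iff.1 (h.symm.le.trans stabilizerSubmodule_le))
  have habn : ∀ g : G, abnSet (leftInvariantDistribution V) (Module.finrank ℝ V) g =
      (fun h : G => g * h) '' abnSet (leftInvariantDistribution V) (Module.finrank ℝ V) (1 : G) :=
    abnSet_eq_image hVtop
  have hone : abnSet (leftInvariantDistribution V) (Module.finrank ℝ V) (1 : G) =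
      groupExp '' stabilizerSet V := by
    rw [image_stabilizerSet]
    exact abnSet_one_eq hD hVtop
  have hnull : IsLebesgueNull n (groupExp '' stabilizerSet V) := by
    rw [image_stabilizerSet]
    exact isLebesgueNull_exp hD hStop
  refine ⟨⟨stabilizerLieSubalgebra V, rfl, fun h => hVtop (eq_top_iff.2 fun v _ => ?_)⟩, hone,
    ⟨expSubgroup hD _ adCLM_mem_stabilizerSubmodule, (image_stabilizerSet V).symm, fun h => ?_⟩,
    hnull, habn, fun g => ?_⟩
  · have hv : v ∈ stabilizerLieSubalgebra V := h ▸ LieSubalgebra.mem_top v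
    exact hv.1
  -- Properness of the subgroup follows from measure: if it were all of `G`, then `G` itself would
  -- be null.
  · refine not_isLebesgueNull_univ (n := n) (G := G) ?_
    rw [← Subgroup.coe_top, ← h]
    exact isLebesgueNull_exp hD hStop
  · rw [habn g, hone, image_stabilizerSet]
    exact isLebesgueNull_mul_exp hD hStop g
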